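/- Let $1\le n\le\infty$, and let $n\text{-}\mathrm{Cat}$ be the category of small strict $n$-categories and strict $n$-functors, regarded as the full subcategory of $\infty\text{-}\mathrm{Cat}$ of those strict $\infty$-categories all of whose $i$-cells with $i>n$ are identities. For $m\ge 0$ let $\Delta_m=\{0<1<\dots<m\}$, let $\mathcal O_m$ be Street's $m$-th oriental, and let $\mathcal O_m^{\le n}$ be its intelligent $n$-truncation: for finite $n$, its $i$-cells with $i<n$ are those of $\mathcal O_m$, and its $n$-cells are those of $\mathcal O_m$ modulo the equivalence relation that identifies two $n$-cells connected by a zigzag of $(n+1)$-cells; moreover $\mathcal O_m^{\le\infty}=\mathcal O_m$. Let $N_n : n\text{-}\mathrm{Cat}\to\widehat\Delta$ be the nerve functor to simplicial sets associated with the cosimplicial object $\Delta_m\mapsto\mathcal O_m^{\le n}$, that is, $$N_n(C)_m=\mathrm{Hom}_{n\text{-}\mathrm{Cat}}(\mathcal O_m^{\le n},C).$$ Let $N:\mathrm{Ord}\to\widehat\Delta$ denote the usual nerve of partially ordered sets. Let $\partial_0,\partial_1:\Delta_0\to\Delta_1$ be the maps with values $0$ and $1$. In $\mathrm{Ord}$,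 and likewise in $n\text{-}\mathrm{Cat}$ (where $\Delta_0$ and $\Delta_1$ are viewed as $n$-categories with only identity $i$-cells for $i>1$), a morphism $X'\to X$ is called a *sieve* (resp. a *cosieve*) if it is the pullback of $\partial_0$ (resp. of $\partial_1$) along some morphism $X\to\Delta_1$. **Proposition.** For every $n$ with $1\le n\le\infty$, the functor $N_n$ has a left adjoint $c_n:\widehat\Delta\to n\text{-}\mathrm{Cat}$, and: (a) the functor $N_n$ commutes with small filtered colimits; (b) the functor $N_n$ sends every pushout square of $n\text{-}\mathrm{Cat}$ all of whose four arrows are cosieves to a pushout square of simplicial sets; (c) the functor $c_nN$ sends sieves (resp. cosieves) of $\mathrm{Ord}$ to sieves (resp. cosieves) of $n\text{-}\mathrm{Cat}$. -/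

import Mathlib

open CategoryTheory CategoryTheory.Limits

universe u

/-! ### Strict `∞`-categories and strict `n`-categories -/

/-- A small strict `∞`-category, in the one-set presentation: an `i`-cell is identified with all
its iterated identities, so that there is a single set of cells.  `bd false k x` is the iterated
`k`-dimensional source and `bd true k x` the iterated `k`-dimensional target of `x`; a cell has
dimension at most `k` exactly when `bd false k x = x`.  `comp k x y` is the composite `x *_k y`
(first `y`, then `x`), defined when the `k`-source of `x` is the `k`-target of `y`. -/
structure OmegaCat : Type (u + 1) where
  Cell : Type u
  bd : Bool → ℕ → Cell → Cell
  comp : (k : ℕ) → (x y : Cell) → bd false k x = bd true k y → Cell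
  bd_bd_of_lt : ∀ (a b : Bool) (j k : ℕ) (x : Cell), j < k → bd a j (bd b k x) = bd a j x
  bd_bd_of_le : ∀ (a b : Bool) (j k : ℕ) (x : Cell), j ≤ k → bd a k (bd b j x) = bd b j x
  /-- Every cell has finite dimension. -/
  exists_dim : ∀ x : Cell, ∃ k : ℕ, bd false k x = x
  src_comp : ∀ (k : ℕ) (x y : Cell) (h : bd false k x = bd true k y),
    bd false k (comp k x y h) = bd false k y
  tgt_comp : ∀ (k : ℕ) (x y : Cell) (h : bd false k x = bd true k y),
    bd true k (comp k x y h) = bd true k x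
  bd_comp : ∀ (a : Bool) (j k : ℕ) (x y : Cell) (h : bd false j x = bd true j y)
    (h' : bd false j (bd a k x) = bd true j (bd a k y)), j < k →
    bd a k (comp j x y h) = comp j (bd a k x) (bd a k y) h'
  comp_unit : ∀ (k : ℕ) (x : Cell) (h : bd false k x = bd true k (bd false k x)),
    comp k x (bd false k x) h = x
  unit_comp : ∀ (k : ℕ) (x : Cell) (h : bd false k (bd true k x) = bd true k x),
    comp k (bd true k x) x h = x
  assoc : ∀ (k : ℕ) (x y z : Cell) (hxy : bd false k x = bd true k y)
    (hyz : bd false k y = bd true k z) (h : bd false k (comp k x y hxy) = bd true k z)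
    (h' : bd false k x = bd true k (comp k y z hyz)),
    comp k (comp k x y hxy) z h = comp k x (comp k y z hyz) h'
  interchange : ∀ (j k : ℕ) (x y z w : Cell), j < k →
    ∀ (hxy : bd false k x = bd true k y) (hzw : bd false k z = bd true k w)
    (hxz : bd false j x = bd true j z) (hyw : bd false j y = bd true j w)
    (h : bd false j (comp k x y hxy) = bd true j (comp k z w hzw))
    (h' : bd false k (comp j x z hxz) = bd true k (comp j y w hyw)),
    comp j (comp k x y hxy) (comp k z w hzw) h = comp k (comp j x z hxz) (comp j y w hyw) h'

namespace OmegaCat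

/-- Strict `∞`-functors. -/
@[ext]
structure Hom (C D : OmegaCat.{u}) : Type u where
  toFun : C.Cell → D.Cell
  map_bd : ∀ (a : Bool) (k : ℕ) (x : C.Cell), toFun (C.bd a k x) = D.bd a k (toFun x)
  map_comp : ∀ (k : ℕ) (x y : C.Cell) (h : C.bd false k x = C.bd true k y)
    (h' : D.bd false k (toFun x) = D.bd true k (toFun y)),
    toFun (C.comp k x y h) = D.comp k (toFun x) (toFun y) h'

instance : Category.{u} OmegaCat.{u} where
  Hom := Hom
  id C := { toFun := fun x => x, map_bd := fun _ _ _ => rfl, map_comp := fun _ _ _ _ _ => rfl }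
  comp {C D E} f g :=
    { toFun := fun x => g.toFun (f.toFun x)
      map_bd := fun a k x => by rw [f.map_bd, g.map_bd]
      map_comp := fun k x y h h' => by
        have h₁ : D.bd false k (f.toFun x) = D.bd true k (f.toFun y) := by
          rw [← f.map_bd, ← f.map_bd, h]
        rw [f.map_comp k x y h h₁, g.map_comp k _ _ h₁ h'] }

@[ext]
theorem hom_ext {C D : OmegaCat.{u}} (f g : C ⟶ D) (h : ∀ x, Hom.toFun f x = Hom.toFun g x) :
    f = g :=
  Hom.ext (funext h)

/-- The cell `x` has dimension at most `n`, that is, it is an `n`-cell or an iterated identity. -/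
def IsCell (C : OmegaCat.{u}) (n : ℕ∞) (x : C.Cell) : Prop :=
  ∀ k : ℕ, n ≤ k → C.bd false k x = x

theorem IsCell.bd_eq {C : OmegaCat.{u}} {n : ℕ∞} {x : C.Cell} (hx : C.IsCell n x) (a : Bool)
    {k : ℕ} (hk : n ≤ k) : C.bd a k x = x := by
  have h := hx k hk
  rw [← h, C.bd_bd_of_le _ _ _ _ _ le_rfl]

theorem isCell_bd_of_le (C : OmegaCat.{u}) {n : ℕ∞} {j : ℕ} (hj : (j : ℕ∞) ≤ n) (a : Bool)
    (x : C.Cell) : C.IsCell n (C.bd a j x) := fun k hk =>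
  C.bd_bd_of_le _ _ _ _ _ (by exact_mod_cast hj.trans hk)

theorem IsCell.bd {C : OmegaCat.{u}} {n : ℕ∞} {x : C.Cell} (hx : C.IsCell n x) (a : Bool)
    (j : ℕ) : C.IsCell n (C.bd a j x) := by
  rcases le_total (j : ℕ∞) n with h | h
  · exact C.isCell_bd_of_le h a x
  · rw [hx.bd_eq a h]; exact hx

theorem bd_bd_congr (C : OmegaCat.{u}) {j : ℕ} {x y : C.Cell}
    (h : C.bd false j x = C.bd true j y) (a : Bool) {k : ℕ} (hjk : j < k) :
    C.bd false j (C.bd a k x) = C.bd true j (C.bd a k y) := by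
  rw [C.bd_bd_of_lt _ _ _ _ _ hjk, C.bd_bd_of_lt _ _ _ _ _ hjk, h]

theorem comp_congr (C : OmegaCat.{u}) {k : ℕ} {x x' y y' : C.Cell} (hx : x = x') (hy : y = y')
    (h : C.bd false k x = C.bd true k y) (h' : C.bd false k x' = C.bd true k y') :
    C.comp k x y h = C.comp k x' y' h' := by
  subst hx; subst hy; rfl

theorem IsCell.comp {C : OmegaCat.{u}} {n : ℕ∞} {x y : C.Cell} (hx : C.IsCell n x)
    (hy : C.IsCell n y) (j : ℕ) (h : C.bd false j x = C.bd true j y) :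
    C.IsCell n (C.comp j x y h) := by
  intro k hk
  rcases lt_or_ge j k with hjk | hjk
  · rw [C.bd_comp _ _ _ _ _ h (C.bd_bd_congr h _ hjk) hjk]
    exact C.comp_congr (hx k hk) (hy k hk) _ _
  · have hnj : n ≤ j := hk.trans (by exact_mod_cast hjk)
    have hxy : x = y := by
      have := h
      rwa [hx.bd_eq _ hnj, hy.bd_eq _ hnj] at this
    have : C.comp j x y h = x := by
      subst hxy
      have e : C.bd false j x = x := hx j hnj
      calc C.comp j x x h = C.comp j x (C.bd false j x)
            (by rw [C.bd_bd_of_le _ _ _ _ _ le_rfl]) := C.comp_congr rfl e.symm _ _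
        _ = x := C.comp_unit _ _ _
    rw [this]; exact hx k hk

end OmegaCat

/-- The property of being an `n`-category: all cells of dimension greater than `n` are
identities. -/
def IsNCat (n : ℕ∞) : ObjectProperty OmegaCat.{u} := fun C => ∀ x : C.Cell, C.IsCell n x

/-- The category of small strict `n`-categories and strict `n`-functors, for `n ≤ ∞`, as a full
subcategory of the category of strict `∞`-categories. -/
abbrev NCat (n : ℕ∞) : Type (u + 1) := (IsNCat.{u} n).FullSubcategory

/-! ### Intelligent truncation -/

namespace OmegaCat

/-- Two cells of dimension at most `n` are elementarily related when `n` is finite and they are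
the source and the target of a cell of dimension at most `n + 1`. -/
def TruncRel (C : OmegaCat.{u}) (n : ℕ∞) (x y : {x : C.Cell // C.IsCell n x}) : Prop :=
  ∃ (k : ℕ) (z : C.Cell), n = k ∧ C.IsCell (n + 1) z ∧ C.bd false k z = x ∧ C.bd true k z = y

/-- The equivalence relation "connected by a zigzag of `(n+1)`-cells". -/
def truncSetoid (C : OmegaCat.{u}) (n : ℕ∞) : Setoid {x : C.Cell // C.IsCell n x} :=
  Relation.EqvGen.setoid (C.TruncRel n)

/-- The cells of the intelligent `n`-truncation. -/
def TruncCell (C : OmegaCat.{u}) (n : ℕ∞) : Type u := Quotient (C.truncSetoid n)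

namespace TruncCell

variable {C : OmegaCat.{u}} {n : ℕ∞}

def mk (x : C.Cell) (hx : C.IsCell n x) : C.TruncCell n :=
  Quotient.mk (C.truncSetoid n) ⟨x, hx⟩

theorem ind {p : C.TruncCell n → Prop} (h : ∀ x hx, p (mk x hx)) (x : C.TruncCell n) : p x :=
  Quotient.inductionOn x fun y => h y.1 y.2

theorem mk_eq_of_eq {x y : C.Cell} {hx : C.IsCell n x} {hy : C.IsCell n y} (h : x = y) :
    mk x hx = mk y hy := by subst h; rfl

theorem mk_eq_of_cell {k : ℕ} (hn : n = k) {z : C.Cell} (hz : C.IsCell (n + 1) z)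
    {x y : C.Cell} {hx : C.IsCell n x} {hy : C.IsCell n y}
    (h₁ : C.bd false k z = x) (h₂ : C.bd true k z = y) : mk x hx = mk y hy :=
  Quotient.sound (s := C.truncSetoid n) (Relation.EqvGen.rel _ _ ⟨k, z, hn, hz, h₁, h₂⟩)

/-- A map out of the cells of the truncation. -/
def lift {β : Type*} (f : (x : C.Cell) → C.IsCell n x → β)
    (hf : ∀ (k : ℕ) (z : C.Cell) (hn : n = k), C.IsCell (n + 1) z →
      f (C.bd false k z) (C.isCell_bd_of_le hn.ge _ z) =
        f (C.bd true k z) (C.isCell_bd_of_le hn.ge _ z)) :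
    C.TruncCell n → β :=
  Quotient.lift (s := C.truncSetoid n) (fun x => f x.1 x.2) (by
    intro x y h
    change Relation.EqvGen _ x y at h
    induction h with
    | rel x y h =>
      obtain ⟨x, hx⟩ := x
      obtain ⟨y, hy⟩ := y
      obtain ⟨k, z, hn, hz, h₁, h₂⟩ := h
      dsimp only at h₁ h₂
      subst h₁; subst h₂
      exact hf k z hn hz
    | refl x => rfl
    | symm x y _ ih => exact ih.symm
    | trans x y z _ _ ih₁ ih₂ => exact ih₁.trans ih₂)

/-- Sources and targets are induced by those of `C`. -/
def bd (a : Bool) (j : ℕ) : C.TruncCell n → C.TruncCell n :=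
  lift (fun x hx => mk (C.bd a j x) (hx.bd a j)) (by
    intro k z hn hz
    rcases lt_or_ge j k with h | h
    · exact mk_eq_of_eq (by rw [C.bd_bd_of_lt _ _ _ _ _ h, C.bd_bd_of_lt _ _ _ _ _ h])
    · exact mk_eq_of_cell hn hz (C.bd_bd_of_le _ _ _ _ _ h).symm
        (C.bd_bd_of_le _ _ _ _ _ h).symm)

@[simp]
theorem bd_mk (a : Bool) (j : ℕ) (x : C.Cell) (hx : C.IsCell n x) :
    bd a j (mk x hx) = mk (C.bd a j x) (hx.bd a j) := rfl

/-- Below dimension `n`, the truncation does not identify any cells. -/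
theorem bd_eq_of_mk_eq {x y : C.Cell} {hx : C.IsCell n x} {hy : C.IsCell n y}
    (h : mk x hx = mk y hy) (a : Bool) {j : ℕ} (hj : (j : ℕ∞) < n) :
    C.bd a j x = C.bd a j y := by
  have := congrArg (lift (n := n) (fun x _ => C.bd a j x) (by
    intro k z hn _
    have hjk : j < k := by rw [hn] at hj; exact_mod_cast hj
    rw [C.bd_bd_of_lt _ _ _ _ _ hjk, C.bd_bd_of_lt _ _ _ _ _ hjk])) h
  exact this

theorem bd_eq_of_bd_mk_eq {a b : Bool} {x y : C.Cell} {hx : C.IsCell n x} {hy : C.IsCell n y}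
    {j : ℕ} (hj : (j : ℕ∞) < n) (h : bd a j (mk x hx) = bd b j (mk y hy)) :
    C.bd a j x = C.bd b j y := by
  have := bd_eq_of_mk_eq h false hj
  rwa [C.bd_bd_of_le _ _ _ _ _ le_rfl, C.bd_bd_of_le _ _ _ _ _ le_rfl] at this

/-- Whiskering the relation on the left variable. -/
theorem mk_comp_left {k j : ℕ} (hn : n = k) (hj : j < k) {z y : C.Cell}
    (hz : C.IsCell (n + 1) z) (hy : C.IsCell n y)
    (h₁ : C.bd false j (C.bd false k z) = C.bd true j y)
    (h₂ : C.bd false j (C.bd true k z) = C.bd true j y) (p₁ p₂) :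
    (mk (C.comp j (C.bd false k z) y h₁) p₁ : C.TruncCell n) =
      mk (C.comp j (C.bd true k z) y h₂) p₂ := by
  have hzy : C.bd false j z = C.bd true j y := by rwa [C.bd_bd_of_lt _ _ _ _ _ hj] at h₁
  have hy' : ∀ a, C.bd a k y = y := fun a => hy.bd_eq a hn.le
  refine mk_eq_of_cell hn (z := C.comp j z y hzy)
    (hz.comp (fun i hi => hy i (le_self_add.trans hi)) j hzy) ?_ ?_
  · rw [C.bd_comp _ _ _ _ _ _ (C.bd_bd_congr hzy _ hj) hj]
    exact C.comp_congr rfl (hy' _) _ _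
  · rw [C.bd_comp _ _ _ _ _ _ (C.bd_bd_congr hzy _ hj) hj]
    exact C.comp_congr rfl (hy' _) _ _

/-- Whiskering the relation on the right variable. -/
theorem mk_comp_right {k j : ℕ} (hn : n = k) (hj : j < k) {z x : C.Cell}
    (hz : C.IsCell (n + 1) z) (hx : C.IsCell n x)
    (h₁ : C.bd false j x = C.bd true j (C.bd false k z))
    (h₂ : C.bd false j x = C.bd true j (C.bd true k z)) (p₁ p₂) :
    (mk (C.comp j x (C.bd false k z) h₁) p₁ : C.TruncCell n) =
      mk (C.comp j x (C.bd true k z) h₂) p₂ := by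
  have hxz : C.bd false j x = C.bd true j z := by rwa [C.bd_bd_of_lt _ _ _ _ _ hj] at h₁
  have hx' : ∀ a, C.bd a k x = x := fun a => hx.bd_eq a hn.le
  refine mk_eq_of_cell hn (z := C.comp j x z hxz)
    (IsCell.comp (fun i hi => hx i (le_self_add.trans hi)) hz j hxz) ?_ ?_
  · rw [C.bd_comp _ _ _ _ _ _ (C.bd_bd_congr hxz _ hj) hj]
    exact C.comp_congr (hx' _) rfl _ _
  · rw [C.bd_comp _ _ _ _ _ _ (C.bd_bd_congr hxz _ hj) hj]
    exact C.comp_congr (hx' _) rfl _ _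

theorem mk_comp_congr {j : ℕ} (hj : (j : ℕ∞) < n) {x x' y y' : C.Cell} {hx : C.IsCell n x}
    {hx' : C.IsCell n x'} {hy : C.IsCell n y} {hy' : C.IsCell n y'}
    (ex : mk x hx = mk x' hx') (ey : mk y hy = mk y' hy')
    (h : C.bd false j x = C.bd true j y) (h' : C.bd false j x' = C.bd true j y') :
    mk (C.comp j x y h) (hx.comp hy j h) = mk (C.comp j x' y' h') (hx'.comp hy' j h') := by
  have hx'y : C.bd false j x' = C.bd true j y := by
    rw [← bd_eq_of_mk_eq ex false hj]; exact h
  have step₁ : mk (C.comp j x y h) (hx.comp hy j h) =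
      mk (C.comp j x' y hx'y) (hx'.comp hy j hx'y) := by
    let c := mk (C.comp j x y h) (hx.comp hy j h)
    have key := congrArg (lift (n := n)
      (fun x hx => ∀ e : C.bd false j x = C.bd true j y,
        mk (C.comp j x y e) (hx.comp hy j e) = c)
      (by
        intro k z hn hz
        have hjk : j < k := by rw [hn] at hj; exact_mod_cast hj
        have es : C.bd false j (C.bd false k z) = C.bd false j (C.bd true k z) := by
          rw [C.bd_bd_of_lt _ _ _ _ _ hjk, C.bd_bd_of_lt _ _ _ _ _ hjk]
        refine propext ⟨fun H e => ?_, fun H e => ?_⟩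
        · rw [← H (es.trans e)]
          exact (mk_comp_left hn hjk hz hy _ _ _ _).symm
        · rw [← H (es.symm.trans e)]
          exact mk_comp_left hn hjk hz hy _ _ _ _)) ex
    have key' : (∀ e : C.bd false j x = C.bd true j y,
        mk (C.comp j x y e) (hx.comp hy j e) = c) =
      ∀ e : C.bd false j x' = C.bd true j y,
        mk (C.comp j x' y e) (hx'.comp hy j e) = c := key
    exact (key'.mp (fun _ => rfl) hx'y).symm
  have step₂ : mk (C.comp j x' y hx'y) (hx'.comp hy j hx'y) =
      mk (C.comp j x' y' h') (hx'.comp hy' j h') := by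
    let c := mk (C.comp j x' y hx'y) (hx'.comp hy j hx'y)
    have key := congrArg (lift (n := n)
      (fun y hy => ∀ e : C.bd false j x' = C.bd true j y,
        mk (C.comp j x' y e) (hx'.comp hy j e) = c)
      (by
        intro k z hn hz
        have hjk : j < k := by rw [hn] at hj; exact_mod_cast hj
        have es : C.bd true j (C.bd false k z) = C.bd true j (C.bd true k z) := by
          rw [C.bd_bd_of_lt _ _ _ _ _ hjk, C.bd_bd_of_lt _ _ _ _ _ hjk]
        refine propext ⟨fun H e => ?_, fun H e => ?_⟩
        · rw [← H (e.trans es.symm)]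
          exact (mk_comp_right hn hjk hz hx' _ _ _ _).symm
        · rw [← H (e.trans es)]
          exact mk_comp_right hn hjk hz hx' _ _ _ _)) ey
    have key' : (∀ e : C.bd false j x' = C.bd true j y,
        mk (C.comp j x' y e) (hx'.comp hy j e) = c) =
      ∀ e : C.bd false j x' = C.bd true j y',
        mk (C.comp j x' y' e) (hx'.comp hy' j e) = c := key
    exact (key'.mp (fun _ => rfl) h').symm
  exact step₁.trans step₂

/-- A representative of a cell of the truncation. -/
noncomputable def rep (x : C.TruncCell n) : C.Cell := (Quotient.out x).1

theorem rep_isCell (x : C.TruncCell n) : C.IsCell n x.rep := (Quotient.out x).2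

theorem mk_rep (x : C.TruncCell n) : mk x.rep x.rep_isCell = x := Quotient.out_eq x

theorem rep_composable {j : ℕ} (hj : (j : ℕ∞) < n) {x y : C.TruncCell n}
    (h : bd false j x = bd true j y) : C.bd false j x.rep = C.bd true j y.rep :=
  bd_eq_of_bd_mk_eq (hx := x.rep_isCell) (hy := y.rep_isCell) hj (by rwa [mk_rep, mk_rep])

open Classical in
/-- Composition is induced by that of `C`; from dimension `n` on all composites are trivial. -/
noncomputable def comp (j : ℕ) (x y : C.TruncCell n) (h : bd false j x = bd true j y) :
    C.TruncCell n :=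
  if hj : (j : ℕ∞) < n then
    mk (C.comp j x.rep y.rep (rep_composable hj h))
      (x.rep_isCell.comp y.rep_isCell j (rep_composable hj h))
  else x

theorem bd_of_not_lt {j : ℕ} (hj : ¬ (j : ℕ∞) < n) (a : Bool) (x : C.TruncCell n) :
    bd a j x = x := by
  induction x using ind with
  | h x hx => exact mk_eq_of_eq (hx.bd_eq a (not_lt.mp hj))

theorem comp_of_not_lt {j : ℕ} (hj : ¬ (j : ℕ∞) < n) {x y : C.TruncCell n}
    (h : bd false j x = bd true j y) : comp j x y h = x := by
  rw [comp, dif_neg hj]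

/-- Composition in the truncation is composition of representatives. -/
theorem comp_mk (j : ℕ) {x y : C.Cell} (hx : C.IsCell n x) (hy : C.IsCell n y)
    (h : bd false j (mk x hx) = bd true j (mk y hy)) (h' : C.bd false j x = C.bd true j y) :
    comp j (mk x hx) (mk y hy) h = mk (C.comp j x y h') (hx.comp hy j h') := by
  by_cases hj : (j : ℕ∞) < n
  · rw [comp, dif_pos hj]
    exact mk_comp_congr (hx := rep_isCell _) (hy := rep_isCell _) hj (mk_rep _) (mk_rep _) _ _
  · rw [comp_of_not_lt hj]
    have hnj := not_lt.mp hj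
    apply mk_eq_of_eq
    have hxy : x = y := by have := h'; rwa [hx.bd_eq _ hnj, hy.bd_eq _ hnj] at this
    subst hxy
    have e : C.bd false j x = x := hx j hnj
    symm
    calc C.comp j x x h' = C.comp j x (C.bd false j x)
          (by rw [C.bd_bd_of_le _ _ _ _ _ le_rfl]) := C.comp_congr rfl e.symm _ _
      _ = x := C.comp_unit _ _ _

end TruncCell

open TruncCell in
/-- The intelligent `n`-truncation: cells of dimension `< n` are those of `C`, and `n`-cells are
those of `C` up to zigzags of `(n+1)`-cells.  For `n = ∞` nothing is changed. -/
noncomputable def trunc (n : ℕ∞) (C : OmegaCat.{u}) : OmegaCat.{u} where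
  Cell := C.TruncCell n
  bd := TruncCell.bd
  comp := TruncCell.comp
  bd_bd_of_lt a b j k x hjk := by
    induction x using ind with
    | h x hx => exact mk_eq_of_eq (C.bd_bd_of_lt a b j k x hjk)
  bd_bd_of_le a b j k x hjk := by
    induction x using ind with
    | h x hx => exact mk_eq_of_eq (C.bd_bd_of_le a b j k x hjk)
  exists_dim x := by
    induction x using ind with
    | h x hx =>
      obtain ⟨k, hk⟩ := C.exists_dim x
      exact ⟨k, mk_eq_of_eq hk⟩
  src_comp k x y h := by
    by_cases hk : (k : ℕ∞) < n
    · induction x using ind with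
      | h x hx =>
      induction y using ind with
      | h y hy =>
      rw [comp_mk k hx hy h (bd_eq_of_bd_mk_eq hk h)]
      exact mk_eq_of_eq (C.src_comp k x y _)
    · rw [comp_of_not_lt hk, h, bd_of_not_lt hk, bd_of_not_lt hk]
  tgt_comp k x y h := by
    by_cases hk : (k : ℕ∞) < n
    · induction x using ind with
      | h x hx =>
      induction y using ind with
      | h y hy =>
      rw [comp_mk k hx hy h (bd_eq_of_bd_mk_eq hk h)]
      exact mk_eq_of_eq (C.tgt_comp k x y _)
    · rw [comp_of_not_lt hk]
  bd_comp a j k x y h h' hjk := by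
    by_cases hj : (j : ℕ∞) < n
    · induction x using ind with
      | h x hx =>
      induction y using ind with
      | h y hy =>
      have e := bd_eq_of_bd_mk_eq hj h
      rw [comp_mk j hx hy h e]
      change _ = TruncCell.comp j (TruncCell.mk _ _) (TruncCell.mk _ _) _
      rw [comp_mk j (hx.bd a k) (hy.bd a k) h' (C.bd_bd_congr e a hjk)]
      exact mk_eq_of_eq (C.bd_comp a j k x y e _ hjk)
    · rw [comp_of_not_lt hj, comp_of_not_lt hj]
  comp_unit k x h := by
    by_cases hk : (k : ℕ∞) < n
    · induction x using ind with
      | h x hx =>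
      change TruncCell.comp k (TruncCell.mk _ _) (TruncCell.mk _ _) _ = _
      rw [comp_mk k hx (hx.bd false k) h (bd_eq_of_bd_mk_eq hk h)]
      exact mk_eq_of_eq (C.comp_unit k x _)
    · rw [comp_of_not_lt hk]
  unit_comp k x h := by
    by_cases hk : (k : ℕ∞) < n
    · induction x using ind with
      | h x hx =>
      change TruncCell.comp k (TruncCell.mk _ _) (TruncCell.mk _ _) _ = _
      rw [comp_mk k (hx.bd true k) hx h (bd_eq_of_bd_mk_eq hk h)]
      exact mk_eq_of_eq (C.unit_comp k x _)
    · rw [comp_of_not_lt hk, bd_of_not_lt hk]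
  assoc k x y z hxy hyz h h' := by
    by_cases hk : (k : ℕ∞) < n
    · induction x using ind with
      | h x hx =>
      induction y using ind with
      | h y hy =>
      induction z using ind with
      | h z hz =>
      have exy := bd_eq_of_bd_mk_eq hk hxy
      have eyz := bd_eq_of_bd_mk_eq hk hyz
      have e : C.bd false k (C.comp k x y exy) = C.bd true k z := by rw [C.src_comp, eyz]
      have e' : C.bd false k x = C.bd true k (C.comp k y z eyz) := by rw [C.tgt_comp, exy]
      simp only [comp_mk k hx hy hxy exy, comp_mk k hy hz hyz eyz]
      rw [comp_mk k (hx.comp hy k exy) hz _ e, comp_mk k hx (hy.comp hz k eyz) _ e']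
      exact mk_eq_of_eq (C.assoc k x y z _ _ _ _)
    · simp only [comp_of_not_lt hk]
  interchange j k x y z w hjk hxy hzw hxz hyw h h' := by
    by_cases hk : (k : ℕ∞) < n
    · have hj : (j : ℕ∞) < n := lt_trans (by exact_mod_cast hjk) hk
      induction x using ind with
      | h x hx =>
      induction y using ind with
      | h y hy =>
      induction z using ind with
      | h z hz =>
      induction w using ind with
      | h w hw =>
      have exy := bd_eq_of_bd_mk_eq hk hxy
      have ezw := bd_eq_of_bd_mk_eq hk hzw
      have exz := bd_eq_of_bd_mk_eq hj hxz
      have eyw := bd_eq_of_bd_mk_eq hj hyw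
      simp only [comp_mk k hx hy hxy exy, comp_mk k hz hw hzw ezw] at h ⊢
      simp only [comp_mk j hx hz hxz exz, comp_mk j hy hw hyw eyw] at h' ⊢
      have e := bd_eq_of_bd_mk_eq hj h
      have e' := bd_eq_of_bd_mk_eq hk h'
      rw [comp_mk j _ _ h e, comp_mk k _ _ h' e']
      exact mk_eq_of_eq (C.interchange j k x y z w hjk _ _ _ _ _ _)
    · simp only [comp_of_not_lt hk]

theorem isNCat_trunc (n : ℕ∞) (C : OmegaCat.{u}) : IsNCat n (C.trunc n) := fun _ _ hk =>
  TruncCell.bd_of_not_lt (not_lt.mpr hk) _ _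

theorem Hom.isCell {C D : OmegaCat.{u}} (f : C ⟶ D) {n : ℕ∞} {x : C.Cell}
    (hx : C.IsCell n x) : D.IsCell n (Hom.toFun f x) := fun k hk => by
  rw [← Hom.map_bd, hx k hk]

open TruncCell in
/-- Functoriality of the intelligent truncation. -/
noncomputable def truncMap (n : ℕ∞) {C D : OmegaCat.{u}} (f : C ⟶ D) :
    C.trunc n ⟶ D.trunc n where
  toFun := TruncCell.lift (fun x hx => TruncCell.mk (Hom.toFun f x) (Hom.isCell f hx))
    fun _ _ hn hz => TruncCell.mk_eq_of_cell hn (Hom.isCell f hz)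
      (Hom.map_bd f _ _ _).symm (Hom.map_bd f _ _ _).symm
  map_bd a k x := by
    induction x using ind with
    | h x hx => exact mk_eq_of_eq (Hom.map_bd f a k x)
  map_comp k x y h h' := by
    by_cases hk : (k : ℕ∞) < n
    · induction x using ind with
      | h x hx =>
      induction y using ind with
      | h y hy =>
      have e := bd_eq_of_bd_mk_eq hk h
      have e' := bd_eq_of_bd_mk_eq (hx := Hom.isCell f hx) (hy := Hom.isCell f hy) hk h'
      refine (congrArg _ (comp_mk k hx hy h e)).trans ?_
      refine Eq.trans ?_ (comp_mk k (Hom.isCell f hx) (Hom.isCell f hy) h' e').symm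
      exact mk_eq_of_eq (Hom.map_comp f k x y e e')
    · refine (congrArg _ (comp_of_not_lt hk h)).trans ?_
      exact (comp_of_not_lt hk h').symm

/-- The intelligent truncation functor from strict `∞`-categories to strict `n`-categories. -/
noncomputable def truncFunctor (n : ℕ∞) : OmegaCat.{u} ⥤ NCat.{u} n where
  obj C := ⟨C.trunc n, isNCat_trunc n C⟩
  map f := ObjectProperty.homMk (truncMap n f)
  map_id C := by
    apply ObjectProperty.hom_ext
    refine OmegaCat.hom_ext _ _ fun x => ?_
    induction x using TruncCell.ind with
    | h x hx => rfl
  map_comp f g := by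
    apply ObjectProperty.hom_ext
    refine OmegaCat.hom_ext _ _ fun x => ?_
    induction x using TruncCell.ind with
    | h x hx => rfl

end OmegaCat

/-! ### Partially ordered sets as `n`-categories -/

/-- A partially ordered set viewed as a strict `∞`-category: its objects are the elements, there
is a unique `1`-arrow `p ⟶ q` for `p ≤ q` (represented by the pair `(p, q)`), and all cells of
dimension greater than `1` are identities. -/
def OmegaCat.ofPoset (P : Type u) [PartialOrder P] : OmegaCat.{u} where
  Cell := {p : P × P // p.1 ≤ p.2}
  bd
    | false, 0, x => ⟨(x.1.1, x.1.1), le_rfl⟩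
    | true, 0, x => ⟨(x.1.2, x.1.2), le_rfl⟩
    | _, _ + 1, x => x
  comp k x y h := ⟨(y.1.1, x.1.2), by
    cases k with
    | zero =>
      have h' : x.1.1 = y.1.2 := congrArg (fun c => c.1.1) h
      exact y.2.trans (h' ▸ x.2)
    | succ k =>
      have h' : x = y := h
      exact h' ▸ x.2⟩
  bd_bd_of_lt a b j k x h := by
    cases k with
    | zero => omega
    | succ k => cases b <;> rfl
  bd_bd_of_le a b j k x h := by
    cases j <;> cases k <;> first | omega | (cases a <;> cases b <;> rfl)
  exists_dim x := ⟨1, rfl⟩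
  src_comp k x y h := by
    cases k with
    | zero => rfl
    | succ k => have h' : x = y := h; subst h'; rfl
  tgt_comp k x y h := by
    cases k with
    | zero => rfl
    | succ k => have h' : x = y := h; subst h'; rfl
  bd_comp a j k x y h h' hjk := by
    cases k with
    | zero => omega
    | succ k => cases a <;> rfl
  comp_unit k x h := by cases k <;> rfl
  unit_comp k x h := by cases k <;> rfl
  assoc k x y z hxy hyz h h' := rfl
  interchange j k x y z w hjk hxy hzw hxz hyw h h' := rfl

/-- Partially ordered sets as `n`-categories, for `n ≥ 1`. -/
def NCat.ofPoset (n : ℕ∞) (hn : 1 ≤ n) : PartOrd.{u} ⥤ NCat.{u} n where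
  obj P := ⟨OmegaCat.ofPoset P, fun x k hk => by
    cases k with
    | zero => exact absurd (hn.trans hk) (by simp)
    | succ k => rfl⟩
  map f := ObjectProperty.homMk
    { toFun := fun x => ⟨(f x.1.1, f x.1.2), f.hom.monotone x.2⟩
      map_bd := fun a k x => by cases k <;> cases a <;> rfl
      map_comp := fun k x y h h' => rfl }

/-! ### Orientals -/

/-- The group of normalized `q`-chains of the simplex `Δ_m` with integral coefficients: the free
abelian group on the strictly increasing maps `Δ_q → Δ_m`. -/
abbrev SimplexChain (m q : ℕ) : Type := (Fin (q + 1) ↪o Fin (m + 1)) →₀ ℤ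

namespace SimplexChain

/-- The boundary `x ↦ ∑ k, (-1)^k x δ^k`. -/
noncomputable def boundary (m q : ℕ) : SimplexChain m (q + 1) →ₗ[ℤ] SimplexChain m q :=
  Finsupp.linearCombination ℤ fun x =>
    ∑ k : Fin (q + 2), (-1 : ℤ) ^ (k : ℕ) • Finsupp.single ((Fin.succAboveOrderEmb k).trans x) 1

/-- The augmentation, sum of the coefficients of a `0`-chain. -/
noncomputable def aug (m : ℕ) : SimplexChain m 0 →ₗ[ℤ] ℤ :=
  Finsupp.linearCombination ℤ fun _ => 1

open Classical in
/-- The image of a nondegenerate simplex under a monotone map; it is zero if degenerate. -/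
noncomputable def basisImage {m p q : ℕ} (f : Fin (m + 1) →o Fin (p + 1))
    (x : Fin (q + 1) ↪o Fin (m + 1)) : SimplexChain p q :=
  if h : StrictMono (fun i => f (x i)) then
    Finsupp.single (OrderEmbedding.ofStrictMono _ h) 1 else 0

/-- The map induced on normalized chains by a monotone map `Δ_m → Δ_p`. -/
noncomputable def map {m p : ℕ} (f : Fin (m + 1) →o Fin (p + 1)) (q : ℕ) :
    SimplexChain m q →ₗ[ℤ] SimplexChain p q :=
  Finsupp.linearCombination ℤ (basisImage f)

theorem boundary_single {m q : ℕ} (x : Fin (q + 2) ↪o Fin (m + 1)) :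
    boundary m q (Finsupp.single x 1) = ∑ k : Fin (q + 2),
      (-1 : ℤ) ^ (k : ℕ) • Finsupp.single ((Fin.succAboveOrderEmb k).trans x) 1 := by
  simp [boundary]

theorem map_single {m p q : ℕ} (f : Fin (m + 1) →o Fin (p + 1))
    (x : Fin (q + 1) ↪o Fin (m + 1)) : map f q (Finsupp.single x 1) = basisImage f x := by
  simp [map]

theorem basisImage_of_strictMono {m p q : ℕ} {f : Fin (m + 1) →o Fin (p + 1)}
    {x : Fin (q + 1) ↪o Fin (m + 1)} (h : StrictMono (fun i => f (x i))) :
    basisImage f x = Finsupp.single (OrderEmbedding.ofStrictMono _ h) 1 := dif_pos h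

theorem basisImage_of_eq {m p q : ℕ} {f : Fin (m + 1) →o Fin (p + 1)}
    {x : Fin (q + 1) ↪o Fin (m + 1)} {i j : Fin (q + 1)} (hij : i ≠ j)
    (h : f (x i) = f (x j)) : basisImage f x = 0 :=
  dif_neg fun hx => hij (hx.injective h)

theorem basisImage_congr {m p q : ℕ} {f : Fin (m + 1) →o Fin (p + 1)}
    {x y : Fin (q + 1) ↪o Fin (m + 1)} (h : ∀ i, f (x i) = f (y i)) :
    basisImage f x = basisImage f y := by
  have e : (fun i => f (x i)) = fun i => f (y i) := funext h
  by_cases hx : StrictMono (fun i => f (x i))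
  · have hy : StrictMono (fun i => f (y i)) := e ▸ hx
    rw [basisImage_of_strictMono hx, basisImage_of_strictMono hy]
    congr 1
    ext i
    exact congrArg Fin.val (h i)
  · have hy : ¬ StrictMono (fun i => f (y i)) := e ▸ hx
    rw [basisImage, basisImage, dif_neg hx, dif_neg hy]

theorem exists_eq_of_not_strictMono {p q : ℕ} {g : Fin (q + 2) → Fin (p + 1)}
    (hg : Monotone g) (h : ¬ StrictMono g) : ∃ i : Fin (q + 1), g i.castSucc = g i.succ := by
  rw [Fin.strictMono_iff_lt_succ] at h
  push Not at h
  obtain ⟨i, hi⟩ := h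
  exact ⟨i, le_antisymm (hg Fin.castSucc_lt_succ.le) hi⟩

theorem map_boundary {m p : ℕ} (f : Fin (m + 1) →o Fin (p + 1)) (q : ℕ)
    (c : SimplexChain m (q + 1)) :
    map f q (boundary m q c) = boundary p q (map f (q + 1) c) := by
  suffices H : (map f q).comp (boundary m q) = (boundary p q).comp (map f (q + 1)) from
    LinearMap.congr_fun H c
  ext1 x
  ext1
  simp only [LinearMap.comp_apply, Finsupp.lsingle_apply, boundary_single, map_sum, map_zsmul,
    map_single]
  by_cases h : StrictMono (fun i => f (x i))
  · rw [basisImage_of_strictMono h, boundary_single]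
    refine Finset.sum_congr rfl fun k _ => ?_
    rw [basisImage_of_strictMono
      (x := (Fin.succAboveOrderEmb k).trans x) (h.comp (Fin.succAboveOrderEmb k).strictMono)]
    rfl
  · obtain ⟨i, hi⟩ := exists_eq_of_not_strictMono
      (g := fun i => f (x i)) (f.monotone.comp x.monotone) h
    have hx : basisImage f x = 0 := basisImage_of_eq (Fin.castSucc_lt_succ (i := i)).ne hi
    rw [hx, map_zero, Fintype.sum_eq_add i.castSucc i.succ Fin.castSucc_lt_succ.ne]
    · have e : basisImage f ((Fin.succAboveOrderEmb i.castSucc).trans x) =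
          basisImage f ((Fin.succAboveOrderEmb i.succ).trans x) := by
        refine basisImage_congr fun j => ?_
        change f (x (i.castSucc.succAbove j)) = f (x (i.succ.succAbove j))
        rcases lt_trichotomy j i with hj | hj | hj
        · rw [Fin.succAbove_of_castSucc_lt _ _ (by simpa using hj),
            Fin.succAbove_of_castSucc_lt _ _ (by rw [Fin.lt_def] at *; simp; omega)]
        · subst hj
          rw [Fin.succAbove_castSucc_self, Fin.succAbove_succ_self]
          exact hi.symm
        · rw [Fin.succAbove_of_le_castSucc _ _ (by rw [Fin.le_def, Fin.lt_def] at *; simp; omega),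
            Fin.succAbove_of_le_castSucc _ _ (by rw [Fin.le_def, Fin.lt_def] at *; simp; omega)]
      rw [e, Fin.val_castSucc, Fin.val_succ, pow_succ, ← add_smul]
      simp
    · rintro k ⟨hk₁, hk₂⟩
      obtain ⟨a, ha⟩ := Fin.exists_succAbove_eq hk₁.symm
      obtain ⟨b, hb⟩ := Fin.exists_succAbove_eq hk₂.symm
      rw [basisImage_of_eq (i := a) (j := b), smul_zero]
      · rintro rfl
        exact (Fin.castSucc_lt_succ (i := i)).ne (ha.symm.trans hb)
      · change f (x (k.succAbove a)) = f (x (k.succAbove b))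
        rw [ha, hb]; exact hi

theorem aug_map {m p : ℕ} (f : Fin (m + 1) →o Fin (p + 1)) (c : SimplexChain m 0) :
    aug p (map f 0 c) = aug m c := by
  suffices H : (aug p).comp (map f 0) = aug m from LinearMap.congr_fun H c
  ext x
  simp [aug, map_single, basisImage_of_strictMono (f := f) (x := x)
    (Subsingleton.strictMono (α := Fin 1) _)]

theorem map_id {m : ℕ} (q : ℕ) (c : SimplexChain m q) : map OrderHom.id q c = c := by
  suffices H : map (OrderHom.id : Fin (m + 1) →o Fin (m + 1)) q = LinearMap.id from
    LinearMap.congr_fun H c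
  ext1 x
  ext1
  simp only [LinearMap.comp_apply, Finsupp.lsingle_apply, map_single]
  rw [basisImage_of_strictMono (f := OrderHom.id) (x := x) x.strictMono]
  rfl

theorem map_map {m p r : ℕ} (f : Fin (m + 1) →o Fin (p + 1)) (g : Fin (p + 1) →o Fin (r + 1))
    (q : ℕ) (c : SimplexChain m q) : map g q (map f q c) = map (g.comp f) q c := by
  suffices H : (map g q).comp (map f q) = map (g.comp f) q from LinearMap.congr_fun H c
  ext1 x
  ext1
  simp only [LinearMap.comp_apply, Finsupp.lsingle_apply, map_single]
  by_cases h : StrictMono (fun i => f (x i))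
  · rw [basisImage_of_strictMono h, map_single]
    rfl
  · obtain ⟨i, j, hij, e⟩ : ∃ i j, i ≠ j ∧ f (x i) = f (x j) := by
      by_contra! H
      exact h ((f.monotone.comp x.monotone).strictMono_of_injective
        fun i j e => by_contra fun hij => H i j hij e)
    rw [basisImage_of_eq hij e, basisImage_of_eq (f := g.comp f) hij (congrArg g e), map_zero]

theorem basisImage_nonneg {m p q : ℕ} (f : Fin (m + 1) →o Fin (p + 1))
    (x : Fin (q + 1) ↪o Fin (m + 1)) : 0 ≤ basisImage f x := by
  unfold basisImage
  split_ifs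
  · exact Finsupp.single_nonneg.mpr zero_le_one
  · exact le_rfl

theorem map_nonneg {m p : ℕ} (f : Fin (m + 1) →o Fin (p + 1)) {q : ℕ} {c : SimplexChain m q}
    (hc : 0 ≤ c) : 0 ≤ map f q c := by
  rw [map, Finsupp.linearCombination_apply]
  intro y
  rw [Finsupp.sum_apply]
  exact Finset.sum_nonneg fun x _ => mul_nonneg (hc x) (basisImage_nonneg f x y)

end SimplexChain

/-- A cell of the `m`-th oriental, in Steiner's description: a table of nonnegative chains, where
`chain q false` and `chain q true` (in degree `q`) represent the iterated `q`-dimensional source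
and target of the cell, subject to `∂ chain_{q+1} = target_q - source_q`, the `0`-dimensional
chains having augmentation `1`. -/
@[ext]
structure OrientalCell (m : ℕ) : Type u where
  chain : (q : ℕ) → Bool → SimplexChain m q
  nonneg : ∀ q b, 0 ≤ chain q b
  aug_eq : ∀ b, SimplexChain.aug m (chain 0 b) = 1
  boundary_eq : ∀ q b,
    SimplexChain.boundary m q (chain (q + 1) b) = chain q true - chain q false

namespace OrientalCell

variable {m : ℕ}

/-- Source (`a = false`) and target (`a = true`) of dimension `k`. -/
noncomputable def bd (a : Bool) (k : ℕ) (x : OrientalCell.{u} m) : OrientalCell.{u} m where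
  chain q b := if q < k then x.chain q b else if q = k then x.chain q a else 0
  nonneg q b := by
    split_ifs
    exacts [x.nonneg q b, x.nonneg q a, le_rfl]
  aug_eq b := by
    split_ifs
    exacts [x.aug_eq b, x.aug_eq a, by omega]
  boundary_eq q b := by
    rcases lt_trichotomy (q + 1) k with h | h | h
    · rw [if_pos h, if_pos (by omega), if_pos (by omega), x.boundary_eq]
    · rw [if_neg (by omega), if_pos h, if_pos (by omega), if_pos (by omega), x.boundary_eq]
    · rw [if_neg (by omega), if_neg (by omega), map_zero]
      by_cases hq : q = k
      · simp [hq]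
      · simp [hq, show ¬ q < k by omega]

/-- Composition in dimension `k`. -/
noncomputable def comp (k : ℕ) (x y : OrientalCell.{u} m) (h : bd false k x = bd true k y) :
    OrientalCell.{u} m where
  chain q b :=
    if q < k then x.chain q b
    else if q = k then (if b then x.chain q true else y.chain q false)
    else x.chain q b + y.chain q b
  nonneg q b := by
    split_ifs
    exacts [x.nonneg q b, x.nonneg q true, y.nonneg q false,
      add_nonneg (x.nonneg q b) (y.nonneg q b)]
  aug_eq b := by
    split_ifs
    exacts [x.aug_eq b, x.aug_eq true, y.aug_eq false, by omega]
  boundary_eq q b := by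
    have hlt : ∀ q < k, ∀ b, x.chain q b = y.chain q b := fun q hq b => by
      simpa [bd, hq] using congrArg (fun c => c.chain q b) h
    have hk : x.chain k false = y.chain k true := by
      simpa [bd] using congrArg (fun c => c.chain k false) h
    rcases lt_trichotomy (q + 1) k with hq | hq | hq
    · rw [if_pos hq, if_pos (by omega), if_pos (by omega), x.boundary_eq]
    · subst hq
      have e := hlt q (Nat.lt_succ_self q)
      cases b
      · simp [y.boundary_eq, e]
      · simp [x.boundary_eq]
    · rw [if_neg (by omega), if_neg (by omega), map_add, x.boundary_eq, y.boundary_eq]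
      by_cases hqk : q = k
      · subst hqk
        simp [hk]
      · rw [if_neg (by omega), if_neg hqk, if_neg (by omega), if_neg hqk]
        abel

theorem chain_lt_of_eq {k : ℕ} {x y : OrientalCell.{u} m} (h : bd false k x = bd true k y)
    {q : ℕ} (hq : q < k) (b : Bool) : x.chain q b = y.chain q b := by
  simpa [bd, hq] using congrArg (fun c => c.chain q b) h

theorem chain_eq_of_eq {k : ℕ} {x y : OrientalCell.{u} m} (h : bd false k x = bd true k y) :
    x.chain k false = y.chain k true := by
  simpa [bd] using congrArg (fun c => c.chain k false) h

theorem chain_eq_zero (x : OrientalCell.{u} m) {q : ℕ} (hq : m < q) (b : Bool) :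
    x.chain q b = 0 := by
  have : IsEmpty (Fin (q + 1) ↪o Fin (m + 1)) := ⟨fun e => by
    have := Fintype.card_le_of_injective e e.injective
    simp at this
    omega⟩
  exact Subsingleton.elim _ _

/-- The action of a monotone map on cells. -/
noncomputable def map {p : ℕ} (f : Fin (m + 1) →o Fin (p + 1)) (x : OrientalCell.{u} m) :
    OrientalCell.{u} p where
  chain q b := SimplexChain.map f q (x.chain q b)
  nonneg q b := SimplexChain.map_nonneg f (x.nonneg q b)
  aug_eq b := by rw [SimplexChain.aug_map, x.aug_eq]
  boundary_eq q b := by rw [← SimplexChain.map_boundary, x.boundary_eq, map_sub]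

end OrientalCell

/-- Street's `m`-th oriental `𝒪_m`. -/
noncomputable def oriental (m : ℕ) : OmegaCat.{u} where
  Cell := OrientalCell.{u} m
  bd := OrientalCell.bd
  comp := OrientalCell.comp
  bd_bd_of_lt a b j k x h := by
    ext1; funext q c
    simp only [OrientalCell.bd]
    split_ifs <;> first | rfl | omega
  bd_bd_of_le a b j k x h := by
    ext1; funext q c
    simp only [OrientalCell.bd]
    split_ifs <;> first | rfl | omega
  exists_dim x := ⟨m, by
    ext1; funext q c
    simp only [OrientalCell.bd]
    split_ifs with h₁ h₂
    · rfl
    · subst h₂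
      have := x.boundary_eq q false
      rw [x.chain_eq_zero (Nat.lt_succ_self q), map_zero] at this
      have e : x.chain q true = x.chain q false := sub_eq_zero.mp this.symm
      cases c
      · rfl
      · exact e.symm
    · exact (x.chain_eq_zero (by omega) c).symm⟩
  src_comp k x y h := by
    ext1; funext q c
    have hlt := fun (hq : q < k) => OrientalCell.chain_lt_of_eq h hq c
    simp only [OrientalCell.bd, OrientalCell.comp]
    split_ifs <;> simp_all
  tgt_comp k x y h := by
    ext1; funext q c
    simp only [OrientalCell.bd, OrientalCell.comp]
    split_ifs <;> simp_all
  bd_comp a j k x y h h' hjk := by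
    ext1; funext q c
    simp only [OrientalCell.bd, OrientalCell.comp]
    split_ifs <;> first | rfl | omega
  comp_unit k x h := by
    ext1; funext q c
    simp only [OrientalCell.bd, OrientalCell.comp]
    split_ifs <;> simp_all
  unit_comp k x h := by
    ext1; funext q c
    simp only [OrientalCell.bd, OrientalCell.comp]
    split_ifs <;> simp_all
  assoc k x y z hxy hyz h h' := by
    ext1; funext q c
    simp only [OrientalCell.comp]
    split_ifs <;> simp_all [add_assoc]
  interchange j k x y z w hjk hxy hzw hxz hyw h h' := by
    ext1; funext q c
    simp only [OrientalCell.comp]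
    split_ifs <;> first | rfl | omega | abel

/-- The cosimplicial object `Δ_m ↦ 𝒪_m` in strict `∞`-categories. -/
noncomputable def orientalFunctor : SimplexCategory ⥤ OmegaCat.{u} where
  obj S := oriental S.len
  map f :=
    { toFun := OrientalCell.map f.toOrderHom
      map_bd := fun a k x => by
        refine OrientalCell.ext ?_
        funext q c
        simp only [oriental, OrientalCell.bd, OrientalCell.map]
        split_ifs <;> simp
      map_comp := fun k x y h h' => by
        refine OrientalCell.ext ?_
        funext q c
        simp only [oriental, OrientalCell.comp, OrientalCell.map]
        split_ifs <;> first | rfl | simp }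
  map_id S := OmegaCat.hom_ext _ _ fun x =>
    OrientalCell.ext (funext fun q => funext fun b => SimplexChain.map_id q (x.chain q b))
  map_comp f g := OmegaCat.hom_ext _ _ fun x =>
    OrientalCell.ext (funext fun q => funext fun b =>
      (SimplexChain.map_map _ _ q (x.chain q b)).symm)

/-- The cosimplicial object `i_n : Δ_m ↦ 𝒪_m^{≤ n}` of truncated orientals. -/
noncomputable def truncatedOriental (n : ℕ∞) : SimplexCategory ⥤ NCat.{u} n :=
  orientalFunctor ⋙ OmegaCat.truncFunctor n

/-- The nerve `N_n : C ↦ (Δ_m ↦ Hom(𝒪_m^{≤ n}, C))`. -/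
noncomputable def streetNerve (n : ℕ∞) : NCat.{u} n ⥤ SSet.{u} :=
  Presheaf.restrictedULiftYoneda.{u} (truncatedOriental.{u} n)

/-! ### Sieves and cosieves -/

/-- `f` is an inverse image (base change) of `d`. -/
def IsInverseImage {C : Type*} [Category* C] {e I : C} (d : e ⟶ I) {X' X : C} (f : X' ⟶ X) :
    Prop :=
  ∃ (p : X' ⟶ e) (χ : X ⟶ I), IsPullback f p χ d

/-- The map `∂_ε : Δ_0 ⟶ Δ_1` of partially ordered sets with value `ε`. -/
def PartOrd.endpoint (ε : Fin 2) :
    PartOrd.of PUnit.{u + 1} ⟶ PartOrd.of (ULift.{u} (Fin 2)) :=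
  PartOrd.ofHom (OrderHom.const _ ⟨ε⟩)

/-- Sieves of partially ordered sets. -/
def PartOrd.IsSieve {E' E : PartOrd.{u}} (f : E' ⟶ E) : Prop :=
  IsInverseImage (PartOrd.endpoint 0) f

/-- Cosieves of partially ordered sets. -/
def PartOrd.IsCosieve {E' E : PartOrd.{u}} (f : E' ⟶ E) : Prop :=
  IsInverseImage (PartOrd.endpoint 1) f

/-- Sieves of `n`-categories: the inverse images of `∂_0 : Δ_0 ⟶ Δ_1`. -/
def NCat.IsSieve {n : ℕ∞} (hn : 1 ≤ n) {A B : NCat.{u} n} (f : A ⟶ B) : Prop :=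
  IsInverseImage ((NCat.ofPoset n hn).map (PartOrd.endpoint 0)) f

/-- Cosieves of `n`-categories: the inverse images of `∂_1 : Δ_0 ⟶ Δ_1`. -/
def NCat.IsCosieve {n : ℕ∞} (hn : 1 ≤ n) {A B : NCat.{u} n} (f : A ⟶ B) : Prop :=
  IsInverseImage ((NCat.ofPoset n hn).map (PartOrd.endpoint 1)) f

/-! ### Cells and functors -/

namespace OmegaCat

/-! Everything about orientals reduces to linear algebra with positive weights. An integral weight
on `q`-simplices that takes positive values on boundaries of `(q+1)`-simplices bounds the
coefficients of a nonnegative `(q+1)`-chain in terms of its boundary. Hence an oriental has finitely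
many cells. Weights supported on the simplices that leave an initial (or final) segment of vertices
show that a cell ending at the vertex `t` involves only vertices `≤ t`, and a cell starting at `t`
only vertices `≥ t` (`last_le_of_vtx_le`, `le_first_of_le_vtx`).

Left adjoint: for a simplicial set `X`, the cells of `c_n X` are formal composites of cells of
orientals indexed by simplices of `X`, where a composite exists, and two composites agree, when this
is so under every map from `X` to a nerve. The terms form a small set, so this gives an initial
object of each comma category (`isRightAdjoint`).

(a) Filtered colimits of `n`-categories are computed on cells, since an operation or axiom involves
finitely many cells. An `n`-category with finitely many cells is therefore finitely presentable
(`exists_factorization_of_finite`, `exists_eq_of_finite`), and truncated orientals are of this kind.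

(b) Let `B'` be the pushout of `A'` and `B` along `A`. Testing against functors to `{0 < 1}` shows
that every object of `B'` lies in `A'` or in `B`, and that their common cells come from `A`. A
cosieve containing the first vertex of an oriental contains all of it (`over_one_of_first`), so each
simplex of the nerve of `B'` lies in that of `A'` or of `B`.

(c) A functor to `{0 < 1}` exhibits a sieve exactly when the map in question is injective with image
the fibre. For a sieve `E' ⟶ E` with characteristic map `χ`, let the cone on `c_n N E'` be obtained
by adjoining a terminal object. A functor `d` from `c_n N E` to this cone collapses what lies
outside `E'` (`exists_functor_cone`): on a simplex of `E`, it uses the retraction of the vertices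
onto those over `E'`, which by the statement on supports fixes every cell ending over `E'`.
Restricted to `c_n N E'`, `d` is the inclusion in the cone, whence injectivity; followed by the cone
on `c_n N E' ⟶ c_n N E`, it is the identity on the fibre, whence surjectivity. Cosieves are handled
simultaneously, the Boolean `e` reversing directions. -/

theorem src_zero_comp (C : OmegaCat.{u}) (k : ℕ) (x y : C.Cell)
    (h : C.bd false k x = C.bd true k y) :
    C.bd false 0 (C.comp k x y h) = C.bd false 0 y := by
  rcases Nat.eq_zero_or_pos k with rfl | hk
  · exact C.src_comp 0 x y h
  · rw [← C.bd_bd_of_lt false false 0 k _ hk, C.src_comp, C.bd_bd_of_lt _ _ _ _ _ hk]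

theorem tgt_zero_comp (C : OmegaCat.{u}) (k : ℕ) (x y : C.Cell)
    (h : C.bd false k x = C.bd true k y) :
    C.bd true 0 (C.comp k x y h) = C.bd true 0 x := by
  rcases Nat.eq_zero_or_pos k with rfl | hk
  · exact C.tgt_comp 0 x y h
  · rw [← C.bd_bd_of_lt true true 0 k _ hk, C.tgt_comp, C.bd_bd_of_lt _ _ _ _ _ hk]

theorem bd_zero_eq_of_pos (C : OmegaCat.{u}) {k : ℕ} (hk : 0 < k) {x y : C.Cell}
    (h : C.bd false k x = C.bd true k y) (a : Bool) : C.bd a 0 x = C.bd a 0 y := by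
  rw [← C.bd_bd_of_lt a false 0 k x hk, h, C.bd_bd_of_lt _ _ _ _ _ hk]

@[simp]
theorem bd_zero_bd_zero (C : OmegaCat.{u}) (a b : Bool) (x : C.Cell) :
    C.bd a 0 (C.bd b 0 x) = C.bd b 0 x := C.bd_bd_of_le _ _ _ _ _ le_rfl

/-- A subset of the cells closed under the operations is a strict `∞`-category. -/
def sub (C : OmegaCat.{u}) (p : C.Cell → Prop) (hbd : ∀ a k x, p x → p (C.bd a k x))
    (hcomp : ∀ k x y h, p x → p y → p (C.comp k x y h)) : OmegaCat.{u} where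
  Cell := {x // p x}
  bd a k x := ⟨C.bd a k x.1, hbd a k x.1 x.2⟩
  comp k x y h := ⟨C.comp k x.1 y.1 (congrArg Subtype.val h), hcomp _ _ _ _ x.2 y.2⟩
  bd_bd_of_lt a b j k x h := Subtype.ext (C.bd_bd_of_lt a b j k x.1 h)
  bd_bd_of_le a b j k x h := Subtype.ext (C.bd_bd_of_le a b j k x.1 h)
  exists_dim x := (C.exists_dim x.1).imp fun _ h => Subtype.ext h
  src_comp k x y h := Subtype.ext (C.src_comp k x.1 y.1 _)
  tgt_comp k x y h := Subtype.ext (C.tgt_comp k x.1 y.1 _)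
  bd_comp a j k x y h h' hjk := Subtype.ext (C.bd_comp a j k x.1 y.1 _ _ hjk)
  comp_unit k x h := Subtype.ext (C.comp_unit k x.1 _)
  unit_comp k x h := Subtype.ext (C.unit_comp k x.1 _)
  assoc k x y z hxy hyz h h' := Subtype.ext (C.assoc k x.1 y.1 z.1 _ _ _ _)
  interchange j k x y z w hjk hxy hzw hxz hyw h h' :=
    Subtype.ext (C.interchange j k x.1 y.1 z.1 w.1 hjk _ _ _ _ _ _)

end OmegaCat

namespace NCat

variable {n : ℕ∞}

/-- The action of an `n`-functor on cells. -/
def app {A B : NCat.{u} n} (f : A ⟶ B) (x : A.obj.Cell) : B.obj.Cell :=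
  OmegaCat.Hom.toFun f.hom x

theorem app_bd {A B : NCat.{u} n} (f : A ⟶ B) (a : Bool) (k : ℕ) (x : A.obj.Cell) :
    app f (A.obj.bd a k x) = B.obj.bd a k (app f x) := OmegaCat.Hom.map_bd f.hom a k x

theorem app_composable {A B : NCat.{u} n} (f : A ⟶ B) {k : ℕ} {x y : A.obj.Cell}
    (h : A.obj.bd false k x = A.obj.bd true k y) :
    B.obj.bd false k (app f x) = B.obj.bd true k (app f y) := by
  rw [← app_bd, ← app_bd, h]

theorem app_comp {A B : NCat.{u} n} (f : A ⟶ B) (k : ℕ) (x y : A.obj.Cell)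
    (h : A.obj.bd false k x = A.obj.bd true k y) :
    app f (A.obj.comp k x y h) = B.obj.comp k (app f x) (app f y) (app_composable f h) :=
  OmegaCat.Hom.map_comp f.hom k x y h _

@[ext]
theorem hom_ext {A B : NCat.{u} n} {f g : A ⟶ B} (h : ∀ x, app f x = app g x) : f = g :=
  ObjectProperty.hom_ext _ (OmegaCat.hom_ext _ _ h)

@[simp]
theorem id_app {A : NCat.{u} n} (x : A.obj.Cell) : app (𝟙 A) x = x := rfl

@[simp]
theorem comp_app {A B C : NCat.{u} n} (f : A ⟶ B) (g : B ⟶ C) (x : A.obj.Cell) :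
    app (f ≫ g) x = app g (app f x) := rfl

/-- Construction of an `n`-functor from its action on cells. -/
def homMk {A B : NCat.{u} n} (f : A.obj.Cell → B.obj.Cell)
    (hbd : ∀ a k x, f (A.obj.bd a k x) = B.obj.bd a k (f x))
    (hcomp : ∀ k x y (h : A.obj.bd false k x = A.obj.bd true k y)
      (h' : B.obj.bd false k (f x) = B.obj.bd true k (f y)),
      f (A.obj.comp k x y h) = B.obj.comp k (f x) (f y) h') : A ⟶ B :=
  ObjectProperty.homMk { toFun := f, map_bd := hbd, map_comp := hcomp }

/-- A subset of the cells closed under the operations is a strict `n`-category. -/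
def sub (C : NCat.{u} n) (p : C.obj.Cell → Prop) (hbd : ∀ a k x, p x → p (C.obj.bd a k x))
    (hcomp : ∀ k x y h, p x → p y → p (C.obj.comp k x y h)) : NCat.{u} n :=
  ⟨C.obj.sub p hbd hcomp, fun x k hk => Subtype.ext (C.property x.1 k hk)⟩

/-- The inclusion of a closed subset of the cells. -/
def subι (C : NCat.{u} n) (p : C.obj.Cell → Prop) (hbd : ∀ a k x, p x → p (C.obj.bd a k x))
    (hcomp : ∀ k x y h, p x → p y → p (C.obj.comp k x y h)) : C.sub p hbd hcomp ⟶ C :=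
  homMk Subtype.val (fun _ _ _ => rfl) (fun _ _ _ _ _ => rfl)

/-! ### Functors to a partially ordered set -/

variable {hn : 1 ≤ n}

theorem ofPoset_cell_ext {P : PartOrd.{u}} {x y : ((ofPoset n hn).obj P).obj.Cell}
    (h₁ : x.1.1 = y.1.1) (h₂ : x.1.2 = y.1.2) : x = y :=
  Subtype.ext (Prod.ext h₁ h₂)

/-- The functor to a partially ordered set given by its values on objects. -/
def toPoset (hn : 1 ≤ n) {A : NCat.{u} n} (P : PartOrd.{u}) (o : A.obj.Cell → P)
    (ho : ∀ x, o (A.obj.bd false 0 x) ≤ o (A.obj.bd true 0 x)) : A ⟶ (ofPoset n hn).obj P :=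
  homMk (fun x => ⟨(o (A.obj.bd false 0 x), o (A.obj.bd true 0 x)), ho x⟩)
    (fun a k x => by
      rcases Nat.eq_zero_or_pos k with rfl | hk
      · cases a <;> apply ofPoset_cell_ext <;> simp [ofPoset, OmegaCat.ofPoset]
      · obtain ⟨k, rfl⟩ := Nat.exists_eq_add_of_lt hk
        have e : ∀ b, A.obj.bd b 0 (A.obj.bd a (0 + k + 1) x) = A.obj.bd b 0 x := fun b =>
          A.obj.bd_bd_of_lt _ _ _ _ _ hk
        simp only [e]
        cases a <;> rfl)
    (fun k x y h h' => ofPoset_cell_ext (congrArg o (A.obj.src_zero_comp k x y h))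
      (congrArg o (A.obj.tgt_zero_comp k x y h)))

theorem app_ofPoset_src {A : NCat.{u} n} {P : PartOrd.{u}} (χ : A ⟶ (ofPoset n hn).obj P)
    (a : Bool) (x : A.obj.Cell) : (app χ (A.obj.bd a 0 x)).1 =
      (if a then ((app χ x).1.2, (app χ x).1.2) else ((app χ x).1.1, (app χ x).1.1)) := by
  rw [app_bd]
  cases a <;> rfl

/-- The value on objects of a functor to a partially ordered set, extended to all cells by
taking `0`-sources. -/
def objVal {A : NCat.{u} n} {P : PartOrd.{u}} (χ : A ⟶ (ofPoset n hn).obj P)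
    (x : A.obj.Cell) : P := (app χ x).1.1

theorem app_eq_objVal {A : NCat.{u} n} {P : PartOrd.{u}} (χ : A ⟶ (ofPoset n hn).obj P)
    (x : A.obj.Cell) : (app χ x).1 =
      (objVal χ (A.obj.bd false 0 x), objVal χ (A.obj.bd true 0 x)) := by
  simp [objVal, app_ofPoset_src]

theorem objVal_le {A : NCat.{u} n} {P : PartOrd.{u}} (χ : A ⟶ (ofPoset n hn).obj P)
    (x : A.obj.Cell) : objVal χ (A.obj.bd false 0 x) ≤ objVal χ (A.obj.bd true 0 x) := by
  have := (app χ x).2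
  rwa [app_eq_objVal] at this

theorem objVal_toPoset {A : NCat.{u} n} (P : PartOrd.{u}) (o : A.obj.Cell → P) (ho)
    (x : A.obj.Cell) : objVal (toPoset hn P o ho) x = o (A.obj.bd false 0 x) := rfl

/-- A cell of a partially ordered set is determined by its two ends, so only values on objects
matter. -/
theorem toPoset_ext {A : NCat.{u} n} {P : PartOrd.{u}} {χ χ' : A ⟶ (ofPoset n hn).obj P}
    (h : ∀ x a, objVal χ (A.obj.bd a 0 x) = objVal χ' (A.obj.bd a 0 x)) : χ = χ' := by
  ext x
  apply Subtype.ext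
  rw [app_eq_objVal, app_eq_objVal, h, h]

theorem objVal_comp {A B : NCat.{u} n} {P : PartOrd.{u}} (f : A ⟶ B)
    (χ : B ⟶ (ofPoset n hn).obj P) (x : A.obj.Cell) :
    objVal (f ≫ χ) x = objVal χ (app f x) := rfl

/-! ### Sieves and cosieves in terms of cells -/

/-- The ordered set `{0 < 1}`. -/
abbrev two : PartOrd.{u} := PartOrd.of (ULift.{u} (Fin 2))

/-- A cell lies over the object `ε`. -/
def Over {A : NCat.{u} n} (χ : A ⟶ (ofPoset n hn).obj two.{u}) (ε : Fin 2) (x : A.obj.Cell) :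
    Prop :=
  (app χ x).1 = (⟨ε⟩, ⟨ε⟩)

theorem over_iff {A : NCat.{u} n} (χ : A ⟶ (ofPoset n hn).obj two.{u}) (ε : Fin 2)
    (x : A.obj.Cell) : Over χ ε x ↔
      ∀ a, (objVal χ (A.obj.bd a 0 x)).down = ε := by
  rw [Over, app_eq_objVal, Prod.mk.injEq, ULift.ext_iff, ULift.ext_iff, Bool.forall_bool]

theorem Over.bd {A : NCat.{u} n} {χ : A ⟶ (ofPoset n hn).obj two.{u}} {ε : Fin 2}
    {x : A.obj.Cell} (h : Over χ ε x) (a : Bool) (k : ℕ) : Over χ ε (A.obj.bd a k x) := by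
  rw [over_iff] at h ⊢
  intro b
  rcases Nat.eq_zero_or_pos k with rfl | hk
  · rw [OmegaCat.bd_zero_bd_zero]; exact h a
  · rw [A.obj.bd_bd_of_lt _ _ _ _ _ hk]; exact h b

theorem Over.comp {A : NCat.{u} n} {χ : A ⟶ (ofPoset n hn).obj two.{u}} {ε : Fin 2}
    {x y : A.obj.Cell} (hx : Over χ ε x) (hy : Over χ ε y) (k : ℕ)
    (h : A.obj.bd false k x = A.obj.bd true k y) : Over χ ε (A.obj.comp k x y h) := by
  rw [over_iff] at hx hy ⊢
  rintro (_ | _)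
  · rw [A.obj.src_zero_comp]; exact hy _
  · rw [A.obj.tgt_zero_comp]; exact hx _

/-- The fibre over the object `ε`. -/
def fiber {A : NCat.{u} n} (χ : A ⟶ (ofPoset n hn).obj two.{u}) (ε : Fin 2) : NCat.{u} n :=
  A.sub (Over χ ε) (fun a k _ h => h.bd a k) (fun k _ _ h hx hy => hx.comp hy k h)

/-- The inclusion of the fibre. -/
def fiberι {A : NCat.{u} n} (χ : A ⟶ (ofPoset n hn).obj two.{u}) (ε : Fin 2) :
    fiber χ ε ⟶ A :=
  A.subι _ _ _

/-- The factorization through the fibre. -/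
def fiberLift {A B : NCat.{u} n} (χ : A ⟶ (ofPoset n hn).obj two.{u}) (ε : Fin 2) (f : B ⟶ A)
    (hf : ∀ x, Over χ ε (app f x)) : B ⟶ fiber χ ε :=
  homMk (fun x => ⟨app f x, hf x⟩) (fun a k x => Subtype.ext (app_bd f a k x))
    (fun k x y h _ => Subtype.ext (app_comp f k x y h))

theorem fiberLift_ι {A B : NCat.{u} n} (χ : A ⟶ (ofPoset n hn).obj two.{u}) (ε : Fin 2)
    (f : B ⟶ A) (hf) : fiberLift χ ε f hf ≫ fiberι χ ε = f := rfl

/-- The fibre of `χ` has the universal property of the pullback, so comparing it with a given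
pullback yields injectivity and the image. Conversely, a map into `B` with values in the fibre lifts
cell by cell, and injectivity makes the lift functorial and unique. -/
theorem isInverseImage_endpoint_iff {A B : NCat.{u} n} (f : A ⟶ B) (ε : Fin 2) :
    IsInverseImage ((ofPoset n hn).map (PartOrd.endpoint ε)) f ↔
      ∃ χ : B ⟶ (ofPoset n hn).obj two.{u}, Function.Injective (app f) ∧
        ∀ x, (∃ y, app f y = x) ↔ Over χ ε x := by
  let pt (C : NCat.{u} n) : C ⟶ (ofPoset n hn).obj (PartOrd.of PUnit.{u + 1}) :=
    toPoset hn _ (fun _ => PUnit.unit) (fun _ => le_rfl)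
  constructor
  · rintro ⟨p, χ, h⟩
    have hf : ∀ y, Over χ ε (app f y) := fun y => by
      rw [Over, ← comp_app, h.w]; rfl
    let l : fiber χ ε ⟶ A := h.lift (fiberι χ ε) (pt _) (by
      ext x
      exact Subtype.ext x.2)
    have hl : l ≫ f = fiberι χ ε := h.lift_fst _ _ _
    have hl' : fiberLift χ ε f hf ≫ l = 𝟙 A := by
      apply h.hom_ext
      · rw [Category.assoc, hl, fiberLift_ι, Category.id_comp]
      · ext x; exact ofPoset_cell_ext rfl rfl
    refine ⟨χ, fun x y hxy => ?_, fun x => ⟨?_, fun hx => ⟨app l ⟨x, hx⟩, ?_⟩⟩⟩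
    · have hx := congrArg (fun g => app g x) hl'
      have hy := congrArg (fun g => app g y) hl'
      simp only [comp_app, id_app] at hx hy
      rw [← hx, ← hy]
      congr 1
      exact Subtype.ext hxy
    · rintro ⟨y, rfl⟩
      exact hf y
    · exact congrArg (fun g : fiber χ ε ⟶ B => app g ⟨x, hx⟩) hl
  · rintro ⟨χ, hinj, hr⟩
    refine ⟨pt A, χ, ⟨?_⟩, ⟨PullbackCone.IsLimit.mk _ ?_ ?_ ?_ ?_⟩⟩
    · ext x
      have := (hr (app f x)).1 ⟨x, rfl⟩
      exact Subtype.ext this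
    · intro s
      have hs : ∀ x, ∃ y, app f y = app s.fst x := fun x => (hr _).2 (by
        rw [Over, ← comp_app, s.condition]; rfl)
      choose g hg using hs
      refine homMk g (fun a k x => hinj ?_) (fun k x y h h' => hinj ?_)
      · rw [hg, app_bd, app_bd, hg]
      · rw [hg, app_comp, app_comp]
        exact OmegaCat.comp_congr _ (hg x).symm (hg y).symm _ _
    · intro s
      ext x
      have hs : ∀ x, ∃ y, app f y = app s.fst x := fun x => (hr _).2 (by
        rw [Over, ← comp_app, s.condition]; rfl)
      exact Classical.choose_spec (hs x)
    · intro s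
      ext x; rfl
    · intro s m hm _
      ext x
      apply hinj
      rw [← comp_app, hm]
      have hs : ∀ x, ∃ y, app f y = app s.fst x := fun x => (hr _).2 (by
        rw [Over, ← comp_app, s.condition]; rfl)
      exact (Classical.choose_spec (hs x)).symm

end NCat

/-- The pullback is compared with the subset `χ = ε` carrying the induced order; this is why `j`
reflects the order and is not merely injective. -/
theorem PartOrd.exists_of_isInverseImage_endpoint {E' E : PartOrd.{u}} {j : E' ⟶ E} {ε : Fin 2}
    (h : IsInverseImage (PartOrd.endpoint.{u} ε) j) :
    ∃ χ : E →o Fin 2, (∀ x y, j x ≤ j y → x ≤ y) ∧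
      ∀ x, (∃ y, j y = x) ↔ χ x = ε := by
  obtain ⟨p, χ, h⟩ := h
  let F : PartOrd.{u} := PartOrd.of {x : E // (χ x).down = ε}
  let i : F ⟶ E := PartOrd.ofHom ⟨Subtype.val, fun _ _ h => h⟩
  let l : F ⟶ E' := h.lift i (PartOrd.ofHom (OrderHom.const _ PUnit.unit)) (by
    ext x
    exact congrArg Fin.val x.2)
  have hl : l ≫ j = i := h.lift_fst _ _ _
  have hj : ∀ y, (χ (j y)).down = ε := fun y => by
    have := congrArg (fun g => (g y).down) (congrArg (fun g => g.hom) h.w)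
    exact this
  let r : E' ⟶ F := PartOrd.ofHom ⟨fun y => ⟨j y, hj y⟩, fun _ _ h => j.hom.monotone h⟩
  have hr : r ≫ l = 𝟙 E' := by
    apply h.hom_ext
    · rw [Category.assoc, hl, Category.id_comp]; rfl
    · ext x
  refine ⟨⟨fun x => (χ x).down, fun x y h => χ.hom.monotone h⟩, fun x y hxy => ?_,
    fun x => ⟨?_, fun hx => ⟨l ⟨x, hx⟩, ?_⟩⟩⟩
  · have hx : l (r x) = x := congrArg (fun g => g.hom x) hr
    have hy : l (r y) = y := congrArg (fun g => g.hom y) hr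
    rw [← hx, ← hy]
    exact l.hom.monotone hxy
  · rintro ⟨y, rfl⟩
    exact hj y
  · exact congrArg (fun g => g.hom ⟨x, hx⟩) hl

/-! ### Cones: adjoining a terminal or an initial object. -/

namespace OmegaCat

/-- Cells of the `∞`-category obtained from `D` by adding an object `out` and a unique arrow
`mid x` between each object `x` of `D` and `out`. -/
inductive ConeCell (D : OmegaCat.{u}) : Type u
  | inn (x : D.Cell)
  | mid (x : D.Cell) (h : ∀ a, D.bd a 0 x = x)
  | out

namespace ConeCell

variable {D : OmegaCat.{u}}

/-- The boundaries; the arrows `mid x` have `x` as source if `e = false`, as target if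
`e = true`. -/
def bd (e a : Bool) : ℕ → ConeCell D → ConeCell D
  | k, inn x => inn (D.bd a k x)
  | _, out => out
  | 0, mid x _ => if a = e then inn x else out
  | _ + 1, mid x h => mid x h

/-- The arrow between the `e`-end of `x` and `out`. -/
def midEnd (e : Bool) (x : D.Cell) : ConeCell D := mid (D.bd e 0 x) fun a => by simp

open Classical in
/-- The composition; only the values on composable pairs matter. -/
noncomputable def comp (e : Bool) (k : ℕ) : ConeCell D → ConeCell D → ConeCell D
  | inn x, inn y => if h : D.bd false k x = D.bd true k y then inn (D.comp k x y h) else inn x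
  | inn x, mid _ _ => midEnd e x
  | mid _ _, inn y => midEnd e y
  | mid x h, mid _ _ => mid x h
  | out, y => y
  | inn x, out => inn x
  | mid x h, out => mid x h

theorem midEnd_congr {e : Bool} {x y : D.Cell} (h : D.bd e 0 x = D.bd e 0 y) :
    (midEnd e x : ConeCell D) = midEnd e y := by
  simp only [midEnd, h]

@[simp] theorem bd_inn (e a : Bool) (k : ℕ) (x : D.Cell) :
    bd e a k (inn x) = inn (D.bd a k x) := by cases k <;> rfl

@[simp] theorem bd_out (e a : Bool) (k : ℕ) : bd e a k (out : ConeCell D) = out := by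
  cases k <;> rfl

@[simp] theorem bd_zero_mid (e a : Bool) (x : D.Cell) (h) :
    bd e a 0 (mid x h) = if a = e then inn x else out := rfl

@[simp] theorem bd_succ_mid (e a : Bool) (k : ℕ) (x : D.Cell) (h) :
    bd e a (k + 1) (mid x h) = mid x h := rfl

theorem comp_inn {e : Bool} {k : ℕ} {x y : D.Cell} (h : D.bd false k x = D.bd true k y) :
    comp e k (inn x) (inn y) = inn (D.comp k x y h) := dif_pos h

/-- The added cells have dimension at most `1`, so outside `D` composition in positive dimension is
trivial. This reduces interchange in the cone to interchange in `D` and to whiskering by added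
cells. -/
theorem eq_or_inn_of_bd_succ {e : Bool} {k : ℕ} {x y : ConeCell D}
    (h : bd e false (k + 1) x = bd e true (k + 1) y) :
    (∃ x' y', x = inn x' ∧ y = inn y' ∧ D.bd false (k + 1) x' = D.bd true (k + 1) y') ∨
      x = y ∧ ∀ x', x ≠ inn x' := by
  cases x <;> cases y <;> simp_all

end ConeCell

theorem bd_zero_comp_of_pos (D : OmegaCat.{u}) {k : ℕ} (hk : 0 < k) {x y : D.Cell}
    (h : D.bd false k x = D.bd true k y) (a : Bool) :
    D.bd a 0 (D.comp k x y h) = D.bd a 0 y := by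
  cases a
  · exact D.src_zero_comp k x y h
  · rw [D.tgt_zero_comp, D.bd_zero_eq_of_pos hk h]

open ConeCell in
/-- The `∞`-category obtained from `D` by adding an object `out` and a unique arrow between each
object of `D` and `out`, directed towards `out` if `e = false`, from `out` if `e = true`. -/
noncomputable def cone (e : Bool) (D : OmegaCat.{u}) : OmegaCat.{u} where
  Cell := ConeCell D
  bd := ConeCell.bd e
  comp k x y _ := ConeCell.comp e k x y
  bd_bd_of_lt a b j k x hjk := by
    obtain ⟨k, rfl⟩ := Nat.exists_eq_succ_of_ne_zero (Nat.ne_zero_of_lt hjk)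
    cases x <;> simp [D.bd_bd_of_lt _ _ _ _ _ hjk]
  bd_bd_of_le a b j k x hjk := by
    cases x with
    | inn x => simp [D.bd_bd_of_le _ _ _ _ _ hjk]
    | mid x h =>
      cases j with
      | zero =>
        rw [bd_zero_mid]
        split_ifs
        · simp only [bd_inn, inn.injEq]
          rw [← h a, D.bd_bd_of_le _ _ _ _ _ hjk]
        · simp
      | succ j =>
        cases k with
        | zero => omega
        | succ k => rfl
    | out => simp
  exists_dim x := by
    cases x with
    | inn x => exact (D.exists_dim x).imp fun k h => by simp [h]
    | mid x h => exact ⟨1, rfl⟩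
    | out => exact ⟨0, rfl⟩
  src_comp k x y h := by
    have h₀ := h
    cases k <;> cases x <;> cases y <;> cases e <;> (try simp at h₀) <;>
      simp_all [ConeCell.comp, D.src_comp, midEnd]
  tgt_comp k x y h := by
    have h₀ := h
    cases k <;> cases x <;> cases y <;> cases e <;> (try simp at h₀) <;>
      simp_all [ConeCell.comp, D.tgt_comp, midEnd]
  bd_comp a j k x y h h' hjk := by
    obtain ⟨k, rfl⟩ := Nat.exists_eq_succ_of_ne_zero (Nat.ne_zero_of_lt hjk)
    have h₀ := h
    cases j <;> cases x <;> cases y <;> cases e <;> (try simp at h₀) <;>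
      simp_all [ConeCell.comp, midEnd, D.bd_bd_of_lt, D.bd_comp]
  comp_unit k x h := by
    cases x with
    | inn x => simp [ConeCell.comp, D.comp_unit, D.bd_bd_of_le]
    | mid x hx => cases k <;> cases e <;> simp [ConeCell.comp, midEnd, hx]
    | out => simp [ConeCell.comp]
  unit_comp k x h := by
    have h₀ := h
    cases k <;> cases x <;> cases e <;> (try simp at h₀) <;>
      simp_all [ConeCell.comp, midEnd, D.unit_comp]
  assoc k x y z hxy hyz h h' := by
    have h₀ := hxy
    have h₁ := hyz
    cases k <;> cases x <;> cases y <;> cases e <;> (try simp at h₀) <;> cases z <;>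
      (try simp at h₁) <;>
      simp_all [ConeCell.comp, midEnd, D.assoc, D.src_zero_comp, D.tgt_zero_comp]
  interchange j k x y z w hjk hxy hzw hxz hyw h h' := by
    obtain ⟨k, rfl⟩ := Nat.exists_eq_succ_of_ne_zero (Nat.ne_zero_of_lt hjk)
    rcases eq_or_inn_of_bd_succ hxy with ⟨x, y, rfl, rfl, exy⟩ | ⟨rfl, hx⟩ <;>
      rcases eq_or_inn_of_bd_succ hzw with ⟨z, w, rfl, rfl, ezw⟩ | ⟨rfl, hz⟩
    · have hxz' : D.bd false j x = D.bd true j z := by simpa using hxz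
      have hyw' : D.bd false j y = D.bd true j w := by simpa using hyw
      rw [comp_inn exy, comp_inn ezw] at h ⊢
      rw [comp_inn hxz', comp_inn hyw'] at h' ⊢
      have h₁ := inn.inj ((bd_inn _ _ _ _).symm.trans (h.trans (bd_inn _ _ _ _)))
      have h₂ := inn.inj ((bd_inn _ _ _ _).symm.trans (h'.trans (bd_inn _ _ _ _)))
      rw [comp_inn h₁, comp_inn h₂, D.interchange j (k + 1) x y z w hjk exy ezw hxz' hyw' h₁ h₂]
    · have e₁ := D.bd_zero_eq_of_pos k.succ_pos exy
      have e₂ := fun a => D.bd_zero_comp_of_pos k.succ_pos exy a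
      cases e <;> cases z <;> simp_all [ConeCell.comp, midEnd]
    · have e₁ := D.bd_zero_eq_of_pos k.succ_pos ezw
      have e₂ := fun a => D.bd_zero_comp_of_pos k.succ_pos ezw a
      cases e <;> cases x <;> simp_all [ConeCell.comp, midEnd]
    · clear h h' hxy hzw
      cases x <;> cases z <;> first | exact absurd rfl (hx _) | exact absurd rfl (hz _) | rfl

end OmegaCat

namespace NCat

open OmegaCat ConeCell

variable {n : ℕ∞}

/-- The `n`-category obtained from `D` by adding an object and a unique arrow between each
object of `D` and it. -/
noncomputable def cone (hn : 1 ≤ n) (e : Bool) (D : NCat.{u} n) : NCat.{u} n :=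
  ⟨D.obj.cone e, fun x k hk => by
    cases k with
    | zero => exact absurd (hn.trans hk) (by simp)
    | succ k =>
      cases x with
      | inn x => exact (bd_inn e _ _ _).trans (congrArg inn (D.property x _ hk))
      | mid x h => rfl
      | out => rfl⟩

open Classical in
/-- The action on cells of `conePair`. -/
noncomputable def conePairFun (e : Bool) {A D : NCat.{u} n} (g : A ⟶ D)
    (o : A.obj.Cell → Prop) (x : A.obj.Cell) : ConeCell D.obj :=
  if o (A.obj.bd (!e) 0 x) then inn (app g x)
  else if o (A.obj.bd e 0 x) then midEnd e (app g x) else out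

/-- The functor to the cone which is `g` on the cells with all vertices in `o` and sends the
cells without vertices in `o` to the additional object. -/
noncomputable def conePair (hn : 1 ≤ n) (e : Bool) {A D : NCat.{u} n} (g : A ⟶ D)
    (o : A.obj.Cell → Prop)
    (ho : ∀ x, o (A.obj.bd (!e) 0 x) → o (A.obj.bd e 0 x)) : A ⟶ cone hn e D :=
  homMk (conePairFun e g o)
    (fun a k x => by
      have h := ho x
      change _ = ConeCell.bd e a k _
      simp only [conePairFun]
      rcases Nat.eq_zero_or_pos k with rfl | hk
      · cases e <;> cases a <;> simp only [bd_zero_bd_zero, Bool.not_true,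
          Bool.not_false] at h ⊢ <;> split_ifs <;>
          simp_all [app_bd, midEnd]
      · have e' : ∀ b, A.obj.bd b 0 (A.obj.bd a k x) = A.obj.bd b 0 x := fun b =>
          A.obj.bd_bd_of_lt _ _ _ _ _ hk
        rw [e', e']
        obtain ⟨k, rfl⟩ := Nat.exists_eq_succ_of_ne_zero hk.ne'
        split_ifs
        · simp [app_bd]
        · simp [midEnd, app_bd, D.obj.bd_bd_of_lt _ _ _ _ _ hk]
        · simp)
    (fun k x y h h' => by
      change _ = ConeCell.comp e k _ _
      have hx := ho x
      have hy := ho y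
      have e₁ := A.obj.src_zero_comp k x y h
      have e₂ := A.obj.tgt_zero_comp k x y h
      have e₃ := app_bd g
      have h₁ := app_composable g h
      have h₂ := app_comp g k x y h
      simp only [conePairFun]
      rcases Nat.eq_zero_or_pos k with rfl | hk
      · cases e <;> simp only [Bool.not_true, Bool.not_false, e₁, e₂, h] at hx hy ⊢ <;>
          split_ifs <;> simp_all [ConeCell.comp, midEnd, src_zero_comp, tgt_zero_comp]
      -- For `k > 0` the two cells and their composite share their `0`-boundaries, hence fall in the
      -- same branch of `conePairFun`.
      · have e₄ := fun a => A.obj.bd_zero_eq_of_pos hk h a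
        have e₅ := fun a => A.obj.bd_zero_comp_of_pos hk h a
        have e₆ := fun a => D.obj.bd_zero_eq_of_pos hk h₁ a
        have e₇ := fun a => D.obj.bd_zero_comp_of_pos hk h₁ a
        rw [e₄, e₄, e₅, e₅]
        split_ifs
        · rw [comp_inn h₁, h₂]
        · rw [h₂]
          exact midEnd_congr ((e₇ e).trans (e₆ e).symm)
        · rfl)

theorem conePair_app (hn : 1 ≤ n) (e : Bool) {A D : NCat.{u} n} (g : A ⟶ D)
    (o : A.obj.Cell → Prop) (ho) (x : A.obj.Cell) :
    app (conePair hn e g o ho) x = conePairFun e g o x := rfl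

/-- The constant functor to the additional object of the cone. -/
noncomputable def coneOut (hn : 1 ≤ n) (e : Bool) (A D : NCat.{u} n) : A ⟶ cone hn e D :=
  homMk (fun _ => (out : ConeCell D.obj)) (fun a k _ => (bd_out e a k).symm) (fun _ _ _ _ _ => rfl)

end NCat

/-! ### Weights on simplices: bounds and supports of nonnegative chains. -/

namespace SimplexChain

variable {m q : ℕ}

/-- The `k`-th face of a simplex. -/
abbrev face (x : Fin (q + 2) ↪o Fin (m + 1)) (k : Fin (q + 2)) : Fin (q + 1) ↪o Fin (m + 1) :=
  (Fin.succAboveOrderEmb k).trans x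

/-- The value on the boundary of a simplex of the linear form with given values on simplices. -/
def boundaryWeight (w : (Fin (q + 1) ↪o Fin (m + 1)) → ℤ) (x : Fin (q + 2) ↪o Fin (m + 1)) : ℤ :=
  ∑ k : Fin (q + 2), (-1 : ℤ) ^ (k : ℕ) * w (face x k)

theorem linearCombination_boundary (w : (Fin (q + 1) ↪o Fin (m + 1)) → ℤ)
    (c : SimplexChain m (q + 1)) :
    Finsupp.linearCombination ℤ w (boundary m q c) = ∑ x, c x * boundaryWeight w x := by
  have : Finsupp.linearCombination ℤ w ∘ₗ boundary m q =
      Finsupp.linearCombination ℤ (boundaryWeight w) := by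
    ext x
    simp [boundary_single, boundaryWeight]
  rw [← LinearMap.comp_apply, this, Finsupp.linearCombination_apply,
    Finsupp.sum_fintype _ _ (by simp)]
  rfl

/-- Pairing `w` with the boundary gives a sum of nonnegative terms `c y * boundaryWeight w y`, and
the term at `x` is at least `c x` because a positive integer is at least `1`. -/
theorem coeff_le_of_boundaryWeight {w : (Fin (q + 1) ↪o Fin (m + 1)) → ℤ}
    (hw : ∀ x, 0 ≤ boundaryWeight w x) {c : SimplexChain m (q + 1)} (hc : 0 ≤ c)
    {x : Fin (q + 2) ↪o Fin (m + 1)} (hx : 0 < boundaryWeight w x) :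
    c x ≤ Finsupp.linearCombination ℤ w (boundary m q c) := by
  rw [linearCombination_boundary]
  refine le_trans ?_ (Finset.single_le_sum (f := fun x => c x * boundaryWeight w x)
    (fun y _ => mul_nonneg (hc y) (hw y)) (Finset.mem_univ x))
  exact le_mul_of_one_le_right (hc x) hx

/-- The other `q + 1` terms contribute at least `-(q + 1) * M`, so `M` is left over. -/
theorem sum_pos_of_dominant {f : Fin (q + 2) → ℤ} {M : ℤ} (hM : 0 < M) (k₀ : Fin (q + 2))
    (h₀ : (q + 2) * M ≤ f k₀) (h : ∀ k, k ≠ k₀ → -M ≤ f k) : 0 < ∑ k, f k := by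
  rw [← Finset.add_sum_erase _ _ (Finset.mem_univ k₀)]
  have : ∑ k ∈ Finset.univ.erase k₀, (-M) ≤ ∑ k ∈ Finset.univ.erase k₀, f k :=
    Finset.sum_le_sum fun k hk => h k (Finset.ne_of_mem_erase hk)
  rw [Finset.sum_const, Finset.card_erase_of_mem (Finset.mem_univ _), Finset.card_univ,
    Fintype.card_fin, nsmul_eq_mul] at this
  push_cast at this
  nlinarith

open Classical in
/-- A weight dominated by the face opposite to the first vertex. -/
noncomputable def initialWeight (P : (Fin (q + 1) ↪o Fin (m + 1)) → Prop)
    (x : Fin (q + 1) ↪o Fin (m + 1)) : ℤ :=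
  if P x then (q + 2 : ℤ) ^ (x 0 : ℕ) else 0

open Classical in
/-- A weight dominated by the face opposite to the last vertex. -/
noncomputable def finalWeight (P : (Fin (q + 1) ↪o Fin (m + 1)) → Prop)
    (x : Fin (q + 1) ↪o Fin (m + 1)) : ℤ :=
  if P x then (-1) ^ (q + 1) * (q + 2 : ℤ) ^ (m - x (Fin.last q) : ℕ) else 0

/-- Only the face opposite to the first vertex has a larger first vertex. Raising the base `q + 2`
to the first vertex makes that face outweigh the `q + 1` others, whatever their signs and whether or
not they satisfy `P`. -/
theorem boundaryWeight_initialWeight_pos {P : (Fin (q + 1) ↪o Fin (m + 1)) → Prop}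
    {x : Fin (q + 2) ↪o Fin (m + 1)} (h : P (face x 0)) :
    0 < boundaryWeight (initialWeight P) x := by
  refine sum_pos_of_dominant (M := (q + 2 : ℤ) ^ (x 0 : ℕ)) (by positivity) 0 ?_ ?_
  · have hlt : (x 0 : ℕ) < x 1 := x.strictMono (by simp)
    simp only [initialWeight, if_pos h]
    rw [← pow_succ']
    simp only [Fin.val_zero, pow_zero, one_mul]
    exact pow_le_pow_right₀ (by omega) hlt
  · intro k hk
    have e : face x k 0 = x 0 := by
      change x (k.succAbove 0) = x 0
      rw [Fin.succAbove_ne_zero_zero hk]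
    unfold initialWeight
    rw [e]
    have hp : 0 < (q + 2 : ℤ) ^ (x 0 : ℕ) := by positivity
    split_ifs
    · rcases neg_one_pow_eq_or ℤ (k : ℕ) with h | h <;> rw [h] <;> linarith
    · linarith

/-- The mirror image: only the face opposite to the last vertex has a smaller last vertex, and the
sign `(-1) ^ (q + 1)` in the weight cancels the sign of this face in the boundary. -/
theorem boundaryWeight_finalWeight_pos {P : (Fin (q + 1) ↪o Fin (m + 1)) → Prop}
    {x : Fin (q + 2) ↪o Fin (m + 1)} (h : P (face x (Fin.last _))) :
    0 < boundaryWeight (finalWeight P) x := by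
  refine sum_pos_of_dominant (M := (q + 2 : ℤ) ^ (m - x (Fin.last _) : ℕ)) (by positivity)
    (Fin.last _) ?_ ?_
  · have e : face x (Fin.last _) (Fin.last _) = x (Fin.last q).castSucc := by
      change x ((Fin.last _).succAbove _) = _
      rw [Fin.succAbove_last]
    have hlt : (x (Fin.last q).castSucc : ℕ) < x (Fin.last (q + 1)) :=
      x.strictMono (Fin.castSucc_lt_last _)
    have := (x (Fin.last (q + 1))).2
    simp only [finalWeight, if_pos h, e]
    rw [← pow_succ', Fin.val_last, ← mul_assoc, ← pow_add, Even.neg_one_pow ⟨_, rfl⟩, one_mul]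
    exact pow_le_pow_right₀ (by omega) (by omega)
  · intro k hk
    have e : face x k (Fin.last _) = x (Fin.last _) := by
      change x (k.succAbove _) = _
      rw [Fin.succAbove_ne_last_last hk]
    unfold finalWeight
    rw [e]
    have hp : 0 < (q + 2 : ℤ) ^ (m - x (Fin.last (q + 1)) : ℕ) := by positivity
    split_ifs
    · rcases neg_one_pow_eq_or ℤ (k : ℕ) with h | h <;>
        rcases neg_one_pow_eq_or ℤ (q + 1) with h' | h' <;> rw [h, h'] <;> linarith
    · linarith

/-- A weight vanishing on the simplices not satisfying `P`, with positive value on the boundary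
of those satisfying `P`. -/
theorem coeff_eq_zero_of_weight {P : (Fin (q + 1) ↪o Fin (m + 1)) → Prop}
    {Q : (Fin (q + 2) ↪o Fin (m + 1)) → Prop} {w : (Fin (q + 1) ↪o Fin (m + 1)) → ℤ}
    (hP : ∀ x, ¬ P x → w x = 0) (hQ : ∀ x, Q x → 0 < boundaryWeight w x)
    (hPQ : ∀ x k, ¬ Q x → ¬ P (face x k)) {c : SimplexChain m (q + 1)} (hc : 0 ≤ c)
    (hb : ∀ x, P x → boundary m q c x = 0) (x) (hx : Q x) : c x = 0 := by
  -- Outside `Q` no face satisfies `P`, so the boundary weight vanishes there. The pairing of `w`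
  -- with the boundary of `c` is then an upper bound for the coefficients on `Q`, and it is zero by
  -- `hb`.
  have hw : ∀ x, 0 ≤ boundaryWeight w x := fun x => by
    by_cases hx : Q x
    · exact (hQ x hx).le
    · exact (Finset.sum_eq_zero fun k _ => by rw [hP _ (hPQ x k hx), mul_zero]).ge
  refine le_antisymm ((coeff_le_of_boundaryWeight hw hc (hQ x hx)).trans_eq ?_) (hc x)
  rw [Finsupp.linearCombination_apply]
  refine Finset.sum_eq_zero fun y _ => ?_
  by_cases hy : P y
  · simp [hb y hy]
  · simp [hP y hy]

/-- In positive dimension, omitting the first vertex preserves the last one, so the dominant face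
for the initial weight still exceeds `t`; a simplex that stays below `t` has all its faces below
`t`. -/
theorem coeff_eq_zero_of_last {t : Fin (m + 1)} {c : SimplexChain m (q + 1)} (hc : 0 ≤ c)
    (hb : ∀ x, t < x (Fin.last q) → boundary m q c x = 0) (x)
    (hx : t < x (Fin.last (q + 1))) : c x = 0 := by
  refine coeff_eq_zero_of_weight (P := fun x => t < x (Fin.last q))
    (Q := fun x => t < x (Fin.last (q + 1))) (w := initialWeight fun x => t < x (Fin.last q))
    (fun x hx => if_neg hx) (fun x hx => boundaryWeight_initialWeight_pos ?_)
    (fun x k hx h => hx (h.trans_le (x.monotone (Fin.le_last _)))) hc hb x hx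
  change t < x ((0 : Fin _).succAbove (Fin.last q))
  rwa [Fin.succAbove_ne_last_last (by simp [Fin.ext_iff])]

/-- Dually, omitting the last vertex preserves the first one, so the final weight applies. -/
theorem coeff_eq_zero_of_first {t : Fin (m + 1)} {c : SimplexChain m (q + 1)} (hc : 0 ≤ c)
    (hb : ∀ x, x 0 < t → boundary m q c x = 0) (x) (hx : x 0 < t) : c x = 0 := by
  refine coeff_eq_zero_of_weight (P := fun x => x 0 < t)
    (Q := fun x => x 0 < t) (w := finalWeight fun x => x 0 < t)
    (fun x hx => if_neg hx) (fun x hx => boundaryWeight_finalWeight_pos ?_)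
    (fun x k hx h => hx ((x.monotone (Fin.zero_le _)).trans_lt h)) hc hb x hx
  change x ((Fin.last _).succAbove 0) < t
  rwa [Fin.succAbove_ne_zero_zero (by simp [Fin.ext_iff])]

/-- The nonnegative chains of positive degree with a given boundary are finite in number. -/
theorem finite_nonneg_of_boundary (d : SimplexChain m q) :
    {c : SimplexChain m (q + 1) | 0 ≤ c ∧ boundary m q c = d}.Finite := by
  -- With no condition on simplices, every boundary weight is positive, so `b` bounds every
  -- coefficient and the chains lie in a finite box.
  let b := Finsupp.linearCombination ℤ (initialWeight (m := m) (q := q) fun _ => True) d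
  refine Set.Finite.subset (Set.Finite.preimage (f := fun c : SimplexChain m (q + 1) => ⇑c)
    DFunLike.coe_injective.injOn (Set.finite_Icc (0 : (Fin (q + 2) ↪o Fin (m + 1)) → ℤ)
      (fun _ => b))) ?_
  rintro c ⟨hc, rfl⟩
  have hw : ∀ x, 0 < boundaryWeight (initialWeight (m := m) (q := q) fun _ => True) x :=
    fun x => boundaryWeight_initialWeight_pos trivial
  exact ⟨hc, fun x => coeff_le_of_boundaryWeight (fun x => (hw x).le) hc (hw x)⟩

theorem aug_apply (c : SimplexChain m 0) : aug m c = ∑ x, c x := by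
  rw [aug, Finsupp.linearCombination_apply, Finsupp.sum_fintype _ _ (by simp)]
  simp

theorem finite_nonneg_of_aug (d : ℤ) : {c : SimplexChain m 0 | 0 ≤ c ∧ aug m c = d}.Finite := by
  refine Set.Finite.subset (Set.Finite.preimage (f := fun c : SimplexChain m 0 => ⇑c)
    DFunLike.coe_injective.injOn (Set.finite_Icc (0 : (Fin 1 ↪o Fin (m + 1)) → ℤ)
      (fun _ => d))) ?_
  rintro c ⟨hc, rfl⟩
  refine ⟨hc, fun x => ?_⟩
  rw [aug_apply]
  exact Finset.single_le_sum (fun y _ => hc y) (Finset.mem_univ x)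

/-- The vertex `i` as a simplex of dimension `0`. -/
def vertex (i : Fin (m + 1)) : Fin 1 ↪o Fin (m + 1) :=
  OrderEmbedding.ofStrictMono (fun _ => i) (Subsingleton.strictMono _)

theorem vertex_apply_zero (x : Fin 1 ↪o Fin (m + 1)) : vertex (x 0) = x := by
  ext i
  rw [Subsingleton.elim i 0]; rfl

theorem exists_eq_single_of_aug {c : SimplexChain m 0} (hc : 0 ≤ c) (h : aug m c = 1) :
    ∃ i, c = Finsupp.single (vertex i) 1 := by
  rw [aug_apply] at h
  obtain ⟨x, -, hx⟩ : ∃ x ∈ Finset.univ, c x ≠ 0 := Finset.exists_ne_zero_of_sum_ne_zero (by omega)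
  have hx' : 1 ≤ c x := lt_of_le_of_ne (hc x) hx.symm
  have hs := Finset.add_sum_erase Finset.univ c (Finset.mem_univ x)
  have hnn : 0 ≤ ∑ y ∈ Finset.univ.erase x, c y := Finset.sum_nonneg fun y _ => hc y
  have h0 : ∑ y ∈ Finset.univ.erase x, c y = 0 := by omega
  refine ⟨x 0, Finsupp.ext fun y => ?_⟩
  rw [vertex_apply_zero]
  by_cases hy : y = x
  · subst hy; rw [Finsupp.single_eq_same]; omega
  · rw [Finsupp.single_eq_of_ne hy]
    exact (Finset.sum_eq_zero_iff_of_nonneg fun y _ => hc y).1 h0 y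
      (Finset.mem_erase.2 ⟨hy, Finset.mem_univ _⟩)

theorem single_vertex_injective {i j : Fin (m + 1)}
    (h : (Finsupp.single (vertex i) 1 : SimplexChain m 0) = Finsupp.single (vertex j) 1) :
    i = j := by
  have := Finsupp.single_left_injective (one_ne_zero) h
  exact congrArg (fun x => x 0) this

/-- A nonnegative `1`-chain goes upwards. -/
theorem le_of_boundary {c : SimplexChain m 1} (hc : 0 ≤ c) {i j : Fin (m + 1)}
    (h : boundary m 0 c = Finsupp.single (vertex j) 1 - Finsupp.single (vertex i) 1) : i ≤ j := by
  -- The weight of a vertex is its index, so an edge has weight target minus source, which is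
  -- positive; the total weight of `c` is `j - i`.
  have hw : ∀ x, 0 < boundaryWeight (m := m) (q := 0) (fun y => ((y 0 : ℕ) : ℤ)) x := fun x => by
    have : (x 0 : ℕ) < x 1 := x.strictMono (by simp)
    simp [boundaryWeight, Fin.sum_univ_two]
  have := linearCombination_boundary (fun y => ((y 0 : ℕ) : ℤ)) c
  rw [h, map_sub, Finsupp.linearCombination_single, Finsupp.linearCombination_single] at this
  have hn : 0 ≤ ∑ x, c x * boundaryWeight (m := m) (q := 0) (fun y => ((y 0 : ℕ) : ℤ)) x :=
    Finset.sum_nonneg fun x _ => mul_nonneg (hc x) (hw x).le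
  rw [← this] at hn
  simpa [vertex] using hn

end SimplexChain

/-! ### Cells of orientals: end vertices, supports, finiteness. -/

namespace OrientalCell

open SimplexChain

variable {m : ℕ}

/-- The `0`-dimensional source (`a = false`) and target (`a = true`) vertices. -/
noncomputable def vtx (a : Bool) (x : OrientalCell.{u} m) : Fin (m + 1) :=
  (exists_eq_single_of_aug (x.nonneg 0 a) (x.aug_eq a)).choose

theorem chain_zero (a : Bool) (x : OrientalCell.{u} m) :
    x.chain 0 a = Finsupp.single (vertex (x.vtx a)) 1 :=
  (exists_eq_single_of_aug (x.nonneg 0 a) (x.aug_eq a)).choose_spec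

theorem vtx_eq_of_chain {a : Bool} {x : OrientalCell.{u} m} {i : Fin (m + 1)}
    (h : x.chain 0 a = Finsupp.single (vertex i) 1) : x.vtx a = i :=
  single_vertex_injective ((chain_zero a x).symm.trans h)

theorem vtx_le (x : OrientalCell.{u} m) : x.vtx false ≤ x.vtx true :=
  le_of_boundary (x.nonneg 1 false) (by rw [x.boundary_eq, chain_zero, chain_zero])

theorem vtx_bd_zero (a b : Bool) (x : OrientalCell.{u} m) : (bd b 0 x).vtx a = x.vtx b :=
  vtx_eq_of_chain (chain_zero b x)

theorem vtx_bd_of_pos (a b : Bool) {k : ℕ} (hk : 0 < k) (x : OrientalCell.{u} m) :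
    (bd b k x).vtx a = x.vtx a :=
  vtx_eq_of_chain ((if_pos hk).trans (chain_zero a x))

theorem basisImage_vertex {p : ℕ} (f : Fin (m + 1) →o Fin (p + 1)) (i : Fin (m + 1)) :
    basisImage f (vertex i) = Finsupp.single (vertex (f i)) 1 :=
  basisImage_of_strictMono (Subsingleton.strictMono (α := Fin 1) _)

theorem vtx_map {p : ℕ} (f : Fin (m + 1) →o Fin (p + 1)) (a : Bool) (x : OrientalCell.{u} m) :
    (map f x).vtx a = f (x.vtx a) :=
  vtx_eq_of_chain (by
    rw [show (map f x).chain 0 a = SimplexChain.map f 0 (x.chain 0 a) from rfl, chain_zero,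
      map_single, basisImage_vertex])

theorem simplexChain_map_eq_self {q : ℕ} (f : Fin (m + 1) →o Fin (m + 1)) (c : SimplexChain m q)
    (h : ∀ x, c x ≠ 0 → ∀ i, f (x i) = x i) : SimplexChain.map f q c = c := by
  rw [SimplexChain.map, Finsupp.linearCombination_apply]
  conv_rhs => rw [← Finsupp.sum_single c]
  refine Finset.sum_congr rfl fun x hx => ?_
  have hx := h x (Finsupp.mem_support_iff.1 hx)
  have e : (fun i => f (x i)) = x := funext hx
  have hs : StrictMono (fun i => f (x i)) := by rw [e]; exact x.strictMono
  have e' : OrderEmbedding.ofStrictMono _ hs = x := by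
    ext i
    exact congrArg Fin.val (hx i)
  simp only [basisImage_of_strictMono hs, e', Finsupp.smul_single, smul_eq_mul, mul_one]

theorem map_eq_self_of_chain (f : Fin (m + 1) →o Fin (m + 1)) (x : OrientalCell.{u} m)
    (h : ∀ q a y, x.chain q a y ≠ 0 → ∀ i, f (y i) = y i) : map f x = x :=
  OrientalCell.ext (funext fun q => funext fun a => simplexChain_map_eq_self f _ (h q a))

/-- Induction on the degree: the boundary of a chain of `x` is a difference of chains of `x` one
degree lower, so it vanishes on simplices exceeding `t`, and positivity transfers this to the chain
itself. In degree `0`, the source vertex is at most the target vertex. -/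
theorem last_le_of_vtx_le {t : Fin (m + 1)} {x : OrientalCell.{u} m} (h : x.vtx true ≤ t)
    (q : ℕ) : ∀ a y, x.chain q a y ≠ 0 → y (Fin.last q) ≤ t := by
  induction q with
  | zero =>
    intro a y hy
    rw [chain_zero, Finsupp.single_apply_ne_zero] at hy
    rw [hy.1]
    cases a
    · exact x.vtx_le.trans h
    · exact h
  | succ q ih =>
    intro a y hy
    by_contra! hlt
    refine hy (coeff_eq_zero_of_last (x.nonneg _ a) (fun z hz => ?_) y hlt)
    rw [x.boundary_eq, Finsupp.sub_apply]
    have hz' : ∀ b, x.chain q b z = 0 := fun b => by_contra fun hb => absurd (ih b z hb) hz.not_ge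
    rw [hz', hz', sub_zero]

theorem le_first_of_le_vtx {t : Fin (m + 1)} {x : OrientalCell.{u} m} (h : t ≤ x.vtx false)
    (q : ℕ) : ∀ a y, x.chain q a y ≠ 0 → t ≤ y 0 := by
  induction q with
  | zero =>
    intro a y hy
    rw [chain_zero, Finsupp.single_apply_ne_zero] at hy
    rw [hy.1]
    cases a
    · exact h
    · exact h.trans x.vtx_le
  | succ q ih =>
    intro a y hy
    by_contra! hlt
    refine hy (coeff_eq_zero_of_first (x.nonneg _ a) (fun z hz => ?_) y hlt)
    rw [x.boundary_eq, Finsupp.sub_apply]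
    have hz' : ∀ b, x.chain q b z = 0 := fun b => by_contra fun hb => absurd (ih b z hb) hz.not_ge
    rw [hz', hz', sub_zero]

/-- The form in which supports are used: a retraction of the vertices acts trivially on every cell
whose far end it fixes together with all vertices before it. -/
theorem map_eq_self_of_vtx_le {t : Fin (m + 1)} {f : Fin (m + 1) →o Fin (m + 1)}
    (hf : ∀ i ≤ t, f i = i) {x : OrientalCell.{u} m} (h : x.vtx true ≤ t) : map f x = x :=
  map_eq_self_of_chain f x fun q a y hy i =>
    hf _ ((y.monotone (Fin.le_last i)).trans (last_le_of_vtx_le h q a y hy))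

theorem map_eq_self_of_le_vtx {t : Fin (m + 1)} {f : Fin (m + 1) →o Fin (m + 1)}
    (hf : ∀ i, t ≤ i → f i = i) {x : OrientalCell.{u} m} (h : t ≤ x.vtx false) : map f x = x :=
  map_eq_self_of_chain f x fun q a y hy i =>
    hf _ ((le_first_of_le_vtx h q a y hy).trans (y.monotone (Fin.zero_le i)))

/-- In degree `q + 1` the boundary is a difference of two of the finitely many chains of degree `q`,
and each boundary has finitely many nonnegative fillings. -/
theorem finite_chains (m q : ℕ) :
    {c : SimplexChain m q | ∃ (x : OrientalCell.{u} m) (a : Bool), x.chain q a = c}.Finite := by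
  induction q with
  | zero =>
    refine (finite_nonneg_of_aug (m := m) 1).subset ?_
    rintro _ ⟨x, a, rfl⟩
    exact ⟨x.nonneg 0 a, x.aug_eq a⟩
  | succ q ih =>
    refine ((ih.prod ih).biUnion fun p _ => finite_nonneg_of_boundary (p.1 - p.2)).subset ?_
    rintro _ ⟨x, a, rfl⟩
    simp only [Set.mem_iUnion]
    exact ⟨(x.chain q true, x.chain q false), ⟨⟨x, true, rfl⟩, ⟨x, false, rfl⟩⟩,
      x.nonneg _ a, x.boundary_eq q a⟩

instance (m : ℕ) : Finite (OrientalCell.{u} m) := by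
  have := fun q : Fin (m + 1) => (finite_chains.{u} m q).to_subtype
  refine Finite.of_injective (β := (q : Fin (m + 1)) → Bool →
    {c : SimplexChain m q | ∃ (x : OrientalCell.{u} m) (a : Bool), x.chain q a = c})
    (fun x q a => ⟨x.chain q a, x, a, rfl⟩) fun x y h => ?_
  ext1
  funext q a
  by_cases hq : q < m + 1
  · exact congrArg Subtype.val (congrFun (congrFun h ⟨q, hq⟩) a)
  · rw [x.chain_eq_zero (by omega), y.chain_eq_zero (by omega)]

theorem bd_zero_eq_of_vtx {a b : Bool} {x y : OrientalCell.{u} m} (h : x.vtx a = y.vtx b) :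
    bd a 0 x = bd b 0 y := by
  ext1
  funext q c
  simp only [bd, Nat.not_lt_zero, if_false]
  split_ifs with hq
  · subst hq
    rw [chain_zero, chain_zero, h]
  · rfl

/-- The edge from the vertex `i` to the vertex `j`. -/
def edge {i j : Fin (m + 1)} (h : i < j) : Fin 2 ↪o Fin (m + 1) :=
  OrderEmbedding.ofStrictMono (fun k => if k = 0 then i else j) (by
    rw [Fin.strictMono_iff_lt_succ]
    intro k
    rw [Subsingleton.elim k 0]
    exact h)

theorem boundary_edge {i j : Fin (m + 1)} (h : i < j) :
    boundary m 0 (Finsupp.single (edge h) 1) =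
      Finsupp.single (vertex j) 1 - Finsupp.single (vertex i) 1 := by
  rw [boundary_single, Fin.sum_univ_two]
  have e₀ : face (edge h) 0 = vertex j := by
    rw [← vertex_apply_zero (face (edge h) 0)]; rfl
  have e₁ : face (edge h) 1 = vertex i := by
    rw [← vertex_apply_zero (face (edge h) 1)]; rfl
  change _ • Finsupp.single (face (edge h) 0) 1 + _ • Finsupp.single (face (edge h) 1) 1 = _
  rw [e₀, e₁]
  simp [sub_eq_add_neg]

/-- The arrow from the vertex `i` to the vertex `j`. -/
noncomputable def arrow {i j : Fin (m + 1)} (h : i ≤ j) : OrientalCell.{u} m where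
  chain
    | 0, b => Finsupp.single (vertex (if b then j else i)) 1
    | 1, _ => if h : i < j then Finsupp.single (edge h) 1 else 0
    | _ + 2, _ => 0
  nonneg q b := by
    match q with
    | 0 => exact Finsupp.single_nonneg.mpr zero_le_one
    | 1 =>
      dsimp only
      split_ifs
      · exact Finsupp.single_nonneg.mpr zero_le_one
      · exact le_rfl
    | _ + 2 => exact le_rfl
  aug_eq b := by simp [aug]
  boundary_eq q b := by
    match q with
    | 0 =>
      by_cases h' : i < j
      · simpa [h'] using boundary_edge h'
      · simp [le_antisymm h (not_lt.1 h')]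
    | 1 => simp
    | _ + 2 => simp

theorem vtx_arrow {i j : Fin (m + 1)} (h : i ≤ j) (a : Bool) :
    (arrow.{u} h).vtx a = if a then j else i := vtx_eq_of_chain rfl

theorem bd_one_arrow {i j : Fin (m + 1)} (h : i ≤ j) : bd false 1 (arrow.{u} h) = arrow h := by
  ext1
  funext q b
  match q with
  | 0 => rfl
  | 1 => rfl
  | _ + 2 => rfl

end OrientalCell

/-! ### Truncated orientals -/

namespace OrientalTrunc

open OmegaCat OrientalCell

variable {n : ℕ∞} {S S' : SimplexCategory}

/-- The `0`-dimensional source and target vertices of a cell of the truncation. -/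
noncomputable def vtx (hn : 1 ≤ n) (a : Bool) :
    ((truncatedOriental.{u} n).obj S).obj.Cell → Fin (S.len + 1) :=
  TruncCell.lift (fun x _ => OrientalCell.vtx a x) fun k z hk _ => by
    -- Since `n ≥ 1`, cells identified by the truncation are parallel in positive dimension and
    -- share their end vertices.
    have hk' : 0 < k := by
      rw [hk] at hn
      exact_mod_cast hn
    exact (vtx_bd_of_pos a false hk' z).trans (vtx_bd_of_pos a true hk' z).symm

theorem vtx_bd_zero (hn : 1 ≤ n) (a b : Bool) (x : ((truncatedOriental.{u} n).obj S).obj.Cell) :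
    vtx hn a (OmegaCat.bd _ b 0 x) = vtx hn b x := by
  induction x using TruncCell.ind with
  | h x hx => exact OrientalCell.vtx_bd_zero a b x

theorem vtx_le (hn : 1 ≤ n) (x : ((truncatedOriental.{u} n).obj S).obj.Cell) :
    vtx hn false x ≤ vtx hn true x := by
  induction x using TruncCell.ind with
  | h x hx => exact OrientalCell.vtx_le x

theorem vtx_map (hn : 1 ≤ n) (f : S ⟶ S') (a : Bool)
    (x : ((truncatedOriental.{u} n).obj S).obj.Cell) :
    vtx hn a (NCat.app ((truncatedOriental.{u} n).map f) x) = f.toOrderHom (vtx hn a x) := by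
  induction x using TruncCell.ind with
  | h x hx => exact OrientalCell.vtx_map f.toOrderHom a x

theorem map_eq_self_of_vtx_le (hn : 1 ≤ n) {t : Fin (S.len + 1)} {f : S ⟶ S}
    (hf : ∀ i ≤ t, f.toOrderHom i = i) {x : ((truncatedOriental.{u} n).obj S).obj.Cell}
    (h : vtx hn true x ≤ t) : NCat.app ((truncatedOriental.{u} n).map f) x = x := by
  induction x using TruncCell.ind with
  | h x hx => exact TruncCell.mk_eq_of_eq (OrientalCell.map_eq_self_of_vtx_le hf h)

theorem map_eq_self_of_le_vtx (hn : 1 ≤ n) {t : Fin (S.len + 1)} {f : S ⟶ S}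
    (hf : ∀ i, t ≤ i → f.toOrderHom i = i) {x : ((truncatedOriental.{u} n).obj S).obj.Cell}
    (h : t ≤ vtx hn false x) : NCat.app ((truncatedOriental.{u} n).map f) x = x := by
  induction x using TruncCell.ind with
  | h x hx => exact TruncCell.mk_eq_of_eq (OrientalCell.map_eq_self_of_le_vtx hf h)

theorem bd_zero_eq_of_vtx (hn : 1 ≤ n) {a b : Bool}
    {x y : ((truncatedOriental.{u} n).obj S).obj.Cell} (h : vtx hn a x = vtx hn b y) :
    OmegaCat.bd _ a 0 x = OmegaCat.bd _ b 0 y := by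
  induction x using TruncCell.ind with
  | h x hx =>
    induction y using TruncCell.ind with
    | h y hy => exact TruncCell.mk_eq_of_eq (OrientalCell.bd_zero_eq_of_vtx h)

instance : Finite ((truncatedOriental.{u} n).obj S).obj.Cell := by
  have : Finite (oriental.{u} S.len).Cell := inferInstanceAs (Finite (OrientalCell.{u} S.len))
  exact inferInstanceAs (Finite (Quotient ((oriental.{u} S.len).truncSetoid n)))

/-- The functor to a partially ordered set induced by a monotone map. -/
noncomputable def toPoset (hn : 1 ≤ n) {P : PartOrd.{u}} (s : Fin (S.len + 1) →o P) :
    (truncatedOriental.{u} n).obj S ⟶ (NCat.ofPoset n hn).obj P :=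
  NCat.toPoset hn P (fun x => s (vtx hn false x)) fun x => by
    rw [vtx_bd_zero, vtx_bd_zero]
    exact s.monotone (vtx_le hn x)

theorem objVal_toPoset (hn : 1 ≤ n) {P : PartOrd.{u}} (s : Fin (S.len + 1) →o P)
    (x : ((truncatedOriental.{u} n).obj S).obj.Cell) :
    NCat.objVal (toPoset hn s) x = s (vtx hn false x) := by
  rw [toPoset, NCat.objVal_toPoset, vtx_bd_zero]

theorem map_toPoset (hn : 1 ≤ n) {P : PartOrd.{u}} (f : S ⟶ S') (s : Fin (S'.len + 1) →o P) :
    (truncatedOriental.{u} n).map f ≫ toPoset hn s = toPoset hn (s.comp f.toOrderHom) := by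
  refine NCat.toPoset_ext fun x a => ?_
  rw [NCat.objVal_comp, objVal_toPoset, objVal_toPoset, vtx_map]
  rfl

/-- For each vertex `i` there is a cell with source `0` and target `i`. -/
theorem exists_vtx (hn : 1 ≤ n) (i : Fin (S.len + 1)) :
    ∃ x : ((truncatedOriental.{u} n).obj S).obj.Cell, vtx hn false x = 0 ∧ vtx hn true x = i := by
  refine ⟨TruncCell.mk (C := oriental.{u} S.len) (arrow (Fin.zero_le i)) fun k hk => ?_,
    OrientalCell.vtx_arrow (Fin.zero_le i) _, OrientalCell.vtx_arrow (Fin.zero_le i) _⟩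
  have hk' : 1 ≤ k := by exact_mod_cast hn.trans hk
  have e : (oriental.{u} S.len).bd false k ((oriental.{u} S.len).bd false 1 _) =
    (oriental.{u} S.len).bd false 1 (arrow (Fin.zero_le i)) := OmegaCat.bd_bd_of_le _ _ _ _ _ _ hk'
  rwa [show (oriental.{u} S.len).bd false 1 (arrow (Fin.zero_le i)) = arrow (Fin.zero_le i) from
    bd_one_arrow _] at e

end OrientalTrunc

/-! ### Strict `n`-categories presented by generators -/

namespace NCat

variable {n : ℕ∞}

/-- Formal iterated boundaries and composites of generators. -/
inductive Term (G : Type u) : Type u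
  | gen (g : G)
  | bd (a : Bool) (k : ℕ) (t : Term G)
  | comp (k : ℕ) (s t : Term G)

namespace Term

variable {G : Type u}

open Classical in
/-- The value of a term; the formal composites that do not exist have an arbitrary value. -/
noncomputable def eval (C : OmegaCat.{u}) (v : G → C.Cell) : Term G → C.Cell
  | gen g => v g
  | bd a k t => C.bd a k (eval C v t)
  | comp k s t =>
    if h : C.bd false k (eval C v s) = C.bd true k (eval C v t) then
      C.comp k (eval C v s) (eval C v t) h
    else eval C v s

variable (M : (C : NCat.{u} n) → (G → C.obj.Cell) → Prop)

/-- A term is defined if all composites in it exist in every model. -/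
inductive IsDefined : Term G → Prop
  | gen (g : G) : IsDefined (gen g)
  | bd (a : Bool) (k : ℕ) (t : Term G) : IsDefined t → IsDefined (bd a k t)
  | comp (k : ℕ) (s t : Term G) : IsDefined s → IsDefined t →
    (∀ C v, M C v → C.obj.bd false k (eval C.obj v s) = C.obj.bd true k (eval C.obj v t)) →
    IsDefined (comp k s t)

/-- Two terms are equivalent if they agree in every model. -/
def setoid : Setoid {t : Term G // IsDefined M t} where
  r s t := ∀ C v, M C v → eval C.obj v s.1 = eval C.obj v t.1
  iseqv := ⟨fun _ _ _ _ => rfl, fun h C v hv => (h C v hv).symm,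
    fun h h' C v hv => (h C v hv).trans (h' C v hv)⟩

/-- The cells presented by the generators `G` with the models `M`. -/
def Presented : Type u := Quotient (setoid M)

variable {M}

namespace Presented

/-- The class of a defined term. -/
def mk (t : Term G) (ht : IsDefined M t) : Presented M := Quotient.mk (setoid M) ⟨t, ht⟩

theorem exists_mk (p : Presented M) : ∃ t ht, mk t ht = p :=
  Quotient.inductionOn p fun t => ⟨t.1, t.2, rfl⟩

/-- The value of a presented cell in a model. -/
noncomputable def ev {C : NCat.{u} n} {v : G → C.obj.Cell} (hv : M C v) :
    Presented M → C.obj.Cell :=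
  Quotient.lift (s := setoid M) (fun t => eval C.obj v t.1) fun _ _ h => h C v hv

/-- Evaluations in models are jointly injective by construction, so every axiom of `n`-categories
for presented cells is inherited from the models. -/
theorem ext {p q : Presented M}
    (h : ∀ (C : NCat.{u} n) (v : G → C.obj.Cell) (hv : M C v), ev hv p = ev hv q) : p = q := by
  obtain ⟨s, hs, rfl⟩ := exists_mk p
  obtain ⟨t, ht, rfl⟩ := exists_mk q
  exact Quotient.sound (s := setoid M) h

theorem exists_bd (a : Bool) (k : ℕ) (p : Presented M) : ∃ q : Presented M,
    ∀ (C : NCat.{u} n) (v : G → C.obj.Cell) (hv : M C v), ev hv q = C.obj.bd a k (ev hv p) := by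
  obtain ⟨t, ht, rfl⟩ := exists_mk p
  exact ⟨mk _ (ht.bd a k), fun _ _ _ => rfl⟩

/-- The boundaries of presented cells. -/
noncomputable def bd (a : Bool) (k : ℕ) (p : Presented M) : Presented M := (exists_bd a k p).choose

theorem ev_bd {C : NCat.{u} n} {v : G → C.obj.Cell} (hv : M C v) (a : Bool) (k : ℕ)
    (p : Presented M) : ev hv (bd a k p) = C.obj.bd a k (ev hv p) :=
  (exists_bd a k p).choose_spec C v hv

theorem ev_composable {C : NCat.{u} n} {v : G → C.obj.Cell} (hv : M C v) {k : ℕ}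
    {p q : Presented M} (h : bd false k p = bd true k q) :
    C.obj.bd false k (ev hv p) = C.obj.bd true k (ev hv q) := by
  rw [← ev_bd, ← ev_bd, h]

theorem exists_comp (k : ℕ) (p q : Presented M) (h : bd false k p = bd true k q) :
    ∃ r : Presented M, ∀ (C : NCat.{u} n) (v : G → C.obj.Cell) (hv : M C v),
      ev hv r = C.obj.comp k (ev hv p) (ev hv q) (ev_composable hv h) := by
  obtain ⟨s, hs, rfl⟩ := exists_mk p
  obtain ⟨t, ht, rfl⟩ := exists_mk q
  -- Composability of the classes means composability in every model, which is exactly what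
  -- definedness of the formal composite requires.
  exact ⟨mk _ (hs.comp k _ _ ht fun C v hv => ev_composable hv h),
    fun C v hv => dif_pos (ev_composable hv h)⟩

/-- The composites of presented cells. -/
noncomputable def comp (k : ℕ) (p q : Presented M) (h : bd false k p = bd true k q) :
    Presented M := (exists_comp k p q h).choose

theorem ev_comp {C : NCat.{u} n} {v : G → C.obj.Cell} (hv : M C v) (k : ℕ)
    (p q : Presented M) (h : bd false k p = bd true k q) :
    ev hv (comp k p q h) = C.obj.comp k (ev hv p) (ev hv q) (ev_composable hv h) :=
  (exists_comp k p q h).choose_spec C v hv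

/-- A presented cell has finite dimension only if the dimensions of its values are bounded uniformly
over all models; for a composite, the maximum of the two bounds works. -/
theorem exists_isCell (hM : ∀ g : G, ∃ d : ℕ, ∀ C v, M C v → C.obj.IsCell d (v g))
    {t : Term G} (ht : IsDefined M t) :
    ∃ d : ℕ, ∀ C v, M C v → C.obj.IsCell d (eval C.obj v t) := by
  induction ht with
  | gen g => exact hM g
  | bd a k t _ ih =>
    obtain ⟨d, hd⟩ := ih
    exact ⟨d, fun C v hv => (hd C v hv).bd a k⟩
  | comp k s t _ _ h ih₁ ih₂ =>
    obtain ⟨d₁, h₁⟩ := ih₁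
    obtain ⟨d₂, h₂⟩ := ih₂
    refine ⟨max d₁ d₂, fun C v hv => ?_⟩
    rw [eval, dif_pos (h C v hv)]
    refine OmegaCat.IsCell.comp (fun j hj => h₁ C v hv j (le_trans ?_ hj))
      (fun j hj => h₂ C v hv j (le_trans ?_ hj)) _ _
    · exact_mod_cast le_max_left _ _
    · exact_mod_cast le_max_right _ _

/-- The `n`-category presented by the generators `G` with the models `M`. -/
noncomputable def ncat (hM : ∀ g : G, ∃ d : ℕ, ∀ C v, M C v → C.obj.IsCell d (v g)) :
    NCat.{u} n where
  obj :=
    { Cell := Presented M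
      bd := bd
      comp := comp
      bd_bd_of_lt := fun a b j k x h => ext fun C v hv => by
        simp only [ev_bd]; exact C.obj.bd_bd_of_lt _ _ _ _ _ h
      bd_bd_of_le := fun a b j k x h => ext fun C v hv => by
        simp only [ev_bd]; exact C.obj.bd_bd_of_le _ _ _ _ _ h
      exists_dim := fun x => by
        obtain ⟨t, ht, rfl⟩ := exists_mk x
        obtain ⟨d, hd⟩ := exists_isCell hM ht
        exact ⟨d, ext fun C v hv => by rw [ev_bd]; exact hd C v hv d le_rfl⟩
      src_comp := fun k x y h => ext fun C v hv => by
        simp only [ev_bd, ev_comp]; exact C.obj.src_comp _ _ _ _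
      tgt_comp := fun k x y h => ext fun C v hv => by
        simp only [ev_bd, ev_comp]; exact C.obj.tgt_comp _ _ _ _
      bd_comp := fun a j k x y h h' hjk => ext fun C v hv => by
        simp only [ev_bd, ev_comp]
        exact C.obj.bd_comp _ _ _ _ _ _ (C.obj.bd_bd_congr (ev_composable hv h) _ hjk) hjk
      comp_unit := fun k x h => ext fun C v hv => by
        simp only [ev_bd, ev_comp]
        exact C.obj.comp_unit _ _ (by simpa only [ev_bd] using ev_composable hv h)
      unit_comp := fun k x h => ext fun C v hv => by
        simp only [ev_bd, ev_comp]
        exact C.obj.unit_comp _ _ (by simpa only [ev_bd] using ev_composable hv h)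
      assoc := fun k x y z hxy hyz h h' => ext fun C v hv => by
        simp only [ev_comp]
        exact C.obj.assoc _ _ _ _ _ _ (by simpa only [ev_comp] using ev_composable hv h)
          (by simpa only [ev_comp] using ev_composable hv h')
      interchange := fun j k x y z w hjk hxy hzw hxz hyw h h' => ext fun C v hv => by
        simp only [ev_comp]
        exact C.obj.interchange _ _ _ _ _ _ hjk _ _ _ _
          (by simpa only [ev_comp] using ev_composable hv h)
          (by simpa only [ev_comp] using ev_composable hv h') }
  property x k hk := ext fun C v hv => (ev_bd hv _ _ x).trans (C.property _ k hk)

/-- The generators as cells. -/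
def gen (g : G) : Presented M := mk (.gen g) (.gen g)

variable (hM : ∀ g : G, ∃ d : ℕ, ∀ C v, M C v → C.obj.IsCell d (v g))

/-- The functor given by a model. -/
noncomputable def desc {C : NCat.{u} n} {v : G → C.obj.Cell} (hv : M C v) : ncat hM ⟶ C :=
  homMk (ev hv) (fun a k x => ev_bd hv a k x) (fun k x y h _ => ev_comp hv k x y h)

theorem hom_ext {C : NCat.{u} n} {f g : ncat hM ⟶ C}
    (h : ∀ x : G, app f (gen x : Presented M) = app g (gen x : Presented M)) : f = g := by
  ext x
  obtain ⟨t, ht, rfl⟩ := exists_mk (M := M) x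
  induction ht with
  | gen x => exact h x
  | bd a k t ht ih =>
    have e : (mk (.bd a k t) (ht.bd a k _) : Presented M) = bd a k (mk t ht) :=
      ext fun C v hv => (ev_bd hv a k (mk t ht)).symm
    rw [e]
    exact (app_bd f a k (mk t ht : Presented M)).trans
      ((congrArg _ ih).trans (app_bd g a k (mk t ht : Presented M)).symm)
  | comp k s t hs ht hst ih₁ ih₂ =>
    have hc : bd false k (mk s hs) = bd true k (mk t ht) := ext fun C v hv => by
      rw [ev_bd, ev_bd]; exact hst C v hv
    have e : (mk (.comp k s t) (hs.comp k _ _ ht hst) : Presented M) =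
        comp k (mk s hs) (mk t ht) hc :=
      ext fun C v hv => (dif_pos (hst C v hv)).trans (ev_comp hv k (mk s hs) (mk t ht) hc).symm
    rw [e]
    exact (app_comp f k (mk s hs : Presented M) (mk t ht : Presented M) hc).trans
      ((OmegaCat.comp_congr _ ih₁ ih₂ _ _).trans
        (app_comp g k (mk s hs : Presented M) (mk t ht : Presented M) hc).symm)

end Presented

end Term

end NCat

/-! ### Maps to the nerve as compatible families of functors. -/

namespace StreetNerve

open Opposite NCat

variable {n : ℕ∞} {X : SSet.{u}} {C : NCat.{u} n} {S S' : SimplexCategory}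

/-- The `n`-functor corresponding to the image of a simplex in the nerve. -/
def simplexMap (h : X ⟶ (streetNerve.{u} n).obj C) (x : X.obj (op S)) :
    (truncatedOriental.{u} n).obj S ⟶ C :=
  ULift.down (h.app (op S) x)

theorem simplexMap_map (h : X ⟶ (streetNerve.{u} n).obj C) (f : S ⟶ S') (x : X.obj (op S')) :
    simplexMap h (X.map f.op x) = (truncatedOriental.{u} n).map f ≫ simplexMap h x :=
  congrArg ULift.down (ConcreteCategory.congr_hom (h.naturality f.op) x)

theorem hom_ext {h h' : X ⟶ (streetNerve.{u} n).obj C}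
    (H : ∀ (S : SimplexCategory) (x : X.obj (op S)), simplexMap h x = simplexMap h' x) :
    h = h' := by
  ext S x
  exact ULift.down_injective (H S.unop x)

/-- Construction of a map to the nerve. -/
def homMk (φ : ∀ S : SimplexCategory, X.obj (op S) → ((truncatedOriental.{u} n).obj S ⟶ C))
    (hφ : ∀ (S S' : SimplexCategory) (f : S ⟶ S') (x : X.obj (op S')),
      φ S (X.map f.op x) = (truncatedOriental.{u} n).map f ≫ φ S' x) :
    X ⟶ (streetNerve.{u} n).obj C where
  app S := ↾fun x => ULift.up (φ S.unop x)
  naturality S S' f := by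
    ext x
    exact ULift.down_injective (hφ _ _ f.unop x)

theorem simplexMap_homMk (φ) (hφ) (x : X.obj (op S)) :
    simplexMap (homMk (X := X) (C := C) φ hφ) x = φ S x := rfl

/-! ### The left adjoint -/

variable (n) in
/-- The generating cells of the `n`-category associated with a simplicial set. -/
abbrev Generator (X : SSet.{u}) : Type u :=
  Σ S : SimplexCategory, X.obj (op S) × ((truncatedOriental.{u} n).obj S).obj.Cell

variable (n) in
/-- The maps on generating cells that come from maps to the nerve. -/
def IsModel (X : SSet.{u}) (C : NCat.{u} n) (v : Generator n X → C.obj.Cell) : Prop :=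
  ∃ h : X ⟶ (streetNerve.{u} n).obj C, ∀ g, v g = app (simplexMap h g.2.1) g.2.2

/-- A functor does not raise dimension, so the dimension of the cell of the oriental serves for all
models. -/
theorem exists_isCell_generator (g : Generator n X) :
    ∃ d : ℕ, ∀ C v, IsModel n X C v → C.obj.IsCell d (v g) := by
  obtain ⟨d, hd⟩ := OmegaCat.exists_dim _ g.2.2
  refine ⟨d, ?_⟩
  rintro C v ⟨h, hv⟩ k hk
  rw [hv, ← app_bd]
  congr 1
  rw [← hd, OmegaCat.bd_bd_of_le _ _ _ _ _ _ (by exact_mod_cast hk)]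

variable (n X) in
/-- The `n`-category associated with a simplicial set. -/
noncomputable def realization : NCat.{u} n :=
  Term.Presented.ncat (exists_isCell_generator (n := n) (X := X))

variable (n X) in
/-- The universal map to the nerve. -/
noncomputable def unit : X ⟶ (streetNerve.{u} n).obj (realization n X) :=
  homMk (fun S x => NCat.homMk
    (fun c => (Term.Presented.gen ⟨S, x, c⟩ : Term.Presented (IsModel n X)))
    (fun a k c => Term.Presented.ext fun C v hv => by
      refine Eq.trans ?_ (Term.Presented.ev_bd hv a k _).symm
      obtain ⟨h, hv⟩ := hv
      change v _ = C.obj.bd a k (v _)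
      rw [hv, hv, app_bd])
    (fun k c d hcd hcd' => Term.Presented.ext fun C v hv => by
      refine Eq.trans ?_ (Term.Presented.ev_comp hv k _ _ hcd').symm
      obtain ⟨h, hv'⟩ := hv
      change v _ = C.obj.comp k (v _) (v _) _
      rw [hv', app_comp]
      exact OmegaCat.comp_congr _ (hv' ⟨S, x, c⟩).symm (hv' ⟨S, x, d⟩).symm _ _))
    (fun S S' f x => by
      ext c
      refine Term.Presented.ext fun C v hv => ?_
      obtain ⟨h, hv⟩ := hv
      change v _ = v _
      rw [hv, hv]
      dsimp only
      rw [simplexMap_map]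
      rfl)

variable (n) in
-- A map from `X` to the nerve of `C` is itself a model, so it factors through `unit`; the
-- factorization is unique because its values on the generators are prescribed.
theorem isRightAdjoint : (streetNerve.{u} n).IsRightAdjoint := by
  have (X : SSet.{u}) : HasInitial (StructuredArrow X (streetNerve.{u} n)) := by
    let desc (A : StructuredArrow X (streetNerve.{u} n)) : realization n X ⟶ A.right :=
      Term.Presented.desc _ (v := fun g => app (simplexMap A.hom g.2.1) g.2.2)
        ⟨A.hom, fun _ => rfl⟩
    refine IsInitial.hasInitial (X := StructuredArrow.mk (unit n X))
      (IsInitial.ofUniqueHom (fun A => StructuredArrow.homMk (desc A) ?_) fun A m => ?_)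
    · exact hom_ext fun S x => rfl
    · ext1
      refine Term.Presented.hom_ext exists_isCell_generator fun g => ?_
      have := congrArg (fun k => app (simplexMap k g.2.1) g.2.2) (StructuredArrow.w m)
      exact this
  exact isRightAdjointOfStructuredArrowInitials _

end StreetNerve

/-! ### Filtered colimits of `n`-categories -/

theorem CategoryTheory.IsFiltered.exists_stage {J : Type*} [Category* J] [IsFiltered J]
    {ι : Type*} [Finite ι] {j : J} (P : ι → ∀ j', (j ⟶ j') → Prop)
    (hP : ∀ i j' (f : j ⟶ j') j'' (g : j' ⟶ j''), P i j' f → P i j'' (f ≫ g))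
    (h : ∀ i, ∃ j' f, P i j' f) : ∃ j' f, ∀ i, P i j' f := by
  classical
  have := Fintype.ofFinite ι
  suffices H : ∀ s : Finset ι, ∃ j' f, ∀ i ∈ s, P i j' f by
    obtain ⟨j', f, hf⟩ := H Finset.univ
    exact ⟨j', f, fun i => hf i (Finset.mem_univ i)⟩
  intro s
  induction s using Finset.induction_on with
  | empty => exact ⟨j, 𝟙 j, by simp⟩
  | insert i s _ ih =>
    obtain ⟨j₁, f₁, h₁⟩ := ih
    obtain ⟨j₂, f₂, h₂⟩ := h i
    obtain ⟨l, g₁, g₂, e⟩ := IsFiltered.span f₁ f₂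
    refine ⟨l, f₁ ≫ g₁, fun i' hi' => ?_⟩
    rcases Finset.mem_insert.1 hi' with rfl | hi'
    · rw [e]; exact hP _ _ _ _ _ h₂
    · exact hP _ _ _ _ _ (h₁ i' hi')

theorem OmegaCat.comp_eq_left (C : OmegaCat.{u}) {k : ℕ} {x y : C.Cell}
    (h : C.bd false k x = C.bd true k y) (hx : C.bd false k x = x) (hy : C.bd true k y = y) :
    C.comp k x y h = x := by
  have e : y = C.bd false k x := hy.symm.trans h.symm
  rw [C.comp_congr rfl e h (by rw [C.bd_bd_of_le _ _ _ _ _ le_rfl]), C.comp_unit]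

theorem OmegaCat.bd_comp_of_lt (C : OmegaCat.{u}) {j k : ℕ} (hjk : j < k) {x y : C.Cell}
    (h : C.bd false k x = C.bd true k y) (a : Bool) :
    C.bd a j (C.comp k x y h) = C.bd a j y := by
  rw [← C.bd_bd_of_lt a false j k _ hjk, C.src_comp, C.bd_bd_of_lt _ _ _ _ _ hjk]

namespace NCat

variable {n : ℕ∞} {J : Type u} [Category.{u} J] (F : J ⥤ NCat.{u} n)

/-- The diagram of the sets of cells. -/
def cells : J ⥤ Type u where
  obj j := (F.obj j).obj.Cell
  map f := ↾(app (F.map f))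
  map_id j := by ext x; simp
  map_comp f g := by ext x; simp

/-- The cells of the filtered colimit. -/
abbrev ColimCell : Type u := colimit (cells F)

namespace ColimCell

variable {F}

/-- The cell of the colimit represented by a cell of a stage. -/
noncomputable def mk (j : J) (x : (F.obj j).obj.Cell) : ColimCell F := colimit.ι (cells F) j x

theorem mk_map {i j : J} (f : i ⟶ j) (x : (F.obj i).obj.Cell) :
    (mk j (app (F.map f) x) : ColimCell F) = mk i x :=
  ConcreteCategory.congr_hom (colimit.w (cells F) f) x

theorem exists_mk (p : ColimCell F) : ∃ j x, mk j x = p :=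
  Types.jointly_surjective_of_isColimit (colimit.isColimit (cells F)) p

/-- The induced map on cells. -/
noncomputable def desc (s : Cocone F) : ColimCell F → s.pt.obj.Cell :=
  colimit.desc (cells F)
    { pt := s.pt.obj.Cell
      ι :=
        { app := fun j => ↾(app (s.ι.app j))
          naturality := fun i j f => by
            ext x
            exact congrArg (fun g => app g x) (s.w f) } }

theorem desc_mk (s : Cocone F) (j : J) (x : (F.obj j).obj.Cell) :
    desc s (mk j x) = app (s.ι.app j) x :=
  ConcreteCategory.congr_hom (colimit.ι_desc (F := cells F) _ j) x

variable [IsFiltered J]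

theorem mk_eq_iff {i j : J} {x : (F.obj i).obj.Cell} {y : (F.obj j).obj.Cell} :
    (mk i x : ColimCell F) = mk j y ↔
      ∃ (k : J) (f : i ⟶ k) (g : j ⟶ k), app (F.map f) x = app (F.map g) y :=
  Types.FilteredColimit.isColimit_eq_iff _ (colimit.isColimit (cells F))

theorem mk_eq_iff' {j : J} {x y : (F.obj j).obj.Cell} :
    (mk j x : ColimCell F) = mk j y ↔
      ∃ (k : J) (f : j ⟶ k), app (F.map f) x = app (F.map f) y :=
  Types.FilteredColimit.isColimit_eq_iff' (colimit.isColimit (cells F)) x y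

theorem exists_bd (a : Bool) (k : ℕ) (p : ColimCell F) : ∃ q : ColimCell F,
    ∀ j x, mk j x = p → q = mk j ((F.obj j).obj.bd a k x) := by
  obtain ⟨i, y, rfl⟩ := exists_mk p
  refine ⟨mk i ((F.obj i).obj.bd a k y), fun j x h => ?_⟩
  obtain ⟨l, f, g, e⟩ := mk_eq_iff.1 h
  exact mk_eq_iff.2 ⟨l, g, f, by rw [app_bd, app_bd, e]⟩

/-- The boundaries in the colimit. -/
noncomputable def bd (a : Bool) (k : ℕ) (p : ColimCell F) : ColimCell F := (exists_bd a k p).choose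

theorem bd_mk (a : Bool) (k : ℕ) (j : J) (x : (F.obj j).obj.Cell) :
    (bd a k (mk j x) : ColimCell F) = mk j ((F.obj j).obj.bd a k x) :=
  (exists_bd a k (mk j x)).choose_spec j x rfl

theorem bd_mk_of_composable {j : J} {k : ℕ} {x y : (F.obj j).obj.Cell}
    (h : (F.obj j).obj.bd false k x = (F.obj j).obj.bd true k y) :
    (bd false k (mk j x) : ColimCell F) = bd true k (mk j y) := by
  rw [bd_mk, bd_mk, h]

theorem exists_stage_composable {j : J} {k : ℕ} {x y : (F.obj j).obj.Cell}
    (h : (bd false k (mk j x) : ColimCell F) = bd true k (mk j y)) :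
    ∃ (j' : J) (f : j ⟶ j'), (F.obj j').obj.bd false k (app (F.map f) x) =
      (F.obj j').obj.bd true k (app (F.map f) y) := by
  rw [bd_mk, bd_mk, mk_eq_iff'] at h
  simpa only [app_bd] using h

variable (F) in
-- Finitely many cells live at a common stage, and each required composability becomes true at a
-- later one. The triples `(k, i, i')` encode the requirements, so that one statement covers the
-- hypotheses of all the axioms.
theorem exists_rep {ι κ : Type*} [Finite ι] (p : ι → ColimCell F) [Finite κ]
    (d : κ → ℕ × ι × ι) (h : ∀ s, bd false (d s).1 (p (d s).2.1) = bd true (d s).1 (p (d s).2.2)) :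
    ∃ (j : J) (x : ι → (F.obj j).obj.Cell), (∀ i, mk j (x i) = p i) ∧
      ∀ s, (F.obj j).obj.bd false (d s).1 (x (d s).2.1) =
        (F.obj j).obj.bd true (d s).1 (x (d s).2.2) := by
  classical
  have := Fintype.ofFinite ι
  choose j x hx using fun i => exists_mk (p i)
  obtain ⟨l, hl⟩ := IsFiltered.sup_objs_exists (Finset.univ.image j)
  have f : ∀ i, j i ⟶ l := fun i => (hl (Finset.mem_image_of_mem j (Finset.mem_univ i))).some
  let y : ι → (F.obj l).obj.Cell := fun i => app (F.map (f i)) (x i)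
  have hy : ∀ i, mk l (y i) = p i := fun i => (mk_map _ _).trans (hx i)
  obtain ⟨l', g, hg⟩ := IsFiltered.exists_stage (j := l)
    (P := fun s l' g => (F.obj l').obj.bd false (d s).1 (app (F.map g) (y (d s).2.1)) =
      (F.obj l').obj.bd true (d s).1 (app (F.map g) (y (d s).2.2)))
    (fun s l₁ g l₂ g' h => by simpa using app_composable (F.map g') h)
    (fun s => exists_stage_composable (by rw [hy, hy]; exact h s))
  exact ⟨l', fun i => app (F.map g) (y i), fun i => (mk_map _ _).trans (hy i), hg⟩

theorem exists_rep₂ {k : ℕ} {p q : ColimCell F} (h : bd false k p = bd true k q) :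
    ∃ (j : J) (x y : (F.obj j).obj.Cell), mk j x = p ∧ mk j y = q ∧
      (F.obj j).obj.bd false k x = (F.obj j).obj.bd true k y := by
  obtain ⟨j, x, hx, hd⟩ := exists_rep F (ι := Fin 2) ![p, q] (κ := Fin 1) ![(k, 0, 1)]
    (by simpa [Fin.forall_fin_succ] using h)
  simp only [Fin.forall_fin_succ] at hx hd
  exact ⟨j, x 0, x 1, hx.1, hx.2.1, hd.1⟩

theorem exists_rep₃ {k : ℕ} {p q r : ColimCell F} (h : bd false k p = bd true k q)
    (h' : bd false k q = bd true k r) :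
    ∃ (j : J) (x y z : (F.obj j).obj.Cell), mk j x = p ∧ mk j y = q ∧ mk j z = r ∧
      (F.obj j).obj.bd false k x = (F.obj j).obj.bd true k y ∧
      (F.obj j).obj.bd false k y = (F.obj j).obj.bd true k z := by
  obtain ⟨j, x, hx, hd⟩ := exists_rep F (ι := Fin 3) ![p, q, r] (κ := Fin 2)
    ![(k, 0, 1), (k, 1, 2)] (by simpa [Fin.forall_fin_succ] using ⟨h, h'⟩)
  simp only [Fin.forall_fin_succ] at hx hd
  exact ⟨j, x 0, x 1, x 2, hx.1, hx.2.1, hx.2.2.1, hd.1, hd.2.1⟩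

theorem exists_rep₄ {j k : ℕ} {p q r s : ColimCell F} (hpq : bd false k p = bd true k q)
    (hrs : bd false k r = bd true k s) (hpr : bd false j p = bd true j r)
    (hqs : bd false j q = bd true j s) :
    ∃ (i : J) (x y z w : (F.obj i).obj.Cell), mk i x = p ∧ mk i y = q ∧ mk i z = r ∧ mk i w = s ∧
      (F.obj i).obj.bd false k x = (F.obj i).obj.bd true k y ∧
      (F.obj i).obj.bd false k z = (F.obj i).obj.bd true k w ∧
      (F.obj i).obj.bd false j x = (F.obj i).obj.bd true j z ∧
      (F.obj i).obj.bd false j y = (F.obj i).obj.bd true j w := by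
  obtain ⟨i, x, hx, hd⟩ := exists_rep F (ι := Fin 4) ![p, q, r, s] (κ := Fin 4)
    ![(k, 0, 1), (k, 2, 3), (j, 0, 2), (j, 1, 3)]
    (by simpa [Fin.forall_fin_succ] using ⟨hpq, hrs, hpr, hqs⟩)
  simp only [Fin.forall_fin_succ] at hx hd
  exact ⟨i, x 0, x 1, x 2, x 3, hx.1, hx.2.1, hx.2.2.1, hx.2.2.2.1, hd.1, hd.2.1, hd.2.2.1,
    hd.2.2.2.1⟩

theorem exists_comp (k : ℕ) (p q : ColimCell F) (h : bd false k p = bd true k q) :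
    ∃ r : ColimCell F, ∀ (j : J) (x y : (F.obj j).obj.Cell)
      (h : (F.obj j).obj.bd false k x = (F.obj j).obj.bd true k y),
      mk j x = p → mk j y = q → r = mk j ((F.obj j).obj.comp k x y h) := by
  obtain ⟨i, x, y, rfl, rfl, hi⟩ := exists_rep₂ h
  refine ⟨mk i ((F.obj i).obj.comp k x y hi), fun j x' y' hj ex ey => ?_⟩
  obtain ⟨l₁, f₁, g₁, e₁⟩ := mk_eq_iff.1 ex
  obtain ⟨l₂, f₂, g₂, e₂⟩ := mk_eq_iff.1 ey
  -- The identifications of the two factors occur at different stages; a common later stage must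
  -- also equalize the two resulting maps from each of `i` and `j`.
  obtain ⟨l, a, b, hab, hab'⟩ := IsFiltered.bowtie f₁ f₂ g₁ g₂
  refine mk_eq_iff.2 ⟨l, g₁ ≫ a, f₁ ≫ a, ?_⟩
  rw [app_comp, app_comp]
  refine OmegaCat.comp_congr _ ?_ ?_ _ _
  · simp [e₁]
  · rw [hab, hab']; simp [e₂]

/-- The composites in the colimit. -/
noncomputable def comp (k : ℕ) (p q : ColimCell F) (h : bd false k p = bd true k q) :
    ColimCell F := (exists_comp k p q h).choose

theorem comp_mk {j : J} (k : ℕ) {x y : (F.obj j).obj.Cell}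
    (h : (F.obj j).obj.bd false k x = (F.obj j).obj.bd true k y)
    (h' : (bd false k (mk j x) : ColimCell F) = bd true k (mk j y)) :
    comp k (mk j x) (mk j y) h' = mk j ((F.obj j).obj.comp k x y h) :=
  (exists_comp k _ _ h').choose_spec j x y h rfl rfl

end ColimCell

open ColimCell

variable [IsFiltered J]

/-- The filtered colimit of `n`-categories. -/
noncomputable def filteredColimit : NCat.{u} n where
  obj :=
    { Cell := ColimCell F
      bd := ColimCell.bd
      comp := ColimCell.comp
      bd_bd_of_lt := fun a b j k p h => by
        obtain ⟨i, x, rfl⟩ := exists_mk p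
        simp only [bd_mk, OmegaCat.bd_bd_of_lt _ _ _ _ _ _ h]
      bd_bd_of_le := fun a b j k p h => by
        obtain ⟨i, x, rfl⟩ := exists_mk p
        simp only [bd_mk, OmegaCat.bd_bd_of_le _ _ _ _ _ _ h]
      exists_dim := fun p => by
        obtain ⟨i, x, rfl⟩ := exists_mk p
        obtain ⟨k, hk⟩ := OmegaCat.exists_dim _ x
        exact ⟨k, by rw [bd_mk, hk]⟩
      src_comp := fun k p q h => by
        obtain ⟨i, x, y, rfl, rfl, hxy⟩ := exists_rep₂ h
        rw [comp_mk k hxy, bd_mk, bd_mk, OmegaCat.src_comp]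
      tgt_comp := fun k p q h => by
        obtain ⟨i, x, y, rfl, rfl, hxy⟩ := exists_rep₂ h
        rw [comp_mk k hxy, bd_mk, bd_mk, OmegaCat.tgt_comp]
      bd_comp := fun a j k p q h h' hjk => by
        obtain ⟨i, x, y, rfl, rfl, hxy⟩ := exists_rep₂ h
        have hxy' := OmegaCat.bd_bd_congr _ hxy a hjk
        simp only [bd_mk] at h' ⊢
        rw [comp_mk j hxy, bd_mk, comp_mk j hxy', OmegaCat.bd_comp _ _ _ _ _ _ _ hxy' hjk]
      comp_unit := fun k p h => by
        obtain ⟨i, x, rfl⟩ := exists_mk p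
        have hx : (F.obj i).obj.bd false k x = (F.obj i).obj.bd true k
          ((F.obj i).obj.bd false k x) := (OmegaCat.bd_bd_of_le _ _ _ _ _ _ le_rfl).symm
        simp only [bd_mk] at h ⊢
        rw [comp_mk k hx, OmegaCat.comp_unit]
      unit_comp := fun k p h => by
        obtain ⟨i, x, rfl⟩ := exists_mk p
        have hx : (F.obj i).obj.bd false k ((F.obj i).obj.bd true k x) =
          (F.obj i).obj.bd true k x := OmegaCat.bd_bd_of_le _ _ _ _ _ _ le_rfl
        simp only [bd_mk] at h ⊢
        rw [comp_mk k hx, OmegaCat.unit_comp]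
      assoc := fun k p q r hpq hqr h h' => by
        obtain ⟨i, x, y, z, rfl, rfl, rfl, hxy, hyz⟩ := exists_rep₃ hpq hqr
        have h₁ : (F.obj i).obj.bd false k ((F.obj i).obj.comp k _ _ hxy) =
          (F.obj i).obj.bd true k _ := ((F.obj i).obj.src_comp _ _ _ _).trans hyz
        have h₂ : (F.obj i).obj.bd false k _ = (F.obj i).obj.bd true k
          ((F.obj i).obj.comp k _ _ hyz) := hxy.trans ((F.obj i).obj.tgt_comp _ _ _ _).symm
        simp only [comp_mk k hxy, comp_mk k hyz] at h h' ⊢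
        rw [comp_mk k h₁, comp_mk k h₂]
        exact congrArg _ ((F.obj i).obj.assoc _ _ _ _ _ _ _ _)
      interchange := fun j k p q r s hjk hpq hrs hpr hqs h h' => by
        obtain ⟨i, x, y, z, w, rfl, rfl, rfl, rfl, hxy, hzw, hxz, hyw⟩ :=
          exists_rep₄ hpq hrs hpr hqs
        have h₁ : (F.obj i).obj.bd false j ((F.obj i).obj.comp k _ _ hxy) =
            (F.obj i).obj.bd true j ((F.obj i).obj.comp k _ _ hzw) := by
          rw [OmegaCat.bd_comp_of_lt _ hjk, OmegaCat.bd_comp_of_lt _ hjk, hyw]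
        have h₂ : (F.obj i).obj.bd false k ((F.obj i).obj.comp j _ _ hxz) =
            (F.obj i).obj.bd true k ((F.obj i).obj.comp j _ _ hyw) := by
          rw [OmegaCat.bd_comp _ _ _ _ _ _ _ (OmegaCat.bd_bd_congr _ hxz _ hjk) hjk,
            OmegaCat.bd_comp _ _ _ _ _ _ _ (OmegaCat.bd_bd_congr _ hyw _ hjk) hjk]
          exact OmegaCat.comp_congr _ hxy hzw _ _
        simp only [comp_mk k hxy, comp_mk k hzw, comp_mk j hxz, comp_mk j hyw] at h h' ⊢
        rw [comp_mk j h₁, comp_mk k h₂]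
        exact congrArg _ ((F.obj i).obj.interchange _ _ _ _ _ _ hjk _ _ _ _ _ _) }
  property p k hk := by
    obtain ⟨i, x, rfl⟩ := exists_mk p
    exact (bd_mk _ _ _ _).trans (congrArg _ ((F.obj i).property x k hk))

/-- The cocone of the filtered colimit. -/
noncomputable def filteredColimitι (j : J) : F.obj j ⟶ filteredColimit F :=
  homMk (ColimCell.mk j) (fun a k x => (bd_mk a k j x).symm)
    (fun k x y h h' => (comp_mk k h h').symm)

/-- The cocone of the filtered colimit. -/
noncomputable def filteredCocone : Cocone F where
  pt := filteredColimit F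
  ι :=
    { app := filteredColimitι F
      naturality := fun i j f => by
        ext x
        exact mk_map f x }

/-- The filtered colimit of `n`-categories is a colimit. -/
noncomputable def filteredCoconeIsColimit : IsColimit (filteredCocone F) where
  desc s := homMk (A := filteredColimit F) (ColimCell.desc s)
    (fun a k p => by
      obtain ⟨j, x, rfl⟩ := exists_mk p
      refine (congrArg _ (bd_mk a k j x)).trans ?_
      rw [ColimCell.desc_mk, ColimCell.desc_mk, app_bd]
      rfl)
    (fun k p q h h' => by
      obtain ⟨j, x, y, rfl, rfl, hxy⟩ := exists_rep₂ h
      refine (congrArg _ (comp_mk k hxy h)).trans ?_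
      rw [ColimCell.desc_mk, app_comp]
      exact OmegaCat.comp_congr _ (ColimCell.desc_mk s j x).symm
        (ColimCell.desc_mk s j y).symm _ _)
  fac s j := by
    ext x
    exact ColimCell.desc_mk s j x
  uniq s m hm := by
    ext p
    obtain ⟨j, x, rfl⟩ := exists_mk (F := F) p
    exact (congrArg (fun g => app g x) (hm j)).trans (ColimCell.desc_mk s j x).symm

/-! ### `n`-categories with finitely many cells are finitely presentable -/

variable {F}

/-- Finitely many cells have bounded dimension `M`, beyond which boundaries and composites are
trivial. So being a functor amounts to finitely many equations, each of which holds at some stage.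
-/
theorem exists_factorization_of_finite {K : NCat.{u} n} [Finite K.obj.Cell]
    (g : K ⟶ filteredColimit F) : ∃ (j : J) (f : K ⟶ F.obj j), f ≫ filteredColimitι F j = g := by
  classical
  have := Fintype.ofFinite K.obj.Cell
  obtain ⟨M, hM⟩ : ∃ M : ℕ, ∀ c, K.obj.bd false M c = c := by
    choose d hd using K.obj.exists_dim
    refine ⟨Finset.univ.sup d, fun c => ?_⟩
    rw [← hd c, K.obj.bd_bd_of_le _ _ _ _ _ (Finset.le_sup (Finset.mem_univ c))]
  have hM' : ∀ a k, M ≤ k → ∀ c, K.obj.bd a k c = c := fun a k hk c => by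
    rw [← hM c, K.obj.bd_bd_of_le _ _ _ _ _ hk]
  obtain ⟨j, x, hx, -⟩ := exists_rep F (fun c => (app g c : ColimCell F)) (κ := Empty)
    (fun s => s.elim) (fun s => s.elim)
  -- Degree `M` is included: this equation makes the lifted cells of dimension at most `M`, and the
  -- boundaries in higher degree then follow.
  obtain ⟨j₁, u₁, h₁⟩ := IsFiltered.exists_stage (j := j)
    (ι := Bool × Fin (M + 1) × K.obj.Cell)
    (P := fun s j' u => app (F.map u) (x (K.obj.bd s.1 s.2.1 s.2.2)) =
      (F.obj j').obj.bd s.1 s.2.1 (app (F.map u) (x s.2.2)))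
    (fun s j₁ u₁ j₂ u₂ h => by simp [h, app_bd])
    (fun s => by
      simp only [← app_bd]
      rw [← mk_eq_iff', hx, ← bd_mk, hx]
      exact app_bd g _ _ _)
  let y (c : K.obj.Cell) : (F.obj j₁).obj.Cell := app (F.map u₁) (x c)
  have hy : ∀ c, (mk j₁ (y c) : ColimCell F) = app g c := fun c => (mk_map _ _).trans (hx c)
  have hybd : ∀ a k c, y (K.obj.bd a k c) = (F.obj j₁).obj.bd a k (y c) := by
    intro a k c
    rcases lt_or_ge k (M + 1) with hk | hk
    · exact h₁ (a, ⟨k, hk⟩, c)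
    · have hM₁ : y c = (F.obj j₁).obj.bd a M (y c) := by
        have := h₁ (a, ⟨M, M.lt_succ_self⟩, c)
        rwa [hM' a M le_rfl] at this
      rw [hM' a k (by omega)]
      conv_rhs => rw [hM₁, OmegaCat.bd_bd_of_le _ _ _ _ _ _ (by omega : M ≤ k)]
      exact hM₁
  have hyc : ∀ {k c d}, K.obj.bd false k c = K.obj.bd true k d →
      (F.obj j₁).obj.bd false k (y c) = (F.obj j₁).obj.bd true k (y d) := fun h => by
    rw [← hybd, ← hybd, h]
  -- Boundaries are already respected at `j₁`, so the composites of lifted cells exist there and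
  -- only their values need a later stage. Degrees `k < M` suffice.
  obtain ⟨j₂, u₂, h₂⟩ := IsFiltered.exists_stage (j := j₁)
    (ι := {s : Fin M × K.obj.Cell × K.obj.Cell //
      K.obj.bd false s.1 s.2.1 = K.obj.bd true s.1 s.2.2})
    (P := fun s j' u => app (F.map u) (y (K.obj.comp s.1.1 s.1.2.1 s.1.2.2 s.2)) =
      app (F.map u) ((F.obj j₁).obj.comp s.1.1 (y s.1.2.1) (y s.1.2.2) (hyc s.2)))
    (fun s j₁ u₁ j₂ u₂ h => by simp [h])
    (fun s => by
      have hc : (bd false s.1.1 (mk j₁ (y s.1.2.1)) : ColimCell F) =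
        bd true s.1.1 (mk j₁ (y s.1.2.2)) := bd_mk_of_composable (hyc s.2)
      rw [← mk_eq_iff', hy, ← comp_mk _ (hyc s.2) hc]
      exact (app_comp g _ _ _ _).trans (OmegaCat.comp_congr _ (hy _).symm (hy _).symm _ hc))
  refine ⟨j₂, homMk (fun c => app (F.map u₂) (y c)) (fun a k c => by rw [hybd, app_bd])
    (fun k c d h h' => ?_), ?_⟩
  · rcases lt_or_ge k M with hk | hk
    · rw [h₂ ⟨(⟨k, hk⟩, c, d), h⟩, app_comp]
    · rw [K.obj.comp_eq_left h (hM' _ _ hk _) (hM' _ _ hk _), OmegaCat.comp_eq_left]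
      · rw [← app_bd, ← hybd, hM' _ _ hk]
      · rw [← app_bd, ← hybd, hM' _ _ hk]
  · ext c
    exact (mk_map _ _).trans (hy c)

theorem exists_eq_of_finite {K : NCat.{u} n} [Finite K.obj.Cell] {j : J} (f g : K ⟶ F.obj j)
    (h : f ≫ filteredColimitι F j = g ≫ filteredColimitι F j) :
    ∃ (j' : J) (u : j ⟶ j'), f ≫ F.map u = g ≫ F.map u := by
  obtain ⟨j', u, hu⟩ := IsFiltered.exists_stage (j := j)
    (P := fun c j' u => app (F.map u) (app f c) = app (F.map u) (app g c))
    (fun c j₁ u₁ j₂ u₂ h => by simp [h])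
    (fun c => mk_eq_iff'.1 (congrArg (fun k => app k c) h))
  exact ⟨j', u, by ext c; exact hu c⟩

end NCat

/-- Colimits of simplicial sets are computed degreewise, so the claim is that each truncated
oriental is finitely presentable. -/
theorem StreetNerve.preservesFilteredColimits (n : ℕ∞) :
    PreservesFilteredColimitsOfSize.{u, u} (streetNerve.{u} n) where
  preserves_filtered_colimits J _ _ := by
    refine preservesColimitsOfShape_of_evaluation _ _ fun S => ⟨fun {F} => ?_⟩
    refine preservesColimit_of_preserves_colimit_cocone (NCat.filteredCoconeIsColimit F) ?_
    refine Types.FilteredColimit.isColimitOf' _ _ (fun f => ?_) (fun j f g h => ?_)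
    · obtain ⟨j, g, hg⟩ := NCat.exists_factorization_of_finite
        (K := (truncatedOriental.{u} n).obj S.unop) (ULift.down f)
      exact ⟨j, ULift.up g, ULift.down_injective hg.symm⟩
    · obtain ⟨j', u, hu⟩ := NCat.exists_eq_of_finite
        (K := (truncatedOriental.{u} n).obj S.unop) (ULift.down f) (ULift.down g)
        (congrArg ULift.down h)
      exact ⟨j', u, ULift.down_injective hu⟩

/-! ### Pushouts of cosieves. -/

namespace NCat

variable {n : ℕ∞}

theorem exists_lift_of_injective {A B C : NCat.{u} n} {a : A ⟶ C}
    (ha : Function.Injective (app a)) (f : B ⟶ C) (hf : ∀ x, ∃ y, app a y = app f x) :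
    ∃ g : B ⟶ A, g ≫ a = f := by
  choose g hg using hf
  refine ⟨homMk g (fun k b x => ha ?_) (fun k x y h h' => ha ?_), hom_ext hg⟩
  · rw [hg, app_bd, app_bd, hg]
  · rw [hg, app_comp, app_comp]
    exact OmegaCat.comp_congr _ (hg x).symm (hg y).symm _ _

theorem mono_of_injective {A B C : NCat.{u} n} {a : A ⟶ C}
    (ha : Function.Injective (app a)) {f g : B ⟶ A} (h : f ≫ a = g ≫ a) : f = g :=
  hom_ext fun x => ha (congrArg (fun k => app k x) h)

variable {hn : 1 ≤ n}

/-- The constant functor with value `1`. -/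
noncomputable def constOne (hn : 1 ≤ n) (A : NCat.{u} n) : A ⟶ (ofPoset n hn).obj two.{u} :=
  toPoset hn _ (fun _ => ⟨1⟩) fun _ => le_rfl

section Pushout

variable {A A' B B' : NCat.{u} n} {a : A ⟶ A'} {i : A ⟶ B} {i' : A' ⟶ B'} {b : B ⟶ B'}

/-- The characteristic functor of `A` in `A'` and the constant `1` on `B` glue to a functor on `B'`.
Its value at the common image of `x` and `y` is `1`, so `x` comes from `A`. -/
theorem exists_of_isPushout (h : IsPushout a i i' b) (hi : Function.Injective (app i))
    (hb : Function.Injective (app b)) {χ : A' ⟶ (ofPoset n hn).obj two.{u}}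
    (ha : ∀ x, (∃ y, app a y = x) ↔ Over χ 1 x) {x : A'.obj.Cell} {y : B.obj.Cell}
    (hxy : app i' x = app b y) : ∃ w, app a w = x ∧ app i w = y := by
  have hw : a ≫ χ = i ≫ constOne hn B := hom_ext fun w => Subtype.ext ((ha _).1 ⟨w, rfl⟩)
  have hx : Over χ 1 x := by
    rw [Over, ← h.inl_desc χ _ hw, comp_app, hxy, ← comp_app, h.inr_desc]
    rfl
  obtain ⟨w, rfl⟩ := (ha x).2 hx
  refine ⟨w, rfl, hb ?_⟩
  rw [← hxy, ← comp_app, ← comp_app, h.w]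

/-- The maximum of the two characteristic functors is again a functor to `{0 < 1}`. It is constantly
`1` on `A'` and on `B`, hence on the pushout. -/
theorem objVal_eq_one_or_of_isPushout (h : IsPushout a i i' b)
    {χ χ' : B' ⟶ (ofPoset n hn).obj two.{u}} (hχ : ∀ x, Over χ 1 (app i' x))
    (hχ' : ∀ y, Over χ' 1 (app b y)) (c : Bool) (z : B'.obj.Cell) :
    (objVal χ (B'.obj.bd c 0 z)).down = 1 ∨ (objVal χ' (B'.obj.bd c 0 z)).down = 1 := by
  let m : B' ⟶ (ofPoset n hn).obj two.{u} :=
    toPoset hn _ (fun x => ⟨max (objVal χ x).down (objVal χ' x).down⟩) fun x =>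
      max_le_max (objVal_le χ x) (objVal_le χ' x)
  have hm : m = constOne hn B' := by
    apply h.hom_ext <;> refine toPoset_ext fun x a => ?_
    · have := (over_iff _ _ _).1 (hχ x)
      rw [objVal_comp, objVal_comp, objVal_toPoset, constOne, objVal_toPoset, app_bd,
        OmegaCat.bd_zero_bd_zero, this]
      exact congrArg ULift.up (max_eq_left (Fin.le_last _))
    · have := (over_iff _ _ _).1 (hχ' x)
      rw [objVal_comp, objVal_comp, objVal_toPoset, constOne, objVal_toPoset, app_bd,
        OmegaCat.bd_zero_bd_zero, this]
      exact congrArg ULift.up (max_eq_right (Fin.le_last _))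
  have := congrArg (fun k : B' ⟶ (ofPoset n hn).obj two.{u} =>
    ULift.down (objVal k (B'.obj.bd c 0 z))) hm
  simp only [m, constOne, objVal_toPoset, OmegaCat.bd_zero_bd_zero] at this
  generalize (objVal χ (B'.obj.bd c 0 z)).down = p at *
  generalize (objVal χ' (B'.obj.bd c 0 z)).down = q at *
  revert p q
  decide

end Pushout

/-- A cosieve containing the first vertex of an oriental contains the whole oriental. -/
theorem over_one_of_first {C : NCat.{u} n} {S : SimplexCategory}
    (g : (truncatedOriental.{u} n).obj S ⟶ C) (χ : C ⟶ (ofPoset n hn).obj two.{u})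
    {x₀ : ((truncatedOriental.{u} n).obj S).obj.Cell} (hx₀ : OrientalTrunc.vtx hn false x₀ = 0)
    (h : (objVal χ (C.obj.bd false 0 (app g x₀))).down = 1)
    (x : ((truncatedOriental.{u} n).obj S).obj.Cell) : Over χ 1 (app g x) := by
  rw [over_iff]
  intro c
  -- An arrow from the first vertex to the end `c` of `x`; along it the value of `χ` cannot drop.
  obtain ⟨y, hy₀, hy₁⟩ := OrientalTrunc.exists_vtx hn (OrientalTrunc.vtx hn c x)
  have e₀ := OrientalTrunc.bd_zero_eq_of_vtx hn (hx₀.trans hy₀.symm)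
  have e₁ := OrientalTrunc.bd_zero_eq_of_vtx hn hy₁.symm
  have hle := objVal_le χ (app g y)
  rw [← app_bd, ← app_bd, ← e₁, ← e₀, app_bd, app_bd] at hle
  have hle' : (objVal χ (C.obj.bd false 0 (app g x₀))).down ≤
    (objVal χ (C.obj.bd c 0 (app g x))).down := hle
  rw [h] at hle'
  exact le_antisymm (Fin.le_last _) hle'

end NCat

/-- In each degree this is a square of injections of sets: it is a pushout as soon as it is a
pullback and the two images cover. The first is tested cell by cell; for the second, the position of
the first vertex decides which cosieve contains the simplex. -/
theorem StreetNerve.isPushout_of_isCosieve {n : ℕ∞} {hn : 1 ≤ n} {A A' B B' : NCat.{u} n}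
    {a : A ⟶ A'} {i : A ⟶ B} {i' : A' ⟶ B'} {b : B ⟶ B'} (h : IsPushout a i i' b)
    (ha : NCat.IsCosieve hn a) (hi : NCat.IsCosieve hn i) (hi' : NCat.IsCosieve hn i')
    (hb : NCat.IsCosieve hn b) :
    IsPushout ((streetNerve.{u} n).map a) ((streetNerve.{u} n).map i)
      ((streetNerve.{u} n).map i') ((streetNerve.{u} n).map b) := by
  obtain ⟨χa, ha, ha'⟩ := (NCat.isInverseImage_endpoint_iff a 1).1 ha
  obtain ⟨-, hi, -⟩ := (NCat.isInverseImage_endpoint_iff i 1).1 hi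
  obtain ⟨χ, hi', hχ⟩ := (NCat.isInverseImage_endpoint_iff i' 1).1 hi'
  obtain ⟨χ', hb, hχ'⟩ := (NCat.isInverseImage_endpoint_iff b 1).1 hb
  refine IsPushout.of_forall_isPushout_app fun S => ?_
  have : Mono (((streetNerve.{u} n).map i').app S) := (mono_iff_injective _).2 fun f g e =>
    ULift.down_injective (NCat.mono_of_injective hi' (congrArg ULift.down e))
  refine Types.isPushout_of_isPullback_of_mono' ?_ ?_ fun f g _ _ e =>
    ULift.down_injective (NCat.mono_of_injective hb (congrArg ULift.down e))
  · refine (Types.isPullback_iff _ _ _ _).2 ⟨?_, ?_, ?_⟩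
    · rw [← NatTrans.comp_app, ← NatTrans.comp_app, ← Functor.map_comp, ← Functor.map_comp, h.w]
    · rintro f g ⟨e, -⟩
      exact ULift.down_injective (NCat.mono_of_injective ha (congrArg ULift.down e))
    · intro f g e
      have e : ULift.down f ≫ i' = ULift.down g ≫ b := congrArg ULift.down e
      have H := fun x => NCat.exists_of_isPushout h hi hb ha'
        (congrArg (fun k => NCat.app k x) e)
      obtain ⟨k, hk⟩ := NCat.exists_lift_of_injective ha (ULift.down f)
        fun x => (H x).imp fun _ h => h.1
      refine ⟨ULift.up k, ULift.down_injective hk,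
        ULift.down_injective (NCat.mono_of_injective hb ?_)⟩
      change (k ≫ i) ≫ b = _
      rw [← e, ← hk, Category.assoc, Category.assoc, h.w]
  · refine Set.eq_univ_of_forall fun f => ?_
    obtain ⟨x₀, hx₀, -⟩ := OrientalTrunc.exists_vtx.{u} (S := S.unop) hn 0
    rcases NCat.objVal_eq_one_or_of_isPushout h (fun x => (hχ _).1 ⟨x, rfl⟩)
      (fun x => (hχ' _).1 ⟨x, rfl⟩) false (NCat.app (ULift.down f) x₀) with h₀ | h₀
    · obtain ⟨k, hk⟩ := NCat.exists_lift_of_injective hi' (ULift.down f) fun x =>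
        (hχ _).2 (NCat.over_one_of_first _ χ hx₀ h₀ x)
      exact Or.inl ⟨ULift.up k, ULift.down_injective hk⟩
    · obtain ⟨k, hk⟩ := NCat.exists_lift_of_injective hb (ULift.down f) fun x =>
        (hχ' _).2 (NCat.over_one_of_first _ χ' hx₀ h₀ x)
      exact Or.inr ⟨ULift.up k, ULift.down_injective hk⟩

/-! ### The simplices of the nerve of a partially ordered set -/

namespace PartOrd

open Opposite

variable {E E' : PartOrd.{u}} {S S' : SimplexCategory}

/-- The simplex of the nerve given by a monotone map. -/
def simplex (s : Fin (S.len + 1) →o E) : (nerveFunctor.obj E).obj (op S) := s.monotone.functor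

theorem exists_simplex (x : (nerveFunctor.obj E).obj (op S)) :
    ∃ s : Fin (S.len + 1) →o E, simplex s = x :=
  let F : Fin (S.len + 1) ⥤ E := x
  ⟨⟨F.obj, fun _ _ h => F.monotone h⟩, rfl⟩

theorem simplex_injective : Function.Injective
    (simplex : (Fin (S.len + 1) →o E) → (nerveFunctor.obj E).obj (op S)) := fun s t h => by
  ext i
  exact congrArg (fun x => Functor.obj (C := Fin (S.len + 1)) (D := E) x i) h

theorem map_simplex (f : S ⟶ S') (s : Fin (S'.len + 1) →o E) :
    (nerveFunctor.obj E).map f.op (simplex s) = simplex (s.comp f.toOrderHom) := rfl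

end PartOrd

namespace StreetNerve

open PartOrd NCat Opposite

variable {n : ℕ∞} {c : SSet.{u} ⥤ NCat.{u} n} (adj : c ⊣ streetNerve.{u} n)
  {E E' : PartOrd.{u}} {S S' : SimplexCategory}

/-- The `n`-functor from an oriental given by a simplex of the nerve. -/
def cellMap (s : Fin (S.len + 1) →o E) :
    (truncatedOriental.{u} n).obj S ⟶ c.obj (nerveFunctor.obj E) :=
  simplexMap (adj.unit.app _) (simplex s)

theorem cellMap_comp (f : S ⟶ S') (s : Fin (S'.len + 1) →o E) :
    cellMap adj (s.comp f.toOrderHom) = (truncatedOriental.{u} n).map f ≫ cellMap adj s :=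
  simplexMap_map _ f (simplex s)

theorem cellMap_map (j : E' ⟶ E) (s : Fin (S.len + 1) →o E') :
    cellMap adj s ≫ c.map (nerveFunctor.map j) = cellMap adj (j.hom.comp s) := by
  have := congrArg (fun h => simplexMap h (simplex s)) (adj.unit.naturality (nerveFunctor.map j))
  exact this.symm

theorem cellMap_hom_ext {C : NCat.{u} n} {f g : c.obj (nerveFunctor.obj E) ⟶ C}
    (h : ∀ (S : SimplexCategory) (s : Fin (S.len + 1) →o E),
      cellMap adj s ≫ f = cellMap adj s ≫ g) : f = g := by
  apply (adj.homEquiv _ _).injective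
  refine hom_ext fun S x => ?_
  obtain ⟨s, rfl⟩ := exists_simplex x
  rw [adj.homEquiv_unit, adj.homEquiv_unit]
  exact h S s

/-- By adjunction, functors out of `c_n N E` may be constructed one simplex at a time. -/
theorem exists_desc {C : NCat.{u} n}
    (ψ : ∀ (S : SimplexCategory), (Fin (S.len + 1) →o E) → ((truncatedOriental.{u} n).obj S ⟶ C))
    (hψ : ∀ (S S' : SimplexCategory) (f : S ⟶ S') (s : Fin (S'.len + 1) →o E),
      ψ S (s.comp f.toOrderHom) = (truncatedOriental.{u} n).map f ≫ ψ S' s) :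
    ∃ d : c.obj (nerveFunctor.obj E) ⟶ C,
      ∀ (S : SimplexCategory) (s : Fin (S.len + 1) →o E), cellMap adj s ≫ d = ψ S s := by
  choose t ht using fun (S : SimplexCategory) (x : (nerveFunctor.obj E).obj (op S)) =>
    exists_simplex x
  have ht' : ∀ (S : SimplexCategory) (s : Fin (S.len + 1) →o E), t S (simplex s) = s :=
    fun S s => simplex_injective (ht _ _)
  let h : nerveFunctor.obj E ⟶ (streetNerve.{u} n).obj C :=
    homMk (fun S x => ψ S (t S x)) fun S S' f x => by
      obtain ⟨s, rfl⟩ := exists_simplex x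
      rw [map_simplex, ht', ht', hψ]
  refine ⟨(adj.homEquiv _ _).symm h, fun S s => ?_⟩
  have : (adj.homEquiv _ _) ((adj.homEquiv _ _).symm h) = h := Equiv.apply_symm_apply _ _
  rw [adj.homEquiv_unit] at this
  have := congrArg (fun h => simplexMap h (simplex s)) this
  refine Eq.trans this ?_
  rw [simplexMap_homMk, ht']

end StreetNerve

/-! ### Retraction of a simplex on its part over an endpoint -/

/-- The value in `{0 < 1}` of the source (`e = false`) and of the target (`e = true`). -/
def endValue (e : Bool) : Fin 2 := if e then 1 else 0

namespace OrientalTrunc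

variable {n : ℕ∞} {S : SimplexCategory}

/-- The end `!e` is the far one: for a sieve (`e = false`) the target, for a cosieve the source. By
monotonicity, if it lies in the fibre, so does the near end. -/
theorem vtx_eq_of_vtx_not (hn : 1 ≤ n) {e : Bool} (τ : Fin (S.len + 1) →o Fin 2)
    (x : ((truncatedOriental.{u} n).obj S).obj.Cell)
    (h : τ (vtx hn (!e) x) = endValue e) : τ (vtx hn e x) = endValue e := by
  have hle := τ.monotone (vtx_le hn x)
  cases e
  · exact le_antisymm (hle.trans_eq h) (Fin.zero_le _)
  · exact le_antisymm (Fin.le_last _) (h.symm.trans_le hle)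

theorem map_eq_self_of_vtx_not (hn : 1 ≤ n) {e : Bool} {τ : Fin (S.len + 1) →o Fin 2} {ρ : S ⟶ S}
    (hρ : ∀ i, τ i = endValue e → ρ.toOrderHom i = i)
    {x : ((truncatedOriental.{u} n).obj S).obj.Cell}
    (h : τ (vtx hn (!e) x) = endValue e) :
    NCat.app ((truncatedOriental.{u} n).map ρ) x = x := by
  cases e
  · exact map_eq_self_of_vtx_le hn (fun i hi => hρ i
      (le_antisymm ((τ.monotone hi).trans_eq h) (Fin.zero_le _))) le_rfl
  · exact map_eq_self_of_le_vtx hn (fun i hi => hρ i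
      (le_antisymm (Fin.le_last _) (h.symm.trans_le (τ.monotone hi)))) le_rfl

/-- The fibre is an initial or a final segment, onto which one retracts by `min` with its largest or
`max` with its smallest element. -/
theorem exists_retraction {e : Bool} (τ : Fin (S.len + 1) →o Fin 2)
    (h : ∃ i, τ i = endValue e) : ∃ ρ : S ⟶ S, (∀ i, τ (ρ.toOrderHom i) = endValue e) ∧
      ∀ i, τ i = endValue e → ρ.toOrderHom i = i := by
  classical
  let s : Finset (Fin (S.len + 1)) := Finset.univ.filter fun i => τ i = endValue e
  have hs : s.Nonempty := h.imp fun i hi => by simpa [s] using hi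
  have hmem : ∀ i, i ∈ s ↔ τ i = endValue e := fun i => by simp [s]
  cases e
  · have ht : τ (s.max' hs) = 0 := (hmem _).1 (s.max'_mem hs)
    refine ⟨SimplexCategory.Hom.mk ⟨fun i => min i (s.max' hs),
      fun _ _ h => min_le_min_right _ h⟩, fun i => ?_, fun i hi => ?_⟩
    · exact le_antisymm ((τ.monotone (min_le_right _ _)).trans_eq ht) (Fin.zero_le _)
    · exact min_eq_left (s.le_max' i ((hmem i).2 hi))
  · have ht : τ (s.min' hs) = 1 := (hmem _).1 (s.min'_mem hs)
    refine ⟨SimplexCategory.Hom.mk ⟨fun i => max i (s.min' hs),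
      fun _ _ h => max_le_max_right _ h⟩, fun i => ?_, fun i hi => ?_⟩
    · exact le_antisymm (Fin.le_last _) (ht.symm.trans_le (τ.monotone (le_max_right _ _)))
    · exact max_eq_left (s.min'_le i ((hmem i).2 hi))

end OrientalTrunc

/-! ### Functoriality of cones -/

namespace NCat

open OmegaCat ConeCell

variable {n : ℕ∞}

/-- The action of a functor on the cells of cones. -/
def coneMapFun {D D' : NCat.{u} n} (f : D ⟶ D') : ConeCell D.obj → ConeCell D'.obj
  | inn x => inn (app f x)
  | mid x h => mid (app f x) fun a => by rw [← app_bd, h]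
  | out => out

theorem coneMapFun_midEnd {D D' : NCat.{u} n} (f : D ⟶ D') (e : Bool) (x : D.obj.Cell) :
    coneMapFun f (midEnd e x) = midEnd e (app f x) := by
  simp only [coneMapFun, midEnd, app_bd]

/-- The functor between cones induced by a functor. -/
noncomputable def coneMap (hn : 1 ≤ n) (e : Bool) {D D' : NCat.{u} n} (f : D ⟶ D') :
    cone hn e D ⟶ cone hn e D' :=
  homMk (coneMapFun f)
    (fun a k x => by
      change coneMapFun f (ConeCell.bd e a k x) = ConeCell.bd e a k (coneMapFun f x)
      cases x with
      | inn x => simp [coneMapFun, app_bd]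
      | mid x h =>
        cases k with
        | zero => simp only [bd_zero_mid, coneMapFun]; split_ifs <;> rfl
        | succ k => rfl
      | out => simp [coneMapFun])
    (fun k x y h hc => by
      change ConeCell.bd e false k x = ConeCell.bd e true k y at h
      change coneMapFun f (ConeCell.comp e k x y) =
        ConeCell.comp e k (coneMapFun f x) (coneMapFun f y)
      clear hc
      cases x <;> cases y <;> try rfl
      · rename_i x y
        have h' : D.obj.bd false k x = D.obj.bd true k y := by simpa using h
        rw [comp_inn h', coneMapFun, coneMapFun, coneMapFun, comp_inn (app_composable f h'),
          app_comp]
      · exact coneMapFun_midEnd f e _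
      · exact coneMapFun_midEnd f e _)

end NCat

/-! ### Categories generated by nerves: sieves and cosieves -/

namespace NCat

open OmegaCat ConeCell

variable {n : ℕ∞}

/-- The functor `g` matters only on cells whose far end is in `o`, and otherwise only at the near
vertex. This permits replacing it by functors that agree just there. -/
theorem conePairFun_congr {e : Bool} {A A' D : NCat.{u} n} {g : A ⟶ D} {g' : A' ⟶ D}
    {o : A.obj.Cell → Prop} {o' : A'.obj.Cell → Prop} {x : A.obj.Cell} {x' : A'.obj.Cell}
    (ho : ∀ a, o (A.obj.bd a 0 x) ↔ o' (A'.obj.bd a 0 x'))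
    (h : o (A.obj.bd (!e) 0 x) → app g x = app g' x')
    (hm : o (A.obj.bd e 0 x) → app g (A.obj.bd e 0 x) = app g' (A'.obj.bd e 0 x')) :
    conePairFun e g o x = conePairFun e g' o' x' := by
  by_cases h₁ : o (A.obj.bd (!e) 0 x)
  · rw [conePairFun, conePairFun, if_pos h₁, if_pos ((ho _).1 h₁), h h₁]
  by_cases h₂ : o (A.obj.bd e 0 x)
  · rw [conePairFun, conePairFun, if_neg h₁, if_neg (h₁ ∘ (ho _).2), if_pos h₂,
      if_pos ((ho _).1 h₂)]
    refine midEnd_congr ?_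
    rw [← app_bd, ← app_bd, hm h₂]
  · rw [conePairFun, conePairFun, if_neg h₁, if_neg (h₁ ∘ (ho _).2), if_neg h₂,
      if_neg (h₂ ∘ (ho _).2)]

theorem conePairFun_of_not {e : Bool} {A D : NCat.{u} n} (g : A ⟶ D) {o : A.obj.Cell → Prop}
    {x : A.obj.Cell} (ho : ∀ a, ¬ o (A.obj.bd a 0 x)) : conePairFun e g o x = out := by
  rw [conePairFun, if_neg (ho _), if_neg (ho _)]

theorem coneMapFun_conePairFun (e : Bool) {A D D' : NCat.{u} n} (g : A ⟶ D) (f : D ⟶ D')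
    (o : A.obj.Cell → Prop) (x : A.obj.Cell) :
    coneMapFun f (conePairFun e g o x) = conePairFun e (g ≫ f) o x := by
  simp only [conePairFun]
  split_ifs
  · rfl
  · exact coneMapFun_midEnd f e _
  · rfl

end NCat

namespace StreetNerve

open PartOrd NCat Opposite OrientalTrunc

variable {n : ℕ∞} {E E' : PartOrd.{u}} {S S' : SimplexCategory}

/-- The simplex `s'` is the restriction of the simplex `s` along a retraction `ρ` of the vertices
onto those over the `e`-end of `{0 < 1}`. -/
structure IsLift (e : Bool) (j : E' ⟶ E) (χ : E →o Fin 2) (s : Fin (S.len + 1) →o E) (ρ : S ⟶ S)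
    (s' : Fin (S.len + 1) →o E') : Prop where
  map_eq : ∀ i, j (s' i) = s (ρ.toOrderHom i)
  eq_self : ∀ i, χ (s i) = endValue e → ρ.toOrderHom i = i

theorem exists_isLift {e : Bool} {j : E' ⟶ E} {χ : E →o Fin 2} (hle : ∀ x y, j x ≤ j y → x ≤ y)
    (hr : ∀ x, (∃ y, j y = x) ↔ χ x = endValue e) (s : Fin (S.len + 1) →o E)
    (h : ∃ i, χ (s i) = endValue e) : ∃ ρ s', IsLift e j χ s ρ s' := by
  obtain ⟨ρ, h₁, h₂⟩ := exists_retraction (χ.comp s) h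
  choose t ht using fun i => (hr (s (ρ.toOrderHom i))).2 (h₁ i)
  refine ⟨ρ, ⟨t, fun i k hik => hle _ _ ?_⟩, ht, h₂⟩
  rw [ht, ht]
  exact s.monotone (ρ.toOrderHom.monotone hik)

section

variable {c : SSet.{u} ⥤ NCat.{u} n} (adj : c ⊣ streetNerve.{u} n)
  {e : Bool} {j : E' ⟶ E} {χ : E →o Fin 2}

/-- The image of `s'` in `E` is `s` precomposed with `ρ`, and `ρ` fixes every cell whose far end is
over the `e`-end. -/
theorem IsLift.app_map_cellMap (hn : 1 ≤ n) {s : Fin (S.len + 1) →o E} {ρ : S ⟶ S}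
    {s' : Fin (S.len + 1) →o E'} (h : IsLift e j χ s ρ s')
    {x : ((truncatedOriental.{u} n).obj S).obj.Cell}
    (hx : χ (s (vtx hn (!e) x)) = endValue e) :
    app (cellMap adj s' ≫ c.map (nerveFunctor.map j)) x = app (cellMap adj s) x := by
  have : j.hom.comp s' = s.comp ρ.toOrderHom := by ext i; exact h.map_eq i
  rw [cellMap_map, this, cellMap_comp, comp_app,
    map_eq_self_of_vtx_not hn (τ := χ.comp s) h.eq_self hx]

/-- Retractions are not natural in the simplex, but `s₁` is `s₂` precomposed with `ρ₁ ≫ f`, and `ρ₁`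
fixes the cells considered. With `f` the identity, this also gives independence of the chosen lift.
-/
theorem IsLift.app_cellMap (hn : 1 ≤ n) (hle : ∀ x y, j x ≤ j y → x ≤ y)
    (hr : ∀ x, (∃ y, j y = x) ↔ χ x = endValue e) {f : S ⟶ S'}
    {s : Fin (S'.len + 1) →o E} {ρ₁ : S ⟶ S} {s₁ : Fin (S.len + 1) →o E'}
    {ρ₂ : S' ⟶ S'} {s₂ : Fin (S'.len + 1) →o E'}
    (h₁ : IsLift e j χ (s.comp f.toOrderHom) ρ₁ s₁) (h₂ : IsLift e j χ s ρ₂ s₂)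
    {x : ((truncatedOriental.{u} n).obj S).obj.Cell}
    (hx : χ (s (f.toOrderHom (vtx hn (!e) x))) = endValue e) :
    app (cellMap adj s₁) x = app (cellMap adj s₂) (app ((truncatedOriental.{u} n).map f) x) := by
  have hs : s₁ = s₂.comp (ρ₁ ≫ f).toOrderHom := by
    ext i
    have hi : j (s₁ i) = j (s₂ (f.toOrderHom (ρ₁.toOrderHom i))) := by
      have := h₁.map_eq i
      -- The vertex `f (ρ₁ i)` already lies over the `e`-end, so `ρ₂` does not move it.
      rw [h₂.map_eq, h₂.eq_self _ ((hr _).1 ⟨_, this⟩), this]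
      rfl
    exact le_antisymm (hle _ _ hi.le) (hle _ _ hi.ge)
  have hρ : app ((truncatedOriental.{u} n).map ρ₁) x = x :=
    map_eq_self_of_vtx_not hn (τ := χ.comp (s.comp f.toOrderHom)) h₁.eq_self hx
  rw [hs, cellMap_comp, CategoryTheory.Functor.map_comp, comp_app, comp_app, hρ]

/-- On each simplex meeting `E'`, a lift along a retraction determines a functor to the cone; a
simplex missing `E'` goes to the added object. The description holds for every lift, not only the
chosen one, so that convenient lifts may be used later. -/
theorem exists_functor_cone (hn : 1 ≤ n) (hle : ∀ x y, j x ≤ j y → x ≤ y)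
    (hr : ∀ x, (∃ y, j y = x) ↔ χ x = endValue e) :
    ∃ d : c.obj (nerveFunctor.obj E) ⟶ cone hn e (c.obj (nerveFunctor.obj E')),
      ∀ (S : SimplexCategory) (s : Fin (S.len + 1) →o E)
        (x : ((truncatedOriental.{u} n).obj S).obj.Cell),
        (∀ ρ s', IsLift e j χ s ρ s' → app (cellMap adj s ≫ d) x =
          conePairFun e (cellMap adj s') (fun y => χ (s (vtx hn false y)) = endValue e) x) ∧
        ((¬ ∃ i, χ (s i) = endValue e) →
          app (cellMap adj s ≫ d) x = (OmegaCat.ConeCell.out : OmegaCat.ConeCell _)) := by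
  have hψ : ∀ (S : SimplexCategory) (s : Fin (S.len + 1) →o E),
      ∃ ψ : (truncatedOriental.{u} n).obj S ⟶ cone hn e (c.obj (nerveFunctor.obj E')), ∀ x,
        (∀ ρ s', IsLift e j χ s ρ s' → app ψ x =
          conePairFun e (cellMap adj s') (fun y => χ (s (vtx hn false y)) = endValue e) x) ∧
        ((¬ ∃ i, χ (s i) = endValue e) →
          app ψ x = (OmegaCat.ConeCell.out : OmegaCat.ConeCell _)) := by
    intro S s
    by_cases hs : ∃ i, χ (s i) = endValue e
    · obtain ⟨ρ, s', h⟩ := exists_isLift hle hr s hs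
      refine ⟨conePair hn e (cellMap adj s') (fun y => χ (s (vtx hn false y)) = endValue e)
        (fun x hx => ?_), fun x => ⟨fun ρ₁ s₁ h₁ => ?_, fun h => absurd hs h⟩⟩
      · rw [vtx_bd_zero] at hx ⊢
        exact vtx_eq_of_vtx_not hn (χ.comp s) x hx
      · have key : ∀ y, χ (s (vtx hn (!e) y)) = endValue e →
            app (cellMap adj s') y = app (cellMap adj s₁) y := fun y hy => by
          have := IsLift.app_cellMap adj hn hle hr (f := 𝟙 S) (s := s) h h₁ hy
          rwa [CategoryTheory.Functor.map_id, id_app] at this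
        rw [conePair_app]
        refine conePairFun_congr (fun _ => Iff.rfl) (fun hx => key x ?_) (fun hx => key _ ?_)
        · rwa [vtx_bd_zero] at hx
        · rw [vtx_bd_zero] at hx ⊢
          exact hx
    · refine ⟨coneOut hn e _ _, fun x => ⟨fun ρ s' h => ?_, fun _ => rfl⟩⟩
      exact absurd ⟨_, (hr _).1 ⟨_, h.map_eq 0⟩⟩ hs
  choose ψ hψ using hψ
  obtain ⟨d, hd⟩ := exists_desc adj ψ fun S S' f s => by
    ext x
    rw [comp_app]
    by_cases hs : ∃ i, χ (s i) = endValue e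
    · obtain ⟨ρ₂, s₂, h₂⟩ := exists_isLift hle hr s hs
      rw [((hψ S' s _).1 ρ₂ s₂ h₂)]
      by_cases hf : ∃ i, χ ((s.comp f.toOrderHom) i) = endValue e
      · obtain ⟨ρ₁, s₁, h₁⟩ := exists_isLift hle hr _ hf
        rw [((hψ S _ _).1 ρ₁ s₁ h₁)]
        refine conePairFun_congr (fun a => ?_) (fun hx => ?_) (fun hx => ?_)
        · rw [vtx_bd_zero, vtx_bd_zero, vtx_map]; rfl
        · rw [vtx_bd_zero] at hx
          exact h₁.app_cellMap adj hn hle hr h₂ hx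
        · rw [← app_bd]
          refine h₁.app_cellMap adj hn hle hr h₂ ?_
          rw [vtx_bd_zero] at hx ⊢
          exact hx
      -- The restricted simplex misses `E'` although `s` does not: all its cells have both ends
      -- outside the fibre and go to the added object on either side.
      · rw [(hψ S _ _).2 hf]
        refine (conePairFun_of_not _ fun a h => ?_).symm
        rw [vtx_bd_zero, vtx_map] at h
        exact hf ⟨_, h⟩
    · rw [(hψ S' _ _).2 hs, (hψ S _ _).2 fun ⟨i, hi⟩ => hs ⟨_, hi⟩]
  exact ⟨d, fun S s => by rw [hd]; exact hψ S s⟩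

theorem exists_functor_two (hn : 1 ≤ n) (χ : E →o Fin 2) :
    ∃ χ' : c.obj (nerveFunctor.obj E) ⟶ (ofPoset n hn).obj two.{u},
      ∀ (S : SimplexCategory) (s : Fin (S.len + 1) →o E)
        (x : ((truncatedOriental.{u} n).obj S).obj.Cell),
        (objVal χ' (app (cellMap adj s) x)).down = χ (s (vtx hn false x)) := by
  let χ₁ : E →o two.{u} := ⟨fun x => ⟨χ x⟩, fun _ _ h => χ.monotone h⟩
  obtain ⟨χ', h⟩ := exists_desc adj (fun S s => toPoset hn (P := two.{u}) (χ₁.comp s))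
    fun S S' f s => (map_toPoset hn f (χ₁.comp s)).symm
  refine ⟨χ', fun S s x => ?_⟩
  rw [← objVal_comp, h, OrientalTrunc.objVal_toPoset]
  rfl

end

theorem isInverseImage_endpoint_map {c : SSet.{u} ⥤ NCat.{u} n} (adj : c ⊣ streetNerve.{u} n) (hn : 1 ≤ n)
    {e : Bool} {j : E' ⟶ E}
    (h : IsInverseImage (PartOrd.endpoint.{u} (endValue e)) j) :
    IsInverseImage ((ofPoset n hn).map (PartOrd.endpoint.{u} (endValue e)))
      (c.map (nerveFunctor.map j)) := by
  obtain ⟨χ, hle, hr⟩ := exists_of_isInverseImage_endpoint h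
  obtain ⟨χ', hχ'⟩ := exists_functor_two adj hn χ
  obtain ⟨d, hd⟩ := exists_functor_cone adj hn hle hr
  have hover : ∀ y, Over χ' (endValue e) (app (c.map (nerveFunctor.map j)) y) := by
    have : c.map (nerveFunctor.map j) ≫ χ' = NCat.toPoset hn two.{u}
        (fun _ => ⟨endValue e⟩) fun _ => le_rfl := by
      refine cellMap_hom_ext adj fun S s => toPoset_ext fun x a => ?_
      rw [objVal_comp, objVal_comp, objVal_comp, ← comp_app, cellMap_map]
      exact ULift.ext _ _ ((hχ' _ _ _).trans ((hr _).1 ⟨_, rfl⟩))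
    intro y
    rw [over_iff]
    intro a
    rw [← app_bd, ← objVal_comp, this]
    rfl
  have hinj : ∀ y, app d (app (c.map (nerveFunctor.map j)) y) =
      (OmegaCat.ConeCell.inn y : OmegaCat.ConeCell _) := by
    have : c.map (nerveFunctor.map j) ≫ d = conePair hn e (𝟙 _) (fun _ => True) fun _ h => h := by
      refine cellMap_hom_ext adj fun S s => ?_
      rw [← Category.assoc, cellMap_map]
      ext x
      -- A simplex coming from `E'` is its own lift, along the identity retraction.
      rw [(hd S _ x).1 (𝟙 S) s ⟨fun _ => rfl, fun _ _ => rfl⟩, comp_app, conePair_app]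
      refine conePairFun_congr (fun a => ?_) (fun _ => rfl) (fun _ => app_bd _ _ _ _)
      exact iff_true_intro ((hr _).1 ⟨_, rfl⟩)
    intro y
    rw [← comp_app, this]
    exact if_pos trivial
  refine (isInverseImage_endpoint_iff _ _).2 ⟨χ', fun x y hxy => ?_, fun z => ⟨?_, fun hz => ?_⟩⟩
  · have := congrArg (app d) hxy
    rw [hinj, hinj] at this
    exact OmegaCat.ConeCell.inn.inj this
  · rintro ⟨y, rfl⟩
    exact hover y
  -- Going to the cone on `c_n N E'` and back to the cone on `c_n N E` is the identity on the fibre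
  -- of `χ'` and collapses the objects outside it, as is checked on each simplex.
  · have key : d ≫ coneMap hn e (c.map (nerveFunctor.map j)) =
        conePair hn e (𝟙 _) (fun x => (objVal χ' x).down = endValue e) fun x hx => by
          have := objVal_le χ' x
          have : (objVal χ' _).down ≤ (objVal χ' _).down := this
          cases e
          · exact le_antisymm (this.trans_eq hx) (Fin.zero_le _)
          · exact le_antisymm (Fin.le_last _) (hx.symm.trans_le this) := by
      refine cellMap_hom_ext adj fun S s => ?_
      rw [← Category.assoc]
      ext x
      change coneMapFun (c.map (nerveFunctor.map j)) (app (cellMap adj s ≫ d) x) =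
        conePairFun e (𝟙 _) (fun x => (objVal χ' x).down = endValue e) (app (cellMap adj s) x)
      by_cases hs : ∃ i, χ (s i) = endValue e
      · obtain ⟨ρ, s', h'⟩ := exists_isLift hle hr s hs
        rw [(hd S s x).1 ρ s' h', coneMapFun_conePairFun]
        refine conePairFun_congr (fun a => ?_) (fun hx => ?_) (fun hx => ?_)
        · rw [← app_bd, hχ']
        · rw [vtx_bd_zero] at hx
          exact h'.app_map_cellMap adj hn hx
        · rw [← app_bd]
          refine h'.app_map_cellMap adj hn ?_
          rw [vtx_bd_zero] at hx ⊢
          exact hx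
      · rw [(hd S s x).2 hs]
        refine (conePairFun_of_not _ fun a h => ?_).symm
        rw [← app_bd, hχ'] at h
        exact hs ⟨_, h⟩
    have hz' := congrArg (fun g => app g z) key
    simp only [comp_app, conePair_app, conePairFun] at hz'
    rw [if_pos ((over_iff _ _ _).1 hz _)] at hz'
    -- For `z` in the fibre, the cone map sends `app d z` to the cell `z` of the base, so `app d z`
    -- is itself a base cell `y`, and `y` maps to `z`.
    generalize app d z = w at hz'
    cases w with
    | inn y => exact ⟨y, OmegaCat.ConeCell.inn.inj hz'⟩
    | mid y h => cases hz'
    | out => cases hz'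

end StreetNerve

theorem proposition5p13 (n : ℕ∞) (hn : 1 ≤ n) :
    -- the nerve `N_n` has a left adjoint `c_n`
    (streetNerve.{u} n).IsRightAdjoint ∧
    -- `N_n` commutes with small filtered colimits
    PreservesFilteredColimitsOfSize.{u, u} (streetNerve.{u} n) ∧
    -- `N_n` sends cocartesian squares of cosieves to cocartesian squares
    (∀ (A A' B B' : NCat.{u} n) (a : A ⟶ A') (i : A ⟶ B) (i' : A' ⟶ B') (b : B ⟶ B'),
      IsPushout a i i' b →
      NCat.IsCosieve hn a → NCat.IsCosieve hn i → NCat.IsCosieve hn i' → NCat.IsCosieve hn b →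
      IsPushout ((streetNerve.{u} n).map a) ((streetNerve.{u} n).map i)
        ((streetNerve.{u} n).map i') ((streetNerve.{u} n).map b)) ∧
    -- `c_n N` preserves sieves and cosieves, for any choice `c` of the left adjoint `c_n`
    (∀ (c : SSet.{u} ⥤ NCat.{u} n), Nonempty (c ⊣ streetNerve.{u} n) →
      ∀ (E' E : PartOrd.{u}) (j : E' ⟶ E),
        (PartOrd.IsSieve j → NCat.IsSieve hn (c.map (PartOrd.nerveFunctor.map j))) ∧
        (PartOrd.IsCosieve j → NCat.IsCosieve hn (c.map (PartOrd.nerveFunctor.map j)))) :=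
  ⟨StreetNerve.isRightAdjoint n, StreetNerve.preservesFilteredColimits n,
    fun _ _ _ _ _ _ _ _ h ha hi hi' hb => StreetNerve.isPushout_of_isCosieve h ha hi hi' hb,
    fun _ ⟨adj⟩ _ _ _ => ⟨StreetNerve.isInverseImage_endpoint_map adj (e := false) hn,
      StreetNerve.isInverseImage_endpoint_map adj (e := true) hn⟩⟩
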